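/- Fix a dimension $d$. Let $P=\{p_1,\dots,p_n\}\subseteq\mathbb{R}^d$ be a set of $n$ distinct points, where $p_i$ has a positive integer weight $w_i$, and let $W=\sum_i w_i$. A point of weight $w_i$ is treated as $w_i$ points at the same location, so that $P$ stands for a family of $W$ points. For integers $1\le m\le W-1$ and $1\le k\le W$, let $d_m(q)$ be the Euclidean distance from a point $q$ of this family to its $m$-th nearest neighbour among the other $W-1$ points of the family, and let $f(P,m,k)$ be the $k$-th smallest number in the multiset of the $W$ values $d_m(q)$ (so $d_m(p_i)$ is counted $w_i$ times). The value $f(P,m,k)$ can be $(1+\varepsilon)$-approximated in expected $O(n/\varepsilon^d)$ time. That is, for every $d$ there are a randomized algorithm and a constant $C$, both depending only on $d$, such that on every input consisting of such a weighted set $P$, of $m$ and $k$ as above, and of a real number $0<\varepsilon\le 1$, the expected number of steps of the algorithm is at most $C\,n/\varepsilon^d$, and whenever the algorithm halts (which therefore happens with probability $1$) it has computed a number $v$ with $$f(P,m,k)\le v\le(1+\varepsilon)\,f(P,m,k).$$ The model of computation is the real RAM with, at unit cost, exact real arithmetic, square roots, comparisons, the floor function, indirect addressing by integers (cells are initially $0$),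 and the generation of a uniformly random element of $\{0,\dots,N-1\}$ for a computed integer $N\geq 1$; the only constants in a program are integers. -/

import Mathlib

noncomputable section

namespace RealRAM

/-! A randomized real RAM with structured programs: unit-cost exact arithmetic on real numbers,
square roots, the floor function, comparisons, indirect addressing, and random integers. -/

/-- The memory: scalar registers and arrays, each cell holding a real number.  The cells of an
array are addressed by arbitrary integers, so that a cell also serves as an entry of a table
with constant-time lookup. -/
structure Store where
  reg : ℕ → ℝ
  arr : ℕ → ℤ → ℝ

/-- Arithmetic terms.  The only constants are integers.  `read a t` is the content of the cell
with address `⌊t⌋` of array number `a`. -/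
inductive Term where
  | const (z : ℤ)
  | var (x : ℕ)
  | read (a : ℕ) (t : Term)
  | add (s t : Term)
  | sub (s t : Term)
  | mul (s t : Term)
  | div (s t : Term)
  | sqrt (t : Term)
  | floor (t : Term)

def Term.eval (σ : Store) : Term → ℝ
  | const z => (z : ℝ)
  | var x => σ.reg x
  | read a t => σ.arr a ⌊t.eval σ⌋
  | add s t => s.eval σ + t.eval σ
  | sub s t => s.eval σ - t.eval σ
  | mul s t => s.eval σ * t.eval σ
  | div s t => s.eval σ / t.eval σ
  | sqrt t => √(t.eval σ)
  | floor t => (⌊t.eval σ⌋ : ℝ)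

/-- Boolean tests. -/
inductive Test where
  | lt (s t : Term)
  | not (b : Test)
  | and (b c : Test)

def Test.holds (σ : Store) : Test → Prop
  | lt s t => s.eval σ < t.eval σ
  | not b => ¬ b.holds σ
  | and b c => b.holds σ ∧ c.holds σ

/-- Programs.  `set x t` assigns to register `x`; `write a i t` assigns to the cell with address
`⌊i⌋` of array `a`; `rand x t` assigns to register `x` a uniformly random element of
`{0, …, N - 1}`, where `N = ⌊t⌋` (and `0` if `N ≤ 0`). -/
inductive Cmd where
  | skip
  | set (x : ℕ) (t : Term)
  | write (a : ℕ) (i t : Term)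
  | rand (x : ℕ) (t : Term)
  | seq (P Q : Cmd)
  | ite (b : Test) (P Q : Cmd)
  | loop (b : Test) (P : Cmd)

def Store.setReg (σ : Store) (x : ℕ) (v : ℝ) : Store :=
  { σ with reg := Function.update σ.reg x v }

def Store.setCell (σ : Store) (a : ℕ) (i : ℤ) (v : ℝ) : Store :=
  { σ with arr := Function.update σ.arr a (Function.update (σ.arr a) i v) }

/-- A configuration: the stack of programs still to be executed, and the memory. -/
structure Config where
  todo : List Cmd
  store : Store

/-- The machine has halted when nothing is left to be executed. -/
def Config.Halted (c : Config) : Prop := c.todo = []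

open Classical in
/-- One step of the machine, as a distribution on the next configuration.  The terms and tests
of a program have fixed sizes, so evaluating one of them is charged as part of a single step. -/
def step : Config → PMF Config
  | ⟨[], σ⟩ => PMF.pure ⟨[], σ⟩
  | ⟨.skip :: K, σ⟩ => PMF.pure ⟨K, σ⟩
  | ⟨.set x t :: K, σ⟩ => PMF.pure ⟨K, σ.setReg x (t.eval σ)⟩
  | ⟨.write a i t :: K, σ⟩ => PMF.pure ⟨K, σ.setCell a ⌊i.eval σ⌋ (t.eval σ)⟩
  | ⟨.rand x t :: K, σ⟩ =>
      (PMF.uniformOfFintype (Fin (⌊t.eval σ⌋₊ - 1 + 1))).map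
        fun u => ⟨K, σ.setReg x ((u : ℕ) : ℝ)⟩
  | ⟨.seq P Q :: K, σ⟩ => PMF.pure ⟨P :: Q :: K, σ⟩
  | ⟨.ite b P Q :: K, σ⟩ => PMF.pure (if b.holds σ then ⟨P :: K, σ⟩ else ⟨Q :: K, σ⟩)
  | ⟨.loop b P :: K, σ⟩ =>
      PMF.pure (if b.holds σ then ⟨P :: .loop b P :: K, σ⟩ else ⟨K, σ⟩)

/-- The distribution of the configuration after `t` steps. -/
def after : ℕ → Config → PMF Config
  | 0, c => PMF.pure c
  | t + 1, c => (step c).bind (after t)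

/-- The configuration in which program `P` starts on memory `σ`. -/
def start (P : Cmd) (σ : Store) : Config := ⟨[P], σ⟩

/-- The expected number of steps before halting.  If `T` is this (possibly infinite) number,
then `T > t` means that the machine, which never leaves a halted configuration, has not halted
after `t` steps, and the expectation of `T` is the sum over `t` of the probability of `T > t`. -/
def expectedTime (P : Cmd) (σ : Store) : ENNReal :=
  ∑' t : ℕ, (after t (start P σ)).toOuterMeasure {c | ¬ c.Halted}

/-- Every computation of `P` on `σ` of positive probability that halts leaves in register `0`
a number with the property `good`. -/
def OutputsOnly (P : Cmd) (σ : Store) (good : ℝ → Prop) : Prop :=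
  ∀ (t : ℕ), ∀ c ∈ (after t (start P σ)).support, c.Halted → good (c.store.reg 0)

end RealRAM

namespace NeighborDistance

/-- The `k`-th smallest element of a multiset of reals, with repetitions
(for `1 ≤ k ≤ s.card`). -/
def kthSmallest (k : ℕ) (s : Multiset ℝ) : ℝ :=
  (s.sort (· ≤ ·)).getD (k - 1) 0

/-- The distance from the point with index `a` to its `m`-th nearest neighbor among the other
points of the finite family `q`. -/
def mthNeighborDist {ι E : Type*} [Fintype ι] [DecidableEq ι] [MetricSpace E]
    (q : ι → E) (m : ℕ) (a : ι) : ℝ :=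
  kthSmallest m ((Finset.univ.erase a).val.map fun b => dist (q a) (q b))

/-- The `k`-th smallest number in the multiset of the `m`-th nearest neighbor distances of all
points of the finite family `q`. -/
def kthMthNeighborDist {ι E : Type*} [Fintype ι] [DecidableEq ι] [MetricSpace E]
    (q : ι → E) (m k : ℕ) : ℝ :=
  kthSmallest k (Finset.univ.val.map fun a => mthNeighborDist q m a)

/-- The family of unit-weight points represented by a weighted point set: point `p i` of weight
`w i` stands for `w i` points at the same location. -/
def copies {n : ℕ} {E : Type*} (p : Fin n → E) (w : Fin n → ℕ) (a : Σ i : Fin n, Fin (w i)) : E :=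
  p a.1

/-- The initial memory: registers `0, 1, 2, 3` hold `n, m, k, ε`; for `j < d`, array `j` holds
the `j`-th coordinates of the `n` points, in the cells `0, …, n - 1`; array `d` holds the
weights, in the same cells; everything else is `0`. -/
def inputStore {d n : ℕ} (p : Fin n → EuclideanSpace ℝ (Fin d)) (w : Fin n → ℕ)
    (m k : ℕ) (ε : ℝ) : RealRAM.Store where
  reg x := if x = 0 then n else if x = 1 then m else if x = 2 then k else if x = 3 then ε else 0
  arr a z :=
    if hz : 0 ≤ z ∧ z.toNat < n then
      if ha : a < d then p ⟨z.toNat, hz.2⟩ ⟨a, ha⟩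
      else if a = d then w ⟨z.toNat, hz.2⟩
      else 0
    else 0

end NeighborDistance

end

noncomputable section

/-! ### Reading the memory after an update. -/

namespace RealRAM

/-! The method is net-and-prune. By `kthMthNeighborDist_copies_le_iff`, the inequality f ≤ r is the
monotone predicate `Reach`: points of total weight at least k see total weight at least m + 1 within
distance r. Rounding points to cells of side η changes a distance by at most (d + 1) η. Hence `scan`
decides `Reach` up to an additive error of order η, for all radii i η with i ≤ I at once, by looking
at (2 I + 1)^d cells per point.

If f = 0, this is visible from the weights alone (`reach_zero_iff`). Otherwise random rounds on a
shrinking weighted set find a scale L comparable with f. A round samples a point, takes its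
nearest-neighbour distance l, and sets L = max l (2 Λ), where Λ is the radius of the last merging.
Two scans compare f with L. If f is well below L, points isolated at that scale matter only through
their own weight; they are deleted and k is lowered accordingly (`WorkInv.prune`). This removes
every point whose nearest-neighbour distance is at least l. If f is well above L, points in a common
cell of side 4 L are merged (`WorkInv.net`). As the radii at least double, the accumulated
displacement is a geometric series and stays below a fixed fraction of f. The grid is shifted by one
of 2^d half-cell vectors chosen at random. Two points at distance at most L share a cell for at
least one of them (`exists_shift`), so a point with nearest-neighbour distance at most l is merged
with probability at least 2^(-d). In the remaining case L is within constant factors of f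
(`WorkInv.upper`, `WorkInv.lower`).

The sampled distance has central rank with probability at least 1/2, so in either shrinking case a
constant fraction of the set disappears on average (`sum_removed_ge`). A round takes time linear in
the current size, so the rounds take expected time O(n) (`rounds_cost_le`). One last scan of the
original input, with side of order ε L, gives the approximation in time O(n / ε^d) (`select_run`).

Correctness and expected time are proved together: `cost` charges an infinite price for a wrong
output, so a finite bound that is uniform in the number of steps yields both (`spec_of_cost_le`). -/

@[simp] lemma Store.setReg_reg (σ : Store) (x y : ℕ) (v : ℝ) :
    (σ.setReg x v).reg y = if y = x then v else σ.reg y := by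
  simp [Store.setReg, Function.update_apply]

@[simp] lemma Store.setReg_arr (σ : Store) (x : ℕ) (v : ℝ) : (σ.setReg x v).arr = σ.arr := rfl

@[simp] lemma Store.setCell_reg (σ : Store) (a : ℕ) (i : ℤ) (v : ℝ) :
    (σ.setCell a i v).reg = σ.reg := rfl

@[simp] lemma Store.setCell_arr (σ : Store) (a b : ℕ) (i j : ℤ) (v : ℝ) :
    (σ.setCell a i v).arr b j = if b = a ∧ j = i then v else σ.arr b j := by
  simp only [Store.setCell, Function.update_apply]
  by_cases h : b = a
  · subst h; simp [Function.update_apply]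
  · simp [h]

lemma Store.setCell_arr_of_ne (σ : Store) {a b : ℕ} (i : ℤ) (v : ℝ) (h : b ≠ a) :
    (σ.setCell a i v).arr b = σ.arr b := by
  funext j; simp [h]

/-! ### Cost-to-go -/

open Classical in
/-- The expected number of steps among the first `N` ones, with an infinite penalty for halting
in a store that is not `good`. -/
def cost (good : Store → Prop) : ℕ → Config → ENNReal
  | 0, _ => 0
  | N + 1, c =>
      if c.Halted then (if good c.store then 0 else ⊤)
      else 1 + ∑' c', step c c' * cost good N c'

lemma step_halted {c : Config} (h : c.Halted) : step c = PMF.pure c := by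
  obtain ⟨l, σ⟩ := c
  cases (show l = [] from h)
  rfl

lemma tsum_pure_mul (c : Config) (f : Config → ENNReal) :
    ∑' c', (PMF.pure c) c' * f c' = f c := by
  rw [tsum_eq_single c]
  · simp
  · intro b hb
    simp [PMF.pure_apply, hb]

lemma tsum_map_mul {α : Type*} (p : PMF α) (g : α → Config) (f : Config → ENNReal) :
    ∑' c', (p.map g) c' * f c' = ∑' u, p u * f (g u) := by
  simp only [PMF.map_apply]
  simp_rw [← ENNReal.tsum_mul_right]
  rw [ENNReal.tsum_comm]
  congr 1
  funext u
  rw [tsum_eq_single (g u)]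
  · simp
  · intro c hc
    rw [if_neg hc, zero_mul]

lemma cost_mono (good : Store → Prop) (N : ℕ) (c : Config) :
    cost good N c ≤ cost good (N + 1) c := by
  induction N generalizing c with
  | zero => simp [cost]
  | succ N ih =>
    rw [cost, cost]
    split_ifs
    · exact le_rfl
    · exact le_rfl
    · gcongr
      exact ih _

/-- The survival probability at time 0 is the 1 charged by `cost`; the later ones form the same sum,
averaged over the first step. -/
lemma sum_notHalted_le_cost (good : Store → Prop) (N : ℕ) (c : Config) :
    ∑ t ∈ Finset.range N, (after t c).toOuterMeasure {c | ¬ c.Halted} ≤ cost good N c := by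
  induction N generalizing c with
  | zero => simp
  | succ N ih =>
    rw [cost]
    by_cases hc : c.Halted
    · have h : ∀ t, after t c = PMF.pure c := by
        intro t
        induction t with
        | zero => rfl
        | succ t iht => rw [after, step_halted hc, PMF.pure_bind, iht]
      have h0 : ∀ t, (after t c).toOuterMeasure {c | ¬ c.Halted} = 0 := by
        intro t
        rw [h t, PMF.toOuterMeasure_pure_apply]
        simp [hc]
      simp [h0]
    · rw [if_neg hc, Finset.sum_range_succ', add_comm]
      gcongr
      · simp only [after]
        rw [PMF.toOuterMeasure_pure_apply]
        split_ifs <;> simp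
      · calc ∑ t ∈ Finset.range N, (after (t + 1) c).toOuterMeasure {c | ¬ c.Halted}
            = ∑ t ∈ Finset.range N, ∑' c', step c c' *
                (after t c').toOuterMeasure {c | ¬ c.Halted} := by
              refine Finset.sum_congr rfl fun t _ => ?_
              rw [after, PMF.toOuterMeasure_bind_apply]
          _ = ∑' c', ∑ t ∈ Finset.range N, step c c' *
                (after t c').toOuterMeasure {c | ¬ c.Halted} :=
              (Summable.tsum_finsetSum fun _ _ => ENNReal.summable).symm
          _ ≤ _ := by
              gcongr with c'
              rw [← Finset.mul_sum]
              gcongr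
              exact ih c'

/-- The penalty travels back along a path of positive probability, since a nonzero multiple of
infinity is infinite. The fuel is `t + 1` because `cost` does not look at the configuration when the
fuel is 0. -/
lemma cost_eq_top (good : Store → Prop) (t : ℕ) (c c' : Config)
    (hc' : c' ∈ (after t c).support) (hh : c'.Halted) (hg : ¬ good c'.store) :
    cost good (t + 1) c = ⊤ := by
  induction t generalizing c with
  | zero =>
    simp only [after, PMF.support_pure, Set.mem_singleton_iff] at hc'
    subst hc'
    simp [cost, hh, hg]
  | succ t ih =>
    rw [after, PMF.mem_support_bind_iff] at hc'
    obtain ⟨c'', h1, h2⟩ := hc'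
    have h3 := ih c'' h2
    by_cases hc : c.Halted
    · rw [step_halted hc] at h1
      simp only [PMF.support_pure, Set.mem_singleton_iff] at h1
      subst h1
      rw [cost, if_pos hc] at h3 ⊢
      exact h3
    · rw [cost, if_neg hc, ENNReal.add_eq_top]
      right
      refine ENNReal.tsum_eq_top_of_eq_top ⟨c'', ?_⟩
      rw [h3]
      exact ENNReal.mul_top ((PMF.mem_support_iff _ _).1 h1)

/-- A finite bound excludes the penalty, hence every wrong output; the partial sums of the survival
probabilities stay below the same bound. -/
theorem spec_of_cost_le {P : Cmd} {σ : Store} {good : ℝ → Prop} {b : ENNReal} (hb : b ≠ ⊤)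
    (h : ∀ N, cost (fun τ => good (τ.reg 0)) N (start P σ) ≤ b) :
    OutputsOnly P σ good ∧ expectedTime P σ ≤ b := by
  constructor
  · intro t c hc hh
    by_contra hg
    have := h (t + 1)
    rw [cost_eq_top _ t _ c hc hh hg] at this
    exact hb (top_le_iff.1 this)
  · rw [expectedTime, ENNReal.tsum_eq_iSup_nat]
    exact iSup_le fun N => (sum_notHalted_le_cost _ N _).trans (h N)

/-! ### Deterministic runs -/

/-- `Steps t c c'`: the machine gets from `c` to `c'` in `t` deterministic steps. -/
inductive Steps : ℕ → Config → Config → Prop where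
  | refl (c : Config) : Steps 0 c c
  | head {t : ℕ} {c c' c'' : Config} (h : step c = PMF.pure c') (h' : Steps t c' c'') :
      Steps (t + 1) c c''

lemma Steps.trans {t t' : ℕ} {c c' c'' : Config} (h : Steps t c c') (h' : Steps t' c' c'') :
    Steps (t + t') c c'' := by
  induction h with
  | refl => simpa using h'
  | @head t _ _ _ h _ ih =>
    rw [show t + 1 + t' = t + t' + 1 by ring]
    exact .head h (ih h')

/-- The fuel is the same on both sides, thanks to `cost_mono`, so deterministic stretches need no
bookkeeping of fuel. -/
lemma Steps.cost_le {t : ℕ} {c c' : Config} (h : Steps t c c') (good : Store → Prop) (N : ℕ) :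
    cost good N c ≤ t + cost good N c' := by
  induction h with
  | refl => simp
  | @head t c c' c'' h _ ih =>
    have key : cost good N c ≤ 1 + cost good N c' := by
      cases N with
      | zero => simp [cost]
      | succ N =>
        by_cases hc : c.Halted
        · rw [step_halted hc] at h
          have : c = c' := by
            have h2 : c ∈ (PMF.pure c').support := by rw [← h]; simp
            simpa using h2
          subst this
          exact le_add_self
        · rw [cost, if_neg hc, h, tsum_pure_mul]
          gcongr
          exact cost_mono good N c'
    calc cost good N c ≤ 1 + cost good N c' := key
      _ ≤ 1 + (t + cost good N c'') := by gcongr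
      _ = _ := by push_cast; ring

/-- Here one unit of fuel is really spent; this is what lets the induction on the fuel in
`rounds_cost_le` proceed. -/
lemma cost_rand_le (good : Store → Prop) (N : ℕ) (x : ℕ) (t : Term) (K : List Cmd) (σ : Store)
    (M : ℕ) (hM : 0 < M) (ht : t.eval σ = M) :
    cost good (N + 1) ⟨.rand x t :: K, σ⟩ ≤
      1 + (∑ u ∈ Finset.range M, cost good N ⟨K, σ.setReg x u⟩) / M := by
  have hh : ¬ (⟨.rand x t :: K, σ⟩ : Config).Halted := by simp [Config.Halted]
  rw [cost, if_neg hh]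
  gcongr
  have hfl : ⌊t.eval σ⌋₊ - 1 + 1 = M := by rw [ht, Nat.floor_natCast]; omega
  have hstep : step ⟨.rand x t :: K, σ⟩ =
      (PMF.uniformOfFintype (Fin (⌊t.eval σ⌋₊ - 1 + 1))).map
        fun u : Fin (⌊t.eval σ⌋₊ - 1 + 1) => (⟨K, σ.setReg x ((u : ℕ) : ℝ)⟩ : Config) :=
    PMF.map_comp _ _ _
  rw [hstep, tsum_map_mul, tsum_fintype]
  simp only [PMF.uniformOfFintype_apply, Fintype.card_fin]
  rw [← Finset.mul_sum, Fin.sum_univ_eq_sum_range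
    (fun u => cost good N ⟨K, σ.setReg x (u : ℝ)⟩), hfl, ENNReal.div_eq_inv_mul]

/-! ### Written variables -/

/-- The registers a program may write. -/
def Cmd.regs : Cmd → List ℕ
  | .skip => []
  | .set x _ => [x]
  | .write _ _ _ => []
  | .rand x _ => [x]
  | .seq P Q => P.regs ++ Q.regs
  | .ite _ P Q => P.regs ++ Q.regs
  | .loop _ P => P.regs

/-- The arrays a program may write. -/
def Cmd.arrs : Cmd → List ℕ
  | .skip => []
  | .set _ _ => []
  | .write a _ _ => [a]
  | .rand _ _ => []
  | .seq P Q => P.arrs ++ Q.arrs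
  | .ite _ P Q => P.arrs ++ Q.arrs
  | .loop _ P => P.arrs

/-- `τ` differs from `σ` at most in what `P` may write. -/
structure Frame (P : Cmd) (σ τ : Store) : Prop where
  reg : ∀ x, x ∉ P.regs → τ.reg x = σ.reg x
  arr : ∀ a, a ∉ P.arrs → τ.arr a = σ.arr a

lemma Frame.refl (P : Cmd) (σ : Store) : Frame P σ σ := ⟨fun _ _ => rfl, fun _ _ => rfl⟩

lemma Frame.trans {P : Cmd} {σ τ ρ : Store} (h : Frame P σ τ) (h' : Frame P τ ρ) : Frame P σ ρ :=
  ⟨fun x hx => (h'.reg x hx).trans (h.reg x hx), fun a ha => (h'.arr a ha).trans (h.arr a ha)⟩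

lemma Frame.mono {P Q : Cmd} {σ τ : Store} (h : Frame P σ τ) (hr : P.regs ⊆ Q.regs)
    (ha : P.arrs ⊆ Q.arrs) : Frame Q σ τ :=
  ⟨fun x hx => h.reg x fun hx' => hx (hr hx'), fun a h' => h.arr a fun ha' => h' (ha ha')⟩

/-- Program `P`, started on `σ`, halts deterministically after at most `T` steps in a store
satisfying `Q`. -/
def Run (P : Cmd) (σ : Store) (T : ℕ) (Q : Store → Prop) : Prop :=
  ∃ t ≤ T, ∃ τ, Q τ ∧ Frame P σ τ ∧ ∀ K, Steps t ⟨P :: K, σ⟩ ⟨K, τ⟩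

lemma Run.conseq {P : Cmd} {σ : Store} {T T' : ℕ} {Q Q' : Store → Prop} (h : Run P σ T Q)
    (hT : T ≤ T') (hQ : ∀ τ, Frame P σ τ → Q τ → Q' τ) : Run P σ T' Q' := by
  obtain ⟨t, ht, τ, hτ, hf, hs⟩ := h
  exact ⟨t, ht.trans hT, τ, hQ τ hf hτ, hf, hs⟩

lemma Run.set {x : ℕ} {t : Term} {σ : Store} {Q : Store → Prop}
    (h : Q (σ.setReg x (t.eval σ))) : Run (.set x t) σ 1 Q :=
  ⟨1, le_rfl, _, h, ⟨fun y hy => by simp_all [Cmd.regs], fun _ _ => rfl⟩,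
    fun _ => .head rfl (.refl _)⟩

lemma Run.write {a : ℕ} {i t : Term} {σ : Store} {Q : Store → Prop}
    (h : Q (σ.setCell a ⌊i.eval σ⌋ (t.eval σ))) : Run (.write a i t) σ 1 Q :=
  ⟨1, le_rfl, _, h, ⟨fun _ _ => rfl, fun b hb =>
    Store.setCell_arr_of_ne _ _ _ (by simpa [Cmd.arrs] using hb)⟩, fun _ => .head rfl (.refl _)⟩

lemma Run.skip {σ : Store} {Q : Store → Prop} (h : Q σ) : Run .skip σ 1 Q :=
  ⟨1, le_rfl, _, h, .refl _ _, fun _ => .head rfl (.refl _)⟩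

lemma Run.seq {P P' : Cmd} {σ : Store} {T T' : ℕ} {R Q : Store → Prop} (h : Run P σ T R)
    (h' : ∀ τ, Frame P σ τ → R τ → Run P' τ T' Q) : Run (.seq P P') σ (T + T' + 1) Q := by
  obtain ⟨t, ht, τ, hτ, hf, hs⟩ := h
  obtain ⟨t', ht', τ', hτ', hf', hs'⟩ := h' τ hf hτ
  refine ⟨t + t' + 1, by omega, τ', hτ', ?_, fun K => ?_⟩
  · exact (hf.mono (by simp [Cmd.regs]) (by simp [Cmd.arrs])).trans
      (hf'.mono (by simp [Cmd.regs]) (by simp [Cmd.arrs]))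
  · exact .head rfl ((hs _).trans (hs' _))

lemma Run.ite {b : Test} {P P' : Cmd} {σ : Store} {T : ℕ} {Q : Store → Prop}
    (h : b.holds σ → Run P σ T Q) (h' : ¬ b.holds σ → Run P' σ T Q) :
    Run (.ite b P P') σ (T + 1) Q := by
  by_cases hb : b.holds σ
  · obtain ⟨t, ht, τ, hτ, hf, hs⟩ := h hb
    refine ⟨t + 1, by omega, τ, hτ, hf.mono (by simp [Cmd.regs]) (by simp [Cmd.arrs]),
      fun K => .head (c' := ⟨P :: K, σ⟩) (by simp [step, hb]) (hs K)⟩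
  · obtain ⟨t, ht, τ, hτ, hf, hs⟩ := h' hb
    refine ⟨t + 1, by omega, τ, hτ, hf.mono (by simp [Cmd.regs]) (by simp [Cmd.arrs]),
      fun K => .head (c' := ⟨P' :: K, σ⟩) (by simp [step, hb]) (hs K)⟩

/-! ### Straight-line programs -/

/-- Programs without loops and random choices. -/
def Cmd.Straight : Cmd → Prop
  | .skip => True
  | .set _ _ => True
  | .write _ _ _ => True
  | .rand _ _ => False
  | .seq P Q => P.Straight ∧ Q.Straight
  | .ite _ P Q => P.Straight ∧ Q.Straight
  | .loop _ _ => False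

open Classical in
/-- The effect of a straight-line program. -/
def Cmd.exec : Cmd → Store → Store
  | .skip, σ => σ
  | .set x t, σ => σ.setReg x (t.eval σ)
  | .write a i t, σ => σ.setCell a ⌊i.eval σ⌋ (t.eval σ)
  | .rand _ _, σ => σ
  | .seq P Q, σ => Q.exec (P.exec σ)
  | .ite b P Q, σ => if b.holds σ then P.exec σ else Q.exec σ
  | .loop _ _, σ => σ

def Cmd.size : Cmd → ℕ
  | .skip => 1
  | .set _ _ => 1
  | .write _ _ _ => 1
  | .rand _ _ => 1
  | .seq P Q => P.size + Q.size + 1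
  | .ite _ P Q => P.size + Q.size + 1
  | .loop _ P => P.size

lemma Run.straight {P : Cmd} (h : P.Straight) {σ : Store} {Q : Store → Prop}
    (hQ : Q (P.exec σ)) : Run P σ P.size Q := by
  induction P generalizing σ Q with
  | skip => exact .skip hQ
  | set => exact .set hQ
  | write => exact .write hQ
  | rand => exact h.elim
  | loop => exact h.elim
  | seq P P' ih ih' =>
    refine Run.seq (R := fun τ => τ = P.exec σ) (ih h.1 rfl) ?_
    rintro τ - rfl
    exact ih' h.2 hQ
  | ite b P P' ih ih' =>
    refine (Run.ite (T := P.size + P'.size) (fun hb => ?_) (fun hb => ?_)).conseq le_rfl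
      (fun _ _ => id)
    · exact (ih h.1 (by simpa [Cmd.exec, hb] using hQ)).conseq (by omega) (fun _ _ => id)
    · exact (ih' h.2 (by simpa [Cmd.exec, hb] using hQ)).conseq (by omega) (fun _ _ => id)

/-! ### Counting loops -/

/-- Execute `body` for `x = 0, 1, …` as long as `x` is less than register `y`. -/
def forUp (x y : ℕ) (body : Cmd) : Cmd :=
  .seq (.set x (.const 0))
    (.loop (.lt (.var x) (.var y)) (.seq body (.set x (.add (.var x) (.const 1)))))

/-- Each iteration pays 3 for the test, the unfolding of the sequence and the increment; the
initialization and the last test account for the other 3. The invariant at `i` refers to a store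
whose counter is already `i`, hence the `setReg` after the body. -/
theorem Run.forUp {x y : ℕ} {body : Cmd} {σ : Store} {Q : Store → Prop} (N T : ℕ)
    (I : ℕ → Store → Prop) (hy : σ.reg y = N) (hyb : y ∉ x :: body.regs) (hxb : x ∉ body.regs)
    (h0 : I 0 (σ.setReg x 0))
    (hstep : ∀ i < N, ∀ τ, Frame (forUp x y body) σ τ → τ.reg x = i → I i τ →
      Run body τ T (fun τ' => I (i + 1) (τ'.setReg x (i + 1))))
    (hQ : ∀ τ, Frame (RealRAM.forUp x y body) σ τ → τ.reg x = N → I N τ → Q τ) :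
    Run (RealRAM.forUp x y body) σ (N * (T + 3) + 3) Q := by
  set F := RealRAM.forUp x y body with hF
  have hregs : F.regs = x :: (body.regs ++ [x]) := rfl
  have harrs : F.arrs = body.arrs := by simp [hF, RealRAM.forUp, Cmd.arrs]
  have hyF : y ∉ F.regs := by simp_all
  set LP : Cmd := .loop (.lt (.var x) (.var y)) (.seq body (.set x (.add (.var x) (.const 1))))
    with hLP
  have key : ∀ j, ∀ i, i + j = N → ∀ τ, Frame F σ τ → τ.reg x = i → I i τ →
      ∃ t ≤ j * (T + 3) + 1, ∃ ρ, Frame F σ ρ ∧ ρ.reg x = N ∧ I N ρ ∧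
        ∀ K, Steps t ⟨LP :: K, τ⟩ ⟨K, ρ⟩ := by
    intro j
    induction j with
    | zero =>
      intro i hi τ hf hx hI
      have hi' : i = N := by omega
      subst hi'
      refine ⟨1, by omega, τ, hf, hx, hI, fun K => .head (c' := ⟨K, τ⟩) ?_ (.refl _)⟩
      simp [hLP, step, Test.holds, Term.eval, hx, hf.reg y hyF, hy]
    | succ j ih =>
      intro i hi τ hf hx hI
      obtain ⟨t, ht, τ', hI', hf', hs⟩ := hstep i (by omega) τ hf hx hI
      have hx' : τ'.reg x = i := by rw [hf'.reg x hxb, hx]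
      have hfF : Frame F σ (τ'.setReg x (i + 1)) := by
        refine (hf.trans (hf'.mono ?_ (by rw [harrs]; exact List.Subset.refl _))).trans ⟨?_, fun _ _ => rfl⟩
        · rw [hregs]
          exact fun z hz => by simp [hz]
        · intro z hz
          have : z ≠ x := by rintro rfl; simp [hregs] at hz
          simp [this]
      obtain ⟨t', ht', ρ, h1, h2, h3, h4⟩ := ih (i + 1) (by omega) _ hfF (by simp) hI'
      refine ⟨(t + (t' + 1)) + 1 + 1, ?_, ρ, h1, h2, h3, fun K => ?_⟩
      · have : (j + 1) * (T + 3) = j * (T + 3) + (T + 3) := by ring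
        omega
      · refine .head (c' := ⟨.seq body (.set x (.add (.var x) (.const 1))) :: LP :: K, τ⟩) ?_ ?_
        · have : (i : ℝ) < N := by exact_mod_cast (by omega : i < N)
          simp [hLP, step, Test.holds, Term.eval, hx, hf.reg y hyF, hy, this]
        · refine .head rfl ((hs _).trans (.head (c' := ⟨LP :: K, τ'.setReg x (i + 1)⟩) ?_ (h4 K)))
          simp [step, Term.eval, hx']
  obtain ⟨t, ht, ρ, h1, h2, h3, h4⟩ := key N 0 (by omega) (σ.setReg x 0)
    ⟨fun z hz => by
      have : z ≠ x := by rintro rfl; simp [hregs] at hz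
      simp [this], fun _ _ => rfl⟩ (by simp) h0
  refine ⟨t + 1 + 1, by omega, ρ, hQ ρ h1 h2 h3, h1, fun K => ?_⟩
  refine .head rfl (.head (c' := ⟨LP :: K, σ.setReg x 0⟩) ?_ (h4 K))
  simp [step, Term.eval, hLP]

end RealRAM

namespace NeighborDistance
open Finset

/-! ### Counting weights -/

open Classical in
/-- The total weight of the `j < s` for which the `i < s` related to `j` have total weight at
least `m + 1`. -/
def deepWeight (s : ℕ) (R : ℕ → ℕ → Prop) (w : ℕ → ℝ) (m : ℝ) : ℝ :=
  ∑ j ∈ range s, if m + 1 ≤ ∑ i ∈ range s, (if R j i then w i else 0) then w j else 0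

lemma deepWeight_mono {s : ℕ} {R R' : ℕ → ℕ → Prop} {w : ℕ → ℝ} {m : ℝ}
    (hw : ∀ i < s, 0 ≤ w i) (h : ∀ j < s, ∀ i < s, R j i → R' j i) :
    deepWeight s R w m ≤ deepWeight s R' w m := by
  classical
  unfold deepWeight
  refine sum_le_sum fun j hj => ?_
  rw [mem_range] at hj
  have h1 : ∑ i ∈ range s, (if R j i then w i else 0) ≤
      ∑ i ∈ range s, (if R' j i then w i else 0) := by
    refine sum_le_sum fun i hi => ?_
    rw [mem_range] at hi
    have := h j hj i hi
    have := hw i hi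
    split_ifs <;> simp_all
  have := hw j hj
  split_ifs with h2 h3
  · exact le_rfl
  · exact absurd (h2.trans h1) h3
  · exact this
  · exact le_rfl

/-- Merging: index `j < s` goes to `g j < s'`, and weights add up. -/
lemma deepWeight_merge {s s' : ℕ} {R : ℕ → ℕ → Prop} {w w' : ℕ → ℝ} {m : ℝ} {g : ℕ → ℕ}
    (hg : ∀ j < s, g j < s')
    (hw : ∀ a < s', w' a = ∑ j ∈ range s, if g j = a then w j else 0) :
    deepWeight s' R w' m = deepWeight s (fun j i => R (g j) (g i)) w m := by
  classical
  have key : ∀ F : ℕ → Prop, ∑ a ∈ range s', (if F a then w' a else 0) =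
      ∑ j ∈ range s, if F (g j) then w j else 0 := by
    intro F
    calc ∑ a ∈ range s', (if F a then w' a else 0)
        = ∑ a ∈ range s', ∑ j ∈ range s, if g j = a then (if F (g j) then w j else 0) else 0 := by
          refine sum_congr rfl fun a ha => ?_
          rw [hw a (mem_range.1 ha)]
          split_ifs with h
          · refine sum_congr rfl fun j _ => ?_
            by_cases h' : g j = a
            · subst h'; simp [h]
            · simp [h']
          · symm
            refine sum_eq_zero fun j _ => ?_
            by_cases h' : g j = a
            · subst h'; simp [h]
            · simp [h']
      _ = ∑ j ∈ range s, ∑ a ∈ range s', if g j = a then (if F (g j) then w j else 0) else 0 :=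
          sum_comm
      _ = _ := by
          refine sum_congr rfl fun j hj => ?_
          rw [sum_ite_eq, if_pos (mem_range.2 (hg j (mem_range.1 hj)))]
  unfold deepWeight
  rw [key]
  refine sum_congr rfl fun j _ => ?_
  rw [key]

/-- Deleting indices that are related only to themselves. -/
lemma deepWeight_prune {s s' : ℕ} {R : ℕ → ℕ → Prop} {K : ℕ → Prop} [DecidablePred K]
    {w : ℕ → ℝ} {m : ℝ}
    {e : ℕ → ℕ} (hR : ∀ j < s, R j j) (hsymm : ∀ j < s, ∀ i < s, R j i → R i j)
    (hK : ∀ j < s, ¬ K j → ∀ i < s, R j i → i = j)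
    (he : ∀ F : ℕ → ℝ, ∑ a ∈ range s', F (e a) = ∑ j ∈ range s, if K j then F j else 0)
    (he' : ∀ a < s', e a < s ∧ K (e a)) :
    deepWeight s R w m =
      (∑ j ∈ range s, if ¬ K j ∧ m + 1 ≤ w j then w j else 0) +
        deepWeight s' (fun a b => R (e a) (e b)) (fun a => w (e a)) m := by
  classical
  have h2 : deepWeight s' (fun a b => R (e a) (e b)) (fun a => w (e a)) m =
      ∑ j ∈ range s, if K j then
        (if m + 1 ≤ ∑ i ∈ range s, (if R j i then w i else 0) then w j else 0) else 0 := by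
    rw [← he]
    unfold deepWeight
    refine sum_congr rfl fun a ha => ?_
    rw [he (fun i => if R (e a) i then w i else 0)]
    obtain ⟨h1, h2⟩ := he' a (mem_range.1 ha)
    have : ∑ j ∈ range s, (if K j then (if R (e a) j then w j else 0) else 0) =
        ∑ j ∈ range s, (if R (e a) j then w j else 0) := by
      refine sum_congr rfl fun j hj => ?_
      by_cases hKj : K j
      · simp [hKj]
      -- By symmetry a kept index is related to no deleted one, so its count does not change.
      · have : ¬ R (e a) j := fun hr => by
          have := hK j (mem_range.1 hj) hKj (e a) h1 (hsymm _ h1 _ (mem_range.1 hj) hr)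
          exact hKj (this ▸ h2)
        simp [this]
    rw [this]
  rw [h2, ← sum_add_distrib]
  refine sum_congr rfl fun j hj => ?_
  have hj' := mem_range.1 hj
  by_cases hKj : K j
  · simp [hKj]
  -- A deleted index sees only itself, so it counts exactly when its own weight reaches m + 1.
  · have : ∑ i ∈ range s, (if R j i then w i else 0) = w j := by
      rw [sum_eq_single_of_mem j hj]
      · simp [hR j hj']
      · intro i hi hne
        rw [if_neg fun h => hne (hK j hj' hKj i (mem_range.1 hi) h)]
    simp [hKj, this]

/-! ### Cells of a grid -/

variable {d : ℕ}

/-- The cell of `x` in a grid of side `η`, shifted by `o`. -/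
def cell (η : ℝ) (o : Fin d → ℝ) (x : EuclideanSpace ℝ (Fin d)) : Fin d → ℤ :=
  fun c => ⌊x c / η + o c⌋

/-- The Euclidean norm of an integer vector. -/
def intNorm (v : Fin d → ℤ) : ℝ := √(∑ c, (v c : ℝ) ^ 2)

/-- The cells of `x` and `y` are at distance less than `i + 1`. -/
def Near (η : ℝ) (i : ℕ) (x y : EuclideanSpace ℝ (Fin d)) : Prop :=
  ⌊intNorm (cell η 0 y - cell η 0 x)⌋ ≤ (i : ℤ)

/-- The factor √d is relaxed to d + 1 here, so that all later constants are integers, as programs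
require. -/
lemma euclidean_norm_le {a : ℝ} (ha : 0 ≤ a) (v : EuclideanSpace ℝ (Fin d))
    (h : ∀ c, |v c| ≤ a) : ‖v‖ ≤ a * (d + 1) := by
  rw [EuclideanSpace.norm_eq, Real.sqrt_le_left (by positivity)]
  calc ∑ i, ‖v i‖ ^ 2 ≤ ∑ _i : Fin d, a ^ 2 := by
        refine sum_le_sum fun i _ => ?_
        rw [Real.norm_eq_abs]
        exact pow_le_pow_left₀ (abs_nonneg _) (h i) 2
    _ = d * a ^ 2 := by simp
    _ ≤ (a * (d + 1)) ^ 2 := by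
        have : (0 : ℝ) ≤ d := by positivity
        nlinarith [sq_nonneg a, mul_nonneg this (sq_nonneg a),
          mul_nonneg (mul_nonneg this this) (sq_nonneg a)]

/-- The cell difference and the scaled difference vector differ coordinatewise by a difference of
two fractional parts, which is less than 1 in absolute value. -/
lemma abs_intNorm_sub_dist_le {η : ℝ} (hη : 0 < η) (x y : EuclideanSpace ℝ (Fin d)) :
    |intNorm (cell η 0 y - cell η 0 x) - dist x y / η| ≤ d + 1 := by
  set o : EuclideanSpace ℝ (Fin d) :=
    WithLp.toLp 2 fun c => ((cell η 0 y - cell η 0 x) c : ℝ) with ho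
  have h1 : intNorm (cell η 0 y - cell η 0 x) = ‖o‖ := by
    rw [EuclideanSpace.norm_eq, intNorm]
    simp [ho]
  have h2 : dist x y / η = ‖(1 / η) • (y - x)‖ := by
    rw [norm_smul, dist_comm, dist_eq_norm, Real.norm_of_nonneg (by positivity)]
    ring
  rw [h1, h2]
  refine (abs_norm_sub_norm_le _ _).trans ?_
  refine (euclidean_norm_le zero_le_one _ fun c => ?_).trans (by simp)
  have e : (o - (1 / η) • (y - x)) c =
      Int.fract (x c / η) - Int.fract (y c / η) := by
    simp only [ho, cell, PiLp.sub_apply, PiLp.smul_apply, Pi.sub_apply, Int.cast_sub,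
      Int.fract, smul_eq_mul, Pi.zero_apply, add_zero]
    ring
  rw [e, abs_le]
  have := Int.fract_nonneg (x c / η)
  have := Int.fract_lt_one (x c / η)
  have := Int.fract_nonneg (y c / η)
  have := Int.fract_lt_one (y c / η)
  constructor <;> linarith

lemma near_of_dist_le {η r : ℝ} {i : ℕ} (hη : 0 < η) {x y : EuclideanSpace ℝ (Fin d)}
    (h : dist x y ≤ r) (hr : r < η * (i + 1 - (d + 1))) : Near η i x y := by
  have h1 := (abs_le.1 (abs_intNorm_sub_dist_le hη x y)).2
  have h2 : dist x y / η < i + 1 - (d + 1) := by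
    rw [div_lt_iff₀ hη]; linarith
  rw [Near, ← Int.lt_add_one_iff, Int.floor_lt]
  push_cast
  linarith

lemma Near.dist_lt {η : ℝ} {i : ℕ} (hη : 0 < η) {x y : EuclideanSpace ℝ (Fin d)}
    (h : Near η i x y) : dist x y < η * (i + 1 + (d + 1)) := by
  have h1 := (abs_le.1 (abs_intNorm_sub_dist_le hη x y)).1
  rw [Near, ← Int.lt_add_one_iff, Int.floor_lt] at h
  push_cast at h
  have h2 : dist x y / η < i + 1 + (d + 1) := by linarith
  rw [div_lt_iff₀ hη] at h2
  linarith

lemma near_self (η : ℝ) (i : ℕ) (x : EuclideanSpace ℝ (Fin d)) : Near η i x x := by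
  simp [Near, intNorm]

lemma dist_le_of_cell_eq {η : ℝ} (hη : 0 < η) {o : Fin d → ℝ} {x y : EuclideanSpace ℝ (Fin d)}
    (h : cell η o x = cell η o y) : dist x y ≤ η * (d + 1) := by
  rw [dist_eq_norm]
  refine euclidean_norm_le hη.le _ fun c => ?_
  have h1 := congrFun h c
  simp only [cell] at h1
  have h2 := (Int.abs_sub_lt_one_of_floor_eq_floor h1).le
  have h3 : x c - y c = (x c / η + o c - (y c / η + o c)) * η := by field_simp; ring
  rw [PiLp.sub_apply, h3, abs_mul, abs_of_pos hη]
  nlinarith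

/-- In each coordinate, two values at most a quarter cell apart cannot be separated both by the grid
and by its translate by half a cell. The good choices for the coordinates are packed as the binary
digits of `b`. -/
lemma exists_shift {L : ℝ} (hL : 0 < L) {x y : EuclideanSpace ℝ (Fin d)} (h : dist x y ≤ L) :
    ∃ b < 2 ^ d, cell (4 * L) (fun c : Fin d => ((b / 2 ^ (c : ℕ) % 2 : ℕ) : ℝ) / 2) x =
      cell (4 * L) (fun c : Fin d => ((b / 2 ^ (c : ℕ) % 2 : ℕ) : ℝ) / 2) y := by
  have key : ∀ c : Fin d, ∃ t : Fin 2,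
      ⌊x c / (4 * L) + ((t : ℕ) : ℝ) / 2⌋ = ⌊y c / (4 * L) + ((t : ℕ) : ℝ) / 2⌋ := by
    intro c
    have h1 : |x c - y c| ≤ L := by
      refine le_trans ?_ h
      rw [dist_eq_norm]
      simpa using PiLp.norm_apply_le (x - y) c
    have h2 : |x c / (4 * L) - y c / (4 * L)| ≤ 1 / 4 := by
      rw [← sub_div, abs_div, abs_of_pos (by positivity : 0 < 4 * L), div_le_iff₀ (by positivity)]
      linarith
    generalize x c / (4 * L) = a at h2
    generalize y c / (4 * L) = b at h2
    rw [abs_le] at h2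
    by_contra! hne
    have n0 := hne 0
    have n1 := hne 1
    simp only [Fin.val_zero, Fin.val_one, Nat.cast_zero, Nat.cast_one, zero_div, add_zero] at n0 n1
    have a1 := Int.floor_le a
    have a2 := Int.lt_floor_add_one a
    have b1 := Int.floor_le b
    have b2 := Int.lt_floor_add_one b
    -- If the floors differ, an integer separates `a` and `b`, both within 1/4 of it; adding 1/2
    -- puts both into the unit interval that starts at this integer.
    rcases lt_or_gt_of_ne n0 with hlt | hlt
    · have h3 : ((⌊a⌋ : ℤ) : ℝ) + 1 ≤ ⌊b⌋ := by exact_mod_cast hlt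
      apply n1
      rw [show ⌊a + 1 / 2⌋ = ⌊b⌋ from Int.floor_eq_iff.2 ⟨by linarith, by linarith⟩,
        show ⌊b + 1 / 2⌋ = ⌊b⌋ from Int.floor_eq_iff.2 ⟨by linarith, by linarith⟩]
    · have h3 : ((⌊b⌋ : ℤ) : ℝ) + 1 ≤ ⌊a⌋ := by exact_mod_cast hlt
      apply n1
      rw [show ⌊a + 1 / 2⌋ = ⌊a⌋ from Int.floor_eq_iff.2 ⟨by linarith, by linarith⟩,
        show ⌊b + 1 / 2⌋ = ⌊a⌋ from Int.floor_eq_iff.2 ⟨by linarith, by linarith⟩]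
  choose t ht using key
  refine ⟨finFunctionFinEquiv t, (finFunctionFinEquiv t).2, ?_⟩
  have h4 : ∀ c : Fin d, ((finFunctionFinEquiv t : Fin (2 ^ d)) : ℕ) / 2 ^ (c : ℕ) % 2 = t c := by
    intro c
    have := congrFun (finFunctionFinEquiv.symm_apply_apply t) c
    simpa [finFunctionFinEquiv] using congrArg Fin.val this
  funext c
  simp only [cell, h4]
  exact ht c

/-! ### Boxes of cells -/

/-- The vector number `t` of the box `{-I, …, I}ᵈ`. -/
def boxVec (d I t : ℕ) : Fin d → ℤ := fun c => ((t / (2 * I + 1) ^ (c : ℕ) % (2 * I + 1) : ℕ) : ℤ) - I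

lemma boxVec_injOn {I t t' : ℕ} (ht : t < (2 * I + 1) ^ d) (ht' : t' < (2 * I + 1) ^ d)
    (h : boxVec d I t = boxVec d I t') : t = t' := by
  have h1 : (finFunctionFinEquiv.symm ⟨t, ht⟩ : Fin d → Fin (2 * I + 1)) =
      finFunctionFinEquiv.symm ⟨t', ht'⟩ := by
    funext c
    have := congrFun h c
    simp only [boxVec, sub_left_inj, Nat.cast_inj] at this
    ext
    simpa [finFunctionFinEquiv] using this
  simpa using finFunctionFinEquiv.symm.injective h1

lemma exists_boxVec {I : ℕ} {v : Fin d → ℤ} (h : ∀ c, |v c| ≤ I) :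
    ∃ t < (2 * I + 1) ^ d, boxVec d I t = v := by
  have hb : ∀ c, (v c + I).toNat < 2 * I + 1 := fun c => by
    have := abs_le.1 (h c)
    omega
  set f : Fin d → Fin (2 * I + 1) := fun c => ⟨(v c + I).toNat, hb c⟩
  refine ⟨finFunctionFinEquiv f, (finFunctionFinEquiv f).2, ?_⟩
  funext c
  have := congrArg Fin.val (congrFun (finFunctionFinEquiv.symm_apply_apply f) c)
  have h2 : ((finFunctionFinEquiv f : Fin ((2 * I + 1) ^ d)) : ℕ) / (2 * I + 1) ^ (c : ℕ) %
      (2 * I + 1) = (v c + I).toNat := by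
    simpa [finFunctionFinEquiv, f] using this
  rw [boxVec, h2]
  have := abs_le.1 (h c)
  omega

lemma abs_le_of_floor_intNorm_le {v : Fin d → ℤ} {I : ℕ} (h : ⌊intNorm v⌋ ≤ (I : ℤ)) (c : Fin d) :
    |v c| ≤ I := by
  rw [← Int.lt_add_one_iff, Int.floor_lt] at h
  have h1 : |(v c : ℝ)| ≤ intNorm v := by
    rw [intNorm, ← Real.sqrt_sq_eq_abs]
    exact Real.sqrt_le_sqrt (single_le_sum (f := fun c => (v c : ℝ) ^ 2)
      (fun i _ => sq_nonneg _) (mem_univ c))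
  have h2 : ((|v c| : ℤ) : ℝ) < ((I + 1 : ℤ) : ℝ) := by
    push_cast at h ⊢
    linarith
  have := Int.cast_lt.1 h2
  omega

/-- A vector whose norm has floor i ≤ I lies in the box and occurs exactly once in its enumeration.
-/
lemma sum_boxVec {I i : ℕ} (hi : i ≤ I) (v : Fin d → ℤ) (a : ℝ) :
    ∑ t ∈ range ((2 * I + 1) ^ d),
        (if ⌊intNorm (boxVec d I t)⌋ = i then (if v = boxVec d I t then a else 0) else 0) =
      if ⌊intNorm v⌋ = i then a else 0 := by
  by_cases h : ⌊intNorm v⌋ = i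
  · obtain ⟨t, ht, hv⟩ := exists_boxVec (I := I) fun c =>
      abs_le_of_floor_intNorm_le (v := v) (I := I) (by rw [h]; exact_mod_cast hi) c
    rw [sum_eq_single_of_mem t (mem_range.2 ht)]
    · simp [hv, h]
    · intro t' ht' hne
      rw [if_neg (c := v = _), ite_self]
      intro hv'
      exact hne (boxVec_injOn (mem_range.1 ht') ht (by rw [← hv', hv]))
  · rw [if_neg h]
    refine sum_eq_zero fun t _ => ?_
    split_ifs with h1 h2
    · exact absurd (h2 ▸ h1) h
    · rfl
    · rfl

/-! ### Coding integer vectors by integers -/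

/-- An injective polynomial from integer vectors to the nonnegative integers. -/
def vecCode : (d : ℕ) → (Fin d → ℤ) → ℤ
  | 0, _ => 0
  | d + 1, v =>
    (vecCode d (Fin.tail v) + v 0 * (2 * v 0 + 1)) ^ 2 + vecCode d (Fin.tail v)

lemma int_sq_code_nonneg (z : ℤ) : 0 ≤ z * (2 * z + 1) := by
  rcases le_or_gt 0 z with h | h
  · positivity
  · nlinarith

lemma vecCode_nonneg : ∀ (d : ℕ) (v : Fin d → ℤ), 0 ≤ vecCode d v
  | 0, _ => le_rfl
  | d + 1, _ => add_nonneg (sq_nonneg _) (vecCode_nonneg d _)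

/-- This makes cells usable as table addresses. On nonnegative integers (a + b)² + a determines a +
b, since it lies between consecutive squares, and then a. On integers z (2z + 1) is injective,
because a difference of two values factors as (z - z') times an odd number. -/
lemma vecCode_injective : ∀ d : ℕ, Function.Injective (vecCode d)
  | 0 => fun _ _ _ => Subsingleton.elim _ _
  | d + 1 => fun v v' h => by
    have pair : ∀ a b a' b' : ℤ, 0 ≤ a → 0 ≤ b → 0 ≤ a' → 0 ≤ b' →
        (a + b) ^ 2 + a = (a' + b') ^ 2 + a' → a = a' ∧ b = b' := by
      intro a b a' b' ha hb ha' hb' h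
      have h1 : a + b = a' + b' := by
        rcases lt_trichotomy (a + b) (a' + b') with h2 | h2 | h2
        · nlinarith
        · exact h2
        · nlinarith
      have h2 : a = a' := by rw [h1] at h; linarith
      exact ⟨h2, by linarith⟩
    obtain ⟨h1, h2⟩ := pair _ _ _ _ (vecCode_nonneg d _) (int_sq_code_nonneg _)
      (vecCode_nonneg d _) (int_sq_code_nonneg _) h
    have h3 := vecCode_injective d h1
    have h4 : v 0 = v' 0 := by
      have : (v 0 - v' 0) * (2 * (v 0 + v' 0) + 1) = 0 := by linarith
      rcases mul_eq_zero.1 this with h5 | h5 <;> omega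
    rw [← Fin.cons_self_tail v, ← Fin.cons_self_tail v', h3, h4]

/-! ### Order statistics as counts -/

/-- Order statistics enter the proof only through this translation into counts. -/
lemma kthSmallest_le_iff {k : ℕ} {s : Multiset ℝ} (hk : 1 ≤ k) (hks : k ≤ s.card) (r : ℝ) :
    kthSmallest k s ≤ r ↔ k ≤ (s.filter (· ≤ r)).card := by
  set l := s.sort (· ≤ ·) with hl
  have hlen : l.length = s.card := by simp [hl]
  have hs : s = (l : Multiset ℝ) := by simp [hl]
  have hsorted : l.Pairwise (· ≤ ·) := s.pairwise_sort (· ≤ ·)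
  have hlt : k - 1 < l.length := by omega
  have hgoal : (s.filter (· ≤ r)).card = l.countP (· ≤ r) := by
    rw [hs, Multiset.filter_coe, Multiset.coe_card, List.countP_eq_length_filter]
  rw [hgoal, kthSmallest, ← hl, List.getD_eq_getElem _ _ hlt]
  constructor
  · intro h
    have h1 : ∀ x ∈ l.take k, x ≤ r := by
      intro x hx
      obtain ⟨i, hi, rfl⟩ := List.mem_iff_getElem.1 hx
      rw [List.getElem_take]
      rw [List.length_take] at hi
      refine le_trans ?_ h
      rcases (show i = k - 1 ∨ i < k - 1 by omega) with hik | hik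
      · subst hik; rfl
      · exact List.pairwise_iff_getElem.1 hsorted i (k - 1) _ _ hik
    have h2 : (l.take k).countP (· ≤ r) = k := by
      rw [List.countP_eq_length.2 (by simpa using h1), List.length_take]
      omega
    rw [← h2]
    exact (List.take_sublist k l).countP_le
  · intro h
    by_contra! hlt'
    have h1 : ∀ x ∈ l.drop (k - 1), ¬ x ≤ r := by
      intro x hx
      obtain ⟨i, hi, rfl⟩ := List.mem_iff_getElem.1 hx
      rw [List.getElem_drop, not_le]
      refine lt_of_lt_of_le hlt' ?_
      rcases Nat.eq_zero_or_pos i with h0 | h0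
      · simp [h0]
      · exact List.pairwise_iff_getElem.1 hsorted (k - 1) (k - 1 + i) _ _ (by omega)
    have h2 : l.countP (· ≤ r) = (l.take (k - 1)).countP (· ≤ r) := by
      conv_lhs => rw [← List.take_append_drop (k - 1) l]
      rw [List.countP_append, (List.countP_eq_zero (p := fun x => decide (x ≤ r)) (l := l.drop (k - 1))).2 (by simpa using h1),
        add_zero]
    have h3 := List.countP_le_length (p := fun x => decide (x ≤ r)) (l := l.take (k - 1))
    rw [List.length_take] at h3
    omega

/-- The point itself lies within distance r ≥ 0, so m other points become m + 1 points. -/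
lemma mthNeighborDist_le_iff {ι E : Type*} [Fintype ι] [DecidableEq ι] [MetricSpace E]
    (q : ι → E) {m : ℕ} (hm : 1 ≤ m) (hmc : m + 1 ≤ Fintype.card ι) (a : ι) {r : ℝ} (hr : 0 ≤ r) :
    mthNeighborDist q m a ≤ r ↔ m + 1 ≤ #{b | dist (q a) (q b) ≤ r} := by
  classical
  rw [mthNeighborDist, kthSmallest_le_iff hm]
  · rw [Multiset.filter_map, Multiset.card_map]
    have h : ({b | dist (q a) (q b) ≤ r} : Finset ι) =
        insert a ((univ.erase a).filter fun b => dist (q a) (q b) ≤ r) := by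
      ext b
      by_cases hb : b = a
      · subst hb; simp [hr]
      · simp [hb]
    rw [h, card_insert_of_notMem (by simp)]
    simp only [add_le_add_iff_right, Finset.card, Finset.filter]
    rfl
  · rw [Multiset.card_map]
    change m ≤ #(univ.erase a)
    rw [card_erase_of_mem (mem_univ a), card_univ]
    omega

lemma kthMthNeighborDist_le_iff {ι E : Type*} [Fintype ι] [DecidableEq ι] [MetricSpace E]
    (q : ι → E) {m k : ℕ} (hm : 1 ≤ m) (hmc : m + 1 ≤ Fintype.card ι) (hk : 1 ≤ k)
    (hkc : k ≤ Fintype.card ι) {r : ℝ} (hr : 0 ≤ r) :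
    kthMthNeighborDist q m k ≤ r ↔ k ≤ #{a | m + 1 ≤ #{b | dist (q a) (q b) ≤ r}} := by
  rw [kthMthNeighborDist, kthSmallest_le_iff hk]
  · rw [Multiset.filter_map, Multiset.card_map]
    simp only [Function.comp_def, mthNeighborDist_le_iff q hm hmc _ hr]
    rfl
  · simpa [Finset.card_univ] using hkc

lemma kthMthNeighborDist_nonneg {ι E : Type*} [Fintype ι] [DecidableEq ι] [MetricSpace E]
    (q : ι → E) (m k : ℕ) : 0 ≤ kthMthNeighborDist q m k := by
  have key : ∀ (k : ℕ) (s : Multiset ℝ), (∀ x ∈ s, 0 ≤ x) → 0 ≤ kthSmallest k s := by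
    intro k s hs
    rw [kthSmallest, List.getD_eq_getElem?_getD]
    rcases h : (s.sort (· ≤ ·))[k - 1]? with _ | x
    · simp
    · exact hs x (by simpa using List.mem_of_getElem? h)
  refine key _ _ fun x hx => ?_
  obtain ⟨a, -, rfl⟩ := Multiset.mem_map.1 hx
  refine key _ _ fun x hx => ?_
  obtain ⟨b, -, rfl⟩ := Multiset.mem_map.1 hx
  exact dist_nonneg

/-- At least weight `k` of the points with indices below `s` have weight at least `m + 1` within
distance `r`. -/
def Reach (s : ℕ) (X : ℕ → EuclideanSpace ℝ (Fin d)) (w : ℕ → ℝ) (m k r : ℝ) : Prop :=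
  k ≤ deepWeight s (fun j i => dist (X j) (X i) ≤ r) w m

lemma Reach.mono {s : ℕ} {X : ℕ → EuclideanSpace ℝ (Fin d)} {w : ℕ → ℝ} {m k r r' : ℝ}
    (hw : ∀ i < s, 0 ≤ w i) (hr : r ≤ r') (h : Reach s X w m k r) : Reach s X w m k r' :=
  le_trans h (deepWeight_mono hw fun _ _ _ _ h' => h'.trans hr)

lemma card_sigma_filter {n : ℕ} (w : Fin n → ℕ) (F : Fin n → Prop) [DecidablePred F] :
    #{a : Σ i : Fin n, Fin (w i) | F a.1} = ∑ i, if F i then w i else 0 := by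
  have : ({a : Σ i : Fin n, Fin (w i) | F a.1} : Finset _) =
      (univ.filter F).sigma fun i => (univ : Finset (Fin (w i))) := by
    ext ⟨i, j⟩
    simp
  rw [this, card_sigma, sum_filter]
  simp

/-- The point with index `i`, for `i < n`. -/
def pointAt {n : ℕ} (p : Fin n → EuclideanSpace ℝ (Fin d)) (i : ℕ) : EuclideanSpace ℝ (Fin d) :=
  if h : i < n then p ⟨i, h⟩ else 0

/-- The weight with index `i`, for `i < n`. -/
def weightAt {n : ℕ} (w : Fin n → ℕ) (i : ℕ) : ℝ :=
  if h : i < n then w ⟨i, h⟩ else 0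

/-- All copies at one location see the same number of points, so both counts group by location into
sums of weights. -/
lemma kthMthNeighborDist_copies_le_iff {n : ℕ} (p : Fin n → EuclideanSpace ℝ (Fin d))
    (w : Fin n → ℕ) {m k : ℕ} (hm : 1 ≤ m) (hmc : m + 1 ≤ ∑ i, w i) (hk : 1 ≤ k)
    (hkc : k ≤ ∑ i, w i) {r : ℝ} (hr : 0 ≤ r) :
    kthMthNeighborDist (copies p w) m k ≤ r ↔
      Reach n (pointAt p) (weightAt w) m k r := by
  classical
  have hcard : Fintype.card (Σ i : Fin n, Fin (w i)) = ∑ i, w i := by simp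
  rw [kthMthNeighborDist_le_iff _ hm (by rw [hcard]; exact hmc) hk (by rw [hcard]; exact hkc) hr]
  have h1 : ∀ a : Σ i : Fin n, Fin (w i), #{b | dist (copies p w a) (copies p w b) ≤ r} =
      ∑ i, if dist (p a.1) (p i) ≤ r then w i else 0 := fun a =>
    card_sigma_filter w fun i => dist (p a.1) (p i) ≤ r
  simp only [h1]
  rw [card_sigma_filter w fun j => m + 1 ≤ ∑ i, if dist (p j) (p i) ≤ r then w i else 0]
  rw [Reach, deepWeight, ← Fin.sum_univ_eq_sum_range
    (fun j => if (m : ℝ) + 1 ≤ ∑ i ∈ range n, (if dist (pointAt p j) (pointAt p i) ≤ r then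
      weightAt w i else 0) then weightAt w j else 0), ← Nat.cast_le (α := ℝ), Nat.cast_sum]
  have h2 : ∀ j : Fin n, ∑ i ∈ range n, (if dist (pointAt p j) (pointAt p i) ≤ r then
      weightAt w i else 0) = ((∑ i, if dist (p j) (p i) ≤ r then w i else 0 : ℕ) : ℝ) := by
    intro j
    rw [← Fin.sum_univ_eq_sum_range
      (fun i => if dist (pointAt p j) (pointAt p i) ≤ r then weightAt w i else 0), Nat.cast_sum]
    refine sum_congr rfl fun i _ => ?_
    simp [pointAt, weightAt]
  refine iff_of_eq (congrArg _ (sum_congr rfl fun j _ => ?_))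
  rw [h2]
  have h3 : ((m : ℝ) + 1 ≤ ((∑ i, if dist (p j) (p i) ≤ r then w i else 0 : ℕ) : ℝ)) ↔
      m + 1 ≤ ∑ i, if dist (p j) (p i) ≤ r then w i else 0 := by
    rw [← Nat.cast_one (R := ℝ), ← Nat.cast_add, Nat.cast_le]
  simp only [h3, weightAt, Fin.is_lt, dite_true, Fin.eta]
  split_ifs <;> simp

/-! ### Progress of a random round -/

/-- All elements of rank below s/4 are counted in the rank of the largest of them, so there are
fewer than s/4 if there are any. -/
lemma four_mul_card_low_rank_le (s : ℕ) (l : ℕ → ℝ) :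
    4 * #{u ∈ range s | 4 * #{j ∈ range s | l j ≤ l u} < s} ≤ s := by
  set H := (range s).filter fun u => 4 * #{j ∈ range s | l j ≤ l u} < s
  rcases H.eq_empty_or_nonempty with h | h
  · simp [h]
  · obtain ⟨u, hu, hmax⟩ := exists_max_image H l h
    have h1 : H ⊆ {j ∈ range s | l j ≤ l u} := fun j hj =>
      mem_filter.2 ⟨(mem_filter.1 hj).1, hmax j hj⟩
    have h2 := card_le_card h1
    have h3 := (mem_filter.1 hu).2
    omega

/-- If a round with random choices `u < s` and `b < S` removes at least `min (B u) (M u b / 2)`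
of `s` elements, then a constant fraction is removed on average. -/
lemma sum_removed_ge {s S : ℕ} (l : ℕ → ℝ) (M : ℕ → ℕ → ℕ) (hM : ∀ u b, M u b ≤ s)
    (hA : ∀ u < s, #{j ∈ range s | l j ≤ l u} ≤ ∑ b ∈ range S, M u b) :
    (s : ℝ) ^ 2 / 32 ≤ ∑ u ∈ range s, ∑ b ∈ range S,
      min (#{j ∈ range s | l u ≤ l j} : ℝ) ((M u b : ℝ) / 2) := by
  set H := (range s).filter fun u =>
    s ≤ 4 * #{j ∈ range s | l j ≤ l u} ∧ s ≤ 4 * #{j ∈ range s | l u ≤ l j} with hH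
  -- At most a quarter of the indices have low rank from below, and at most a quarter from above
  -- (the same bound for `-l`); the central ones make up at least half.
  have h1 : s ≤ 2 * #H := by
    have a1 := four_mul_card_low_rank_le s l
    have a2 := four_mul_card_low_rank_le s fun j => -l j
    simp only [neg_le_neg_iff] at a2
    have hsub : range s ⊆ H ∪ ((range s).filter fun u => 4 * #{j ∈ range s | l j ≤ l u} < s) ∪
        ((range s).filter fun u => 4 * #{j ∈ range s | l u ≤ l j} < s) := by
      intro u hu
      simp only [hH, mem_union, mem_filter, hu, true_and]
      omega
    have a3 := (card_le_card hsub).trans ((card_union_le _ _).trans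
      (Nat.add_le_add_right (card_union_le _ _) _))
    rw [card_range] at a3
    omega
  -- For central `u` the first entry of the minimum is at least s/4 ≥ M/4, so each minimum is at
  -- least M/4; the sum of M over `b` is at least s/4.
  have h2 : ∀ u ∈ H, (s : ℝ) / 16 ≤ ∑ b ∈ range S,
      min (#{j ∈ range s | l u ≤ l j} : ℝ) ((M u b : ℝ) / 2) := by
    intro u hu
    obtain ⟨hu, hu1, hu2⟩ := mem_filter.1 hu
    have hu1' : (s : ℝ) ≤ 4 * #{j ∈ range s | l j ≤ l u} := by exact_mod_cast hu1
    have hu2' : (s : ℝ) ≤ 4 * #{j ∈ range s | l u ≤ l j} := by exact_mod_cast hu2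
    have hA' : (#{j ∈ range s | l j ≤ l u} : ℝ) ≤ ∑ b ∈ range S, (M u b : ℝ) := by
      exact_mod_cast hA u (mem_range.1 hu)
    calc (s : ℝ) / 16 ≤ (∑ b ∈ range S, (M u b : ℝ)) / 4 := by linarith
      _ = ∑ b ∈ range S, (M u b : ℝ) / 4 := sum_div _ _ _
      _ ≤ _ := by
          refine sum_le_sum fun b _ => le_min ?_ ?_
          · have : (M u b : ℝ) ≤ s := by exact_mod_cast hM u b
            linarith
          · have : (0 : ℝ) ≤ M u b := by positivity
            linarith
  have h3 : (s : ℝ) ≤ 2 * #H := by exact_mod_cast h1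
  calc (s : ℝ) ^ 2 / 32 ≤ #H * ((s : ℝ) / 16) := by
        have : (0 : ℝ) ≤ s := by positivity
        nlinarith
    _ = ∑ u ∈ H, (s : ℝ) / 16 := by simp
    _ ≤ ∑ u ∈ H, ∑ b ∈ range S, min (#{j ∈ range s | l u ≤ l j} : ℝ) ((M u b : ℝ) / 2) :=
        sum_le_sum h2
    _ ≤ _ := sum_le_sum_of_subset_of_nonneg (filter_subset _ _) fun u _ _ =>
        sum_nonneg fun b _ => by positivity

/-- The number of indices below `s` whose value under `f` is attained at another index. -/
def mergedCount {α : Type*} [DecidableEq α] (s : ℕ) (f : ℕ → α) : ℕ :=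
  #{j ∈ range s | ∃ i ∈ range s, i ≠ j ∧ f i = f j}

lemma mergedCount_le {α : Type*} [DecidableEq α] (s : ℕ) (f : ℕ → α) : mergedCount s f ≤ s :=
  (card_filter_le _ _).trans (card_range s).le

/-- Every value attained more than once absorbs at least two merged indices, while the unmerged
indices contribute one value each. -/
lemma two_mul_card_image_add_mergedCount_le {α : Type*} [DecidableEq α] (s : ℕ) (f : ℕ → α) :
    2 * #((range s).image f) + mergedCount s f ≤ 2 * s := by
  have h1 : s = ∑ a ∈ (range s).image f, #{j ∈ range s | f j = a} := by
    conv_lhs => rw [← card_range s]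
    exact card_eq_sum_card_image f _
  set U := (range s).filter fun j => ¬ ∃ i ∈ range s, i ≠ j ∧ f i = f j with hU
  have h2 : #U = ∑ a ∈ (range s).image f, #{j ∈ U | f j = a} :=
    card_eq_sum_card_fiberwise fun j hj =>
      mem_image_of_mem f (mem_filter.1 hj).1
  have h3 : mergedCount s f + #U = s := by
    conv_rhs => rw [← card_range s]
    exact card_filter_add_card_filter_not _
  have h4 : 2 * #((range s).image f) ≤ s + #U := by
    rw [h2]
    nth_rewrite 2 [h1]
    rw [← sum_add_distrib, mul_comm, ← smul_eq_mul, ← sum_const]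
    refine sum_le_sum fun a ha => ?_
    obtain ⟨j, hj, rfl⟩ := mem_image.1 ha
    have hj1 : j ∈ {i ∈ range s | f i = f j} := mem_filter.2 ⟨hj, rfl⟩
    by_cases hju : j ∈ U
    · have h5 : 0 < #{i ∈ U | f i = f j} := card_pos.2 ⟨j, mem_filter.2 ⟨hju, rfl⟩⟩
      have h6 : 0 < #{i ∈ range s | f i = f j} := card_pos.2 ⟨j, hj1⟩
      omega
    · have : ∃ i ∈ range s, i ≠ j ∧ f i = f j := by
        by_contra h
        exact hju (mem_filter.2 ⟨hj, h⟩)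
      obtain ⟨i, hi, hne, hf⟩ := this
      have : 1 < #{i ∈ range s | f i = f j} :=
        one_lt_card.2 ⟨i, mem_filter.2 ⟨hi, hf⟩, j, hj1, hne⟩
      omega
  omega

open RealRAM

/-! ### Compound terms -/

def powTerm (t : Term) : ℕ → Term
  | 0 => .const 1
  | e + 1 => .mul (powTerm t e) t

@[simp] lemma eval_powTerm (σ : Store) (t : Term) (e : ℕ) :
    (powTerm t e).eval σ = t.eval σ ^ e := by
  induction e with
  | zero => simp [powTerm, Term.eval]
  | succ e ih => simp [powTerm, Term.eval, ih, pow_succ]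

/-- Digit number `e` of `t` in base `b`. -/
def digitTerm (t b : Term) (e : ℕ) : Term :=
  .sub (.floor (.div t (powTerm b e))) (.mul b (.floor (.div t (powTerm b (e + 1)))))

/-- Remainders are not primitive in the machine; a digit is the difference of two floors. -/
lemma eval_digitTerm {σ : Store} {t b : Term} {t' b' : ℕ} (ht : t.eval σ = t')
    (hb : b.eval σ = b') (e : ℕ) : (digitTerm t b e).eval σ = ((t' / b' ^ e % b' : ℕ) : ℝ) := by
  have h : ∀ e : ℕ, ⌊(t' : ℝ) / (b' : ℝ) ^ e⌋ = ((t' / b' ^ e : ℕ) : ℤ) := by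
    intro e
    rw [← Nat.cast_pow, ← Int.natCast_floor_eq_floor (by positivity), Nat.floor_div_eq_div]
  simp only [digitTerm, Term.eval, eval_powTerm, ht, hb, h]
  rw [pow_succ, ← Nat.div_div_eq_div_mul]
  have := Nat.div_add_mod (t' / b' ^ e) b'
  have h2 : ((t' / b' ^ e : ℕ) : ℝ) = b' * ((t' / b' ^ e / b' : ℕ) : ℝ) +
      ((t' / b' ^ e % b' : ℕ) : ℝ) := by exact_mod_cast this.symm
  simp only [Int.cast_natCast]
  linarith

def sumTerm : (d : ℕ) → (Fin d → Term) → Term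
  | 0, _ => .const 0
  | d + 1, f => .add (f 0) (sumTerm d (Fin.tail f))

@[simp] lemma eval_sumTerm (σ : Store) : ∀ (d : ℕ) (f : Fin d → Term),
    (sumTerm d f).eval σ = ∑ c, (f c).eval σ
  | 0, _ => by simp [sumTerm, Term.eval]
  | d + 1, f => by
    rw [sumTerm, Term.eval, eval_sumTerm σ d, Fin.sum_univ_succ]
    rfl

/-- The square root of the sum of the squares. -/
def normTerm (f : Fin d → Term) : Term := .sqrt (sumTerm d fun c => .mul (f c) (f c))

lemma eval_normTerm {σ : Store} {f : Fin d → Term} {v : Fin d → ℝ}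
    (h : ∀ c, (f c).eval σ = v c) : (normTerm f).eval σ = √(∑ c, v c ^ 2) := by
  simp [normTerm, Term.eval, h, sq]

def codeTerm : (d : ℕ) → (Fin d → Term) → Term
  | 0, _ => .const 0
  | d + 1, f =>
    .add (.mul
      (.add (codeTerm d (Fin.tail f)) (.mul (f 0) (.add (.mul (.const 2) (f 0)) (.const 1))))
      (.add (codeTerm d (Fin.tail f)) (.mul (f 0) (.add (.mul (.const 2) (f 0)) (.const 1)))))
      (codeTerm d (Fin.tail f))

lemma eval_codeTerm (σ : Store) : ∀ (d : ℕ) {f : Fin d → Term} {v : Fin d → ℤ},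
    (∀ c, (f c).eval σ = v c) → (codeTerm d f).eval σ = vecCode d v
  | 0, _, _, _ => by simp [codeTerm, vecCode, Term.eval]
  | d + 1, f, v, h => by
    have h1 : (codeTerm d (Fin.tail f)).eval σ = vecCode d (Fin.tail v) :=
      eval_codeTerm σ d fun c => h c.succ
    simp only [codeTerm, vecCode, Term.eval, h1, h 0]
    push_cast
    ring

/-! ### The working set

Register `4` holds the size `s` of the working set, array `d + 1` the indices of its points and
array `d + 2` its weights. -/

structure Holds (s : ℕ) (X : ℕ → EuclideanSpace ℝ (Fin d)) (w : ℕ → ℝ) (σ : Store) : Prop where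
  size : σ.reg 4 = s
  coord : ∀ j < s, ∀ c : Fin d, σ.arr c ⌊σ.arr (d + 1) j⌋ = X j c
  weight : ∀ j < s, σ.arr (d + 2) j = w j

lemma Holds.of_eq {s : ℕ} {X : ℕ → EuclideanSpace ℝ (Fin d)} {w : ℕ → ℝ} {σ τ : Store}
    (h : Holds s X w σ) (hr : τ.reg 4 = σ.reg 4) (ha : ∀ a < d + 3, τ.arr a = σ.arr a) :
    Holds s X w τ where
  size := hr.trans h.size
  coord j hj c := by
    rw [ha c (by omega), ha (d + 1) (by omega)]
    exact h.coord j hj c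
  weight j hj := by
    rw [ha (d + 2) (by omega)]
    exact h.weight j hj

lemma Holds.of_frame {s : ℕ} {X : ℕ → EuclideanSpace ℝ (Fin d)} {w : ℕ → ℝ} {σ τ : Store}
    {P : Cmd} (h : Holds s X w σ) (hf : Frame P σ τ) (hr : 4 ∉ P.regs)
    (ha : ∀ a < d + 3, a ∉ P.arrs) : Holds s X w τ :=
  h.of_eq (hf.reg 4 hr) fun a h' => hf.arr a (ha a h')

/-- Coordinate `c` of the point in the slot given by register `j`. -/
def slotCoord (d : ℕ) (c j : ℕ) : Term := .read c (.read (d + 1) (.var j))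

lemma Holds.eval_slotCoord {s : ℕ} {X : ℕ → EuclideanSpace ℝ (Fin d)} {w : ℕ → ℝ} {σ : Store}
    (h : Holds s X w σ) {j x : ℕ} (hx : σ.reg x = j) (hj : j < s) (c : Fin d) :
    (slotCoord d c x).eval σ = X j c := by
  simp only [slotCoord, Term.eval, hx, Int.floor_natCast]
  exact h.coord j hj c

/-- The code of the cell of the point in the slot given by register `j`, in the grid whose side
is in register `11`, shifted by `o`. -/
def cellTerm (d j : ℕ) (o : Fin d → Term) : Term :=
  codeTerm d fun c => .floor (.add (.div (slotCoord d c j) (.var 11)) (o c))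

lemma Holds.eval_cellTerm {s : ℕ} {X : ℕ → EuclideanSpace ℝ (Fin d)} {w : ℕ → ℝ} {σ : Store}
    (h : Holds s X w σ) {j x : ℕ} (hx : σ.reg x = j) (hj : j < s) {o : Fin d → Term}
    {o' : Fin d → ℝ} (ho : ∀ c, (o c).eval σ = o' c) :
    (cellTerm d x o).eval σ = vecCode d (cell (σ.reg 11) o' (X j)) := by
  refine eval_codeTerm σ d fun c => ?_
  simp only [Term.eval, h.eval_slotCoord hx hj c, ho c, cell]

/-- An integral shift translates the cell, so `cellTerm` can also address the cells of a box around
a point. -/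
lemma cell_intCast (η : ℝ) (v : Fin d → ℤ) (x : EuclideanSpace ℝ (Fin d)) :
    cell η (fun c => (v c : ℝ)) x = cell η 0 x + v := by
  funext c
  simp [cell]

/-- The distance of the points in the slots given by registers `i` and `j`. -/
def distTerm (d i j : ℕ) : Term :=
  normTerm fun c : Fin d => .sub (slotCoord d c i) (slotCoord d c j)

lemma Holds.eval_distTerm {s : ℕ} {X : ℕ → EuclideanSpace ℝ (Fin d)} {w : ℕ → ℝ} {σ : Store}
    (h : Holds s X w σ) {i j x y : ℕ} (hx : σ.reg x = i) (hi : i < s) (hy : σ.reg y = j)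
    (hj : j < s) : (distTerm d x y).eval σ = dist (X i) (X j) := by
  rw [distTerm, eval_normTerm (v := fun c => X i c - X j c), EuclideanSpace.dist_eq]
  · simp [Real.dist_eq]
  · intro c
    simp only [Term.eval, h.eval_slotCoord hx hi, h.eval_slotCoord hy hj]

/-! ### Counting the weights in neighboring cells -/

/-- Component `c` of the box vector with the number in register `17`. -/
def boxTerm (c : ℕ) : Term := .sub (digitTerm (.var 17) (.var 14) c) (.var 12)

lemma eval_boxTerm {σ : Store} {I t : ℕ} (h12 : σ.reg 12 = I)
    (h14 : σ.reg 14 = (2 * I + 1 : ℕ)) (h17 : σ.reg 17 = t) (c : Fin d) :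
    (boxTerm c).eval σ = (boxVec d I t c : ℝ) := by
  simp only [boxTerm, Term.eval, eval_digitTerm (t := .var 17) (b := .var 14) h17 h14 c, h12,
    boxVec, Int.cast_sub, Int.cast_natCast]

def boxCellTerm (d : ℕ) : Term := cellTerm d 16 fun c => boxTerm c

lemma Holds.eval_boxCellTerm {s : ℕ} {X : ℕ → EuclideanSpace ℝ (Fin d)} {w : ℕ → ℝ} {σ : Store}
    (h : Holds s X w σ) {j I t : ℕ} (h12 : σ.reg 12 = I)
    (h14 : σ.reg 14 = (2 * I + 1 : ℕ)) (h17 : σ.reg 17 = t) (h16 : σ.reg 16 = j) (hj : j < s) :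
    (boxCellTerm d).eval σ = vecCode d (cell (σ.reg 11) 0 (X j) + boxVec d I t) := by
  rw [boxCellTerm, h.eval_cellTerm h16 hj (fun c => eval_boxTerm h12 h14 h17 c), cell_intCast]

/-- Clear the table in all cells of the boxes around the points. -/
def clearTable (d : ℕ) : Cmd :=
  forUp 16 4 (forUp 17 15 (.write (d + 3) (boxCellTerm d) (.const 0)))

/-- Only the addresses that the scan is going to read are cleared; entries left elsewhere by earlier
uses of the table are harmless. -/
lemma clearTable_run {s I : ℕ} {X : ℕ → EuclideanSpace ℝ (Fin d)} {w : ℕ → ℝ} {σ : Store}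
    (h : Holds s X w σ) (h12 : σ.reg 12 = I) (h14 : σ.reg 14 = (2 * I + 1 : ℕ))
    (h15 : σ.reg 15 = ((2 * I + 1) ^ d : ℕ)) :
    Run (clearTable d) σ (s * (((2 * I + 1) ^ d * (1 + 3) + 3) + 3) + 3) fun τ =>
      ∀ j < s, ∀ t < (2 * I + 1) ^ d,
        τ.arr (d + 3) (vecCode d (cell (σ.reg 11) 0 (X j) + boxVec d I t)) = 0 := by
  refine Run.forUp s _ (fun j' τ => ∀ j < j', ∀ t < (2 * I + 1) ^ d,
      τ.arr (d + 3) (vecCode d (cell (σ.reg 11) 0 (X j) + boxVec d I t)) = 0) h.size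
      (by simp [forUp, Cmd.regs]) (by simp [forUp, Cmd.regs]) (by simp) ?_
      (fun τ _ _ hI => hI)
  intro j hj τ hf hx hI
  have hτ := h.of_frame hf (by simp [forUp, Cmd.regs]) (by simp [forUp, Cmd.arrs]; omega)
  have r12 := hf.reg 12 (by simp [forUp, Cmd.regs])
  have r14 := hf.reg 14 (by simp [forUp, Cmd.regs])
  have r15 := hf.reg 15 (by simp [forUp, Cmd.regs])
  have r11 := hf.reg 11 (by simp [forUp, Cmd.regs])
  refine Run.forUp ((2 * I + 1) ^ d) _ (fun t' ρ => (∀ j' < j, ∀ t < (2 * I + 1) ^ d,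
      ρ.arr (d + 3) (vecCode d (cell (σ.reg 11) 0 (X j') + boxVec d I t)) = 0) ∧
      ∀ t < t', ρ.arr (d + 3) (vecCode d (cell (σ.reg 11) 0 (X j) + boxVec d I t)) = 0)
      (by rw [r15, h15])
      (by simp [Cmd.regs]) (by simp [Cmd.regs]) (by simpa using hI) ?_ ?_
  · intro t ht ρ hf' hx' hI'
    refine .write ?_
    have hρ := hτ.of_frame hf' (by simp [forUp, Cmd.regs]) (by simp [forUp, Cmd.arrs]; omega)
    have q12 := hf'.reg 12 (by simp [forUp, Cmd.regs])
    have q14 := hf'.reg 14 (by simp [forUp, Cmd.regs])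
    have q16 := hf'.reg 16 (by simp [forUp, Cmd.regs])
    have q11 := hf'.reg 11 (by simp [forUp, Cmd.regs])
    rw [hρ.eval_boxCellTerm (I := I) (t := t) (j := j) (by rw [q12, r12, h12])
      (by rw [q14, r14, h14]) hx' (by rw [q16, hx]) hj, q11, r11, Int.floor_intCast]
    simp only [Store.setReg_arr, Store.setCell_arr, Term.eval, Int.cast_zero]
    refine ⟨fun j' hj' t' ht' => ?_, fun t' ht' => ?_⟩
    · split_ifs
      · rfl
      · exact hI'.1 j' hj' t' ht'
    · split_ifs with hne
      · rfl
      · refine hI'.2 t' ?_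
        rcases Nat.lt_succ_iff_lt_or_eq.1 ht' with h1 | h1
        · exact h1
        · subst h1; simp at hne
  · intro ρ hf' hx' hI' j' hj' t ht
    rw [Store.setReg_arr]
    rcases Nat.lt_succ_iff_lt_or_eq.1 hj' with h1 | h1
    · exact hI'.1 j' h1 t ht
    · subst h1; exact hI'.2 t ht

/-- Enter the weights of the points into the table. -/
def fillTable (d : ℕ) : Cmd :=
  forUp 16 4 (.write (d + 3) (cellTerm d 16 fun _ => .const 0)
    (.add (.read (d + 3) (cellTerm d 16 fun _ => .const 0)) (.read (d + 2) (.var 16))))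

/-- `Z` is the set of cells known to be clean. Injectivity of `vecCode` ensures that distinct cells
never share an entry. -/
lemma fillTable_run {s : ℕ} {X : ℕ → EuclideanSpace ℝ (Fin d)} {w : ℕ → ℝ} {σ : Store}
    (h : Holds s X w σ) (Z : Set (Fin d → ℤ)) (hZ : ∀ v ∈ Z, σ.arr (d + 3) (vecCode d v) = 0) :
    Run (fillTable d) σ (s * (1 + 3) + 3) fun τ => ∀ v ∈ Z,
      τ.arr (d + 3) (vecCode d v) =
        ∑ i ∈ range s, if cell (σ.reg 11) 0 (X i) = v then w i else 0 := by
  refine Run.forUp s _ (fun j τ => ∀ v ∈ Z, τ.arr (d + 3) (vecCode d v) =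
      ∑ i ∈ range j, if cell (σ.reg 11) 0 (X i) = v then w i else 0) h.size
      (by simp [Cmd.regs]) (by simp [Cmd.regs]) (by simpa using hZ) ?_
      (fun τ _ _ hI => hI)
  intro j hj τ hf hx hI
  refine .write ?_
  have hτ := h.of_frame hf (by simp [forUp, Cmd.regs]) (by simp [forUp, Cmd.arrs]; omega)
  have r11 := hf.reg 11 (by simp [forUp, Cmd.regs])
  intro v hv
  have e := hτ.eval_cellTerm hx hj (o := fun _ => .const 0) (o' := 0) (by simp [Term.eval])
  simp only [Term.eval, e, hx, Int.floor_intCast, Int.floor_natCast, hτ.weight j hj, r11,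
    Store.setReg_arr, Store.setCell_arr, sum_range_succ, true_and, (vecCode_injective d).eq_iff]
  by_cases hc : v = cell (σ.reg 11) 0 (X j)
  · rw [if_pos hc, if_pos hc.symm, ← hc, hI v hv]
  · rw [if_neg hc, if_neg (Ne.symm hc), hI v hv, add_zero]

/-- Set the first `⌊reg 13⌋` cells of array `a` to zero. -/
def clearArray (a : ℕ) : Cmd := forUp 18 13 (.write a (.var 18) (.const 0))

lemma clearArray_run {a I : ℕ} {σ : Store} (h13 : σ.reg 13 = (I + 1 : ℕ)) :
    Run (clearArray a) σ ((I + 1) * (1 + 3) + 3) fun τ => ∀ i ≤ I, τ.arr a i = 0 := by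
  refine Run.forUp (I + 1) _ (fun j τ => ∀ i < j, τ.arr a i = 0) h13
      (by simp [Cmd.regs]) (by simp [Cmd.regs]) (by simp) ?_
      (fun τ _ _ hI i hi => hI i (by omega))
  intro j hj τ hf hx hI
  refine .write ?_
  intro i hi
  simp only [Term.eval, hx, Int.floor_natCast, Store.setReg_arr, Store.setCell_arr, true_and,
    Nat.cast_inj, Int.cast_zero]
  split_ifs with h
  · rfl
  · exact hI i (by omega)

/-- For the point in the slot given by register `16`, sort the weights in the box around it by
the distances of the cells. -/
def fillBuckets (d : ℕ) : Cmd :=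
  forUp 17 15 (.write (d + 4) (normTerm fun c : Fin d => boxTerm c)
    (.add (.read (d + 4) (normTerm fun c : Fin d => boxTerm c)) (.read (d + 3) (boxCellTerm d))))

/-- The machine rounds addresses down, so the norm of the offset serves directly as bucket number.
Corners of the box may write to buckets beyond `I`; these are neither cleared nor read. -/
lemma fillBuckets_run {s I j : ℕ} {X : ℕ → EuclideanSpace ℝ (Fin d)} {w : ℕ → ℝ} {σ : Store}
    (h : Holds s X w σ) (h12 : σ.reg 12 = I) (h14 : σ.reg 14 = (2 * I + 1 : ℕ))
    (h15 : σ.reg 15 = ((2 * I + 1) ^ d : ℕ)) (h16 : σ.reg 16 = j) (hj : j < s)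
    (htab : ∀ t < (2 * I + 1) ^ d,
      σ.arr (d + 3) (vecCode d (cell (σ.reg 11) 0 (X j) + boxVec d I t)) =
        ∑ i ∈ range s, if cell (σ.reg 11) 0 (X i) = cell (σ.reg 11) 0 (X j) + boxVec d I t
          then w i else 0)
    (hbuc : ∀ i ≤ I, σ.arr (d + 4) i = 0) :
    Run (fillBuckets d) σ ((2 * I + 1) ^ d * (1 + 3) + 3) fun τ =>
      ∀ i ≤ I, τ.arr (d + 4) i = ∑ i' ∈ range s,
        if ⌊intNorm (cell (σ.reg 11) 0 (X i') - cell (σ.reg 11) 0 (X j))⌋ = i then w i' else 0 := by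
  refine Run.forUp ((2 * I + 1) ^ d) _ (fun t' τ => ∀ i ≤ I, τ.arr (d + 4) i =
      ∑ t ∈ range t', if ⌊intNorm (boxVec d I t)⌋ = i then
        σ.arr (d + 3) (vecCode d (cell (σ.reg 11) 0 (X j) + boxVec d I t)) else 0) h15
      (by simp [Cmd.regs]) (by simp [Cmd.regs]) (by simpa using hbuc) ?_ ?_
  · intro t ht τ hf hx hI
    refine .write ?_
    have hτ := h.of_frame hf (by simp [forUp, Cmd.regs]) (by simp [forUp, Cmd.arrs]; omega)
    have r11 := hf.reg 11 (by simp [forUp, Cmd.regs])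
    have r12 := hf.reg 12 (by simp [forUp, Cmd.regs])
    have r14 := hf.reg 14 (by simp [forUp, Cmd.regs])
    have r16 := hf.reg 16 (by simp [forUp, Cmd.regs])
    have a3 := hf.arr (d + 3) (by simp [forUp, Cmd.arrs])
    have e := hτ.eval_boxCellTerm (I := I) (t := t) (j := j) (by rw [r12, h12])
      (by rw [r14, h14]) hx (by rw [r16, h16]) hj
    have e2 : (normTerm fun c : Fin d => boxTerm c).eval τ = intNorm (boxVec d I t) :=
      eval_normTerm fun c => eval_boxTerm (by rw [r12, h12]) (by rw [r14, h14]) hx c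
    intro i hi
    simp only [Term.eval, e, e2, Int.floor_intCast, r11, a3, Store.setReg_arr, Store.setCell_arr,
      sum_range_succ, true_and]
    by_cases hc : ⌊intNorm (boxVec d I t)⌋ = i
    · rw [if_pos hc.symm, if_pos hc, hc, hI i hi]
    · rw [if_neg (Ne.symm hc), if_neg hc, hI i hi, add_zero]
  · intro τ hf hx hI i hi
    rw [hI i hi]
    calc _ = ∑ t ∈ range ((2 * I + 1) ^ d), ∑ i' ∈ range s,
          (if ⌊intNorm (boxVec d I t)⌋ = i then (if cell (σ.reg 11) 0 (X i') -
            cell (σ.reg 11) 0 (X j) = boxVec d I t then w i' else 0) else 0) := by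
          refine sum_congr rfl fun t ht => ?_
          split_ifs
          · rw [htab t (mem_range.1 ht)]
            simp only [sub_eq_iff_eq_add']
          · simp
      _ = _ := by
          rw [sum_comm]
          exact sum_congr rfl fun i' _ => sum_boxVec hi _ _

open Classical in
/-- The total weight of the points whose cells are near the cell of `X j`. -/
def nearWeight (s : ℕ) (X : ℕ → EuclideanSpace ℝ (Fin d)) (w : ℕ → ℝ) (η : ℝ) (i j : ℕ) : ℝ :=
  ∑ i' ∈ range s, if Near η i (X j) (X i') then w i' else 0

lemma sum_buckets (s : ℕ) (X : ℕ → EuclideanSpace ℝ (Fin d)) (w : ℕ → ℝ) (η : ℝ) (i j : ℕ) :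
    ∑ b ∈ range (i + 1), ∑ i' ∈ range s,
      (if ⌊intNorm (cell η 0 (X i') - cell η 0 (X j))⌋ = (b : ℤ) then w i' else 0) =
      nearWeight s X w η i j := by
  classical
  rw [sum_comm]
  refine sum_congr rfl fun i' _ => ?_
  set z := ⌊intNorm (cell η 0 (X i') - cell η 0 (X j))⌋ with hz
  have hz0 : 0 ≤ z := Int.floor_nonneg.2 (Real.sqrt_nonneg _)
  by_cases h : Near η i (X j) (X i')
  · rw [if_pos h]
    have h' : z ≤ i := h
    rw [sum_eq_single_of_mem z.toNat (by simp; omega)]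
    · rw [if_pos (by omega)]
    · intro b _ hb
      rw [if_neg (by omega)]
  · rw [if_neg h]
    have h' : ¬ z ≤ i := h
    refine sum_eq_zero fun b hb => ?_
    have := mem_range.1 hb
    rw [if_neg (by omega)]

/-- Find the numbers `i` such that the first `i + 1` buckets have total weight at least `m + 1`. -/
def sumBuckets (d : ℕ) : Cmd :=
  .seq (.set 19 (.const 0)) (forUp 18 13 (.seq
    (.set 19 (.add (.var 19) (.read (d + 4) (.var 18))))
    (.ite (.lt (.var 19) (.add (.var 1) (.const 1))) .skip
      (.write (d + 5) (.var 18) (.add (.read (d + 5) (.var 18)) (.read (d + 2) (.var 16)))))))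

/-- The running total in register 19 is the weight near the point for each radius in turn, so a
single pass serves all thresholds `i ≤ I`. -/
lemma sumBuckets_run {I j : ℕ} {σ : Store} {m W : ℝ} {b : ℕ → ℝ} (h1 : σ.reg 1 = m)
    (h13 : σ.reg 13 = (I + 1 : ℕ)) (h16 : σ.reg 16 = j) (hW : σ.arr (d + 2) j = W)
    (hb : ∀ i ≤ I, σ.arr (d + 4) i = b i) :
    Run (sumBuckets d) σ (1 + ((I + 1) * (4 + 3) + 3) + 1) fun τ =>
      (∀ i ≤ I, τ.arr (d + 5) i = σ.arr (d + 5) i +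
        if m + 1 ≤ ∑ i' ∈ range (i + 1), b i' then W else 0) ∧
      τ.reg 19 = ∑ i' ∈ range (I + 1), b i' := by
  refine Run.seq (R := fun τ => τ = σ.setReg 19 0) (.set (by simp [Term.eval])) ?_
  rintro _ - rfl
  refine Run.forUp (I + 1) _ (fun i' τ => (∀ i ≤ I, τ.arr (d + 5) i = σ.arr (d + 5) i +
        if i < i' ∧ m + 1 ≤ ∑ i' ∈ range (i + 1), b i' then W else 0) ∧
      τ.reg 19 = ∑ i ∈ range i', b i) (by simpa using h13)
      (by simp [Cmd.regs]) (by simp [Cmd.regs]) (by simp) ?_ ?_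
  · rintro i hi τ hf hx ⟨hI, h19⟩
    have r1 := hf.reg 1 (by simp [forUp, Cmd.regs])
    have r16 := hf.reg 16 (by simp [forUp, Cmd.regs])
    have a2 := hf.arr (d + 2) (by simp [forUp, Cmd.arrs])
    have a4 := hf.arr (d + 4) (by simp [forUp, Cmd.arrs])
    simp only [Store.setReg_reg, OfNat.one_ne_ofNat, if_false,
      Store.setReg_arr, Nat.reduceEqDiff] at r1 r16 a2 a4
    have hsum : τ.reg 19 + b i = ∑ i' ∈ range (i + 1), b i' := by rw [h19, sum_range_succ]
    refine Run.seq (T := 1) (T' := 2) (R := fun ρ => ρ = τ.setReg 19 (τ.reg 19 + b i)) (.set ?_) ?_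
    · simp only [Term.eval, hx, Int.floor_natCast, a4, hb i (by omega)]
    rintro _ - rfl
    rw [hsum]
    refine Run.ite (T := 1) (fun hlt => .skip ?_) (fun hlt => .write ?_)
    · simp only [Test.holds, Term.eval, Store.setReg_reg, if_true, OfNat.one_ne_ofNat, if_false,
        r1, h1, Int.cast_one] at hlt
      refine ⟨fun i' hi' => ?_, by simp⟩
      simp only [Store.setReg_arr]
      rw [hI i' hi']
      congr 1
      refine if_congr ?_ rfl rfl
      rcases eq_or_ne i' i with rfl | hne
      · simp [hlt]
      · have : i' < i ↔ i' < i + 1 := by omega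
        simp only [this]
    · simp only [Test.holds, Term.eval, Store.setReg_reg, if_true, OfNat.one_ne_ofNat, if_false,
        r1, h1, Int.cast_one, not_lt] at hlt
      refine ⟨fun i' hi' => ?_, by simp⟩
      simp only [Term.eval, Store.setReg_arr, Store.setCell_arr, Store.setReg_reg,
        Nat.reduceEqDiff, if_false, hx, Int.floor_natCast, r16, h16, a2, hW, Nat.cast_inj, true_and]
      rcases eq_or_ne i' i with rfl | hne
      · rw [if_pos rfl, hI i' hi']
        simp [hlt]
      · rw [if_neg hne, hI i' hi']
        have : i' < i ↔ i' < i + 1 := by omega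
        simp only [this]
  · rintro τ hf hx ⟨hI, h19⟩
    refine ⟨fun i hi => ?_, h19⟩
    rw [hI i hi]
    simp [show i < I + 1 by omega]

/-- Process one point in `scan`. -/
def scanPoint (d : ℕ) : Cmd :=
  .seq (clearArray (d + 4)) (.seq (fillBuckets d) (.seq (sumBuckets d)
    (.write (d + 6) (.var 16) (.var 19))))

lemma scanPoint_run {s I j : ℕ} {X : ℕ → EuclideanSpace ℝ (Fin d)} {w : ℕ → ℝ} {σ : Store} {m : ℝ}
    (h : Holds s X w σ) (h1 : σ.reg 1 = m) (h12 : σ.reg 12 = I) (h13 : σ.reg 13 = (I + 1 : ℕ))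
    (h14 : σ.reg 14 = (2 * I + 1 : ℕ))
    (h15 : σ.reg 15 = ((2 * I + 1) ^ d : ℕ)) (h16 : σ.reg 16 = j) (hj : j < s)
    (htab : ∀ t < (2 * I + 1) ^ d,
      σ.arr (d + 3) (vecCode d (cell (σ.reg 11) 0 (X j) + boxVec d I t)) =
        ∑ i ∈ range s, if cell (σ.reg 11) 0 (X i) = cell (σ.reg 11) 0 (X j) + boxVec d I t
          then w i else 0) :
    Run (scanPoint d) σ (31 * ((2 * I + 1) ^ d + I + 1)) fun τ =>
      (∀ i ≤ I, τ.arr (d + 5) i = σ.arr (d + 5) i +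
        if m + 1 ≤ nearWeight s X w (σ.reg 11) i j then w j else 0) ∧
      τ.arr (d + 6) j = nearWeight s X w (σ.reg 11) I j ∧
      ∀ z : ℤ, z ≠ j → τ.arr (d + 6) z = σ.arr (d + 6) z := by
  refine Run.conseq (Q := fun τ => (∀ i ≤ I, τ.arr (d + 5) i = σ.arr (d + 5) i +
        if m + 1 ≤ nearWeight s X w (σ.reg 11) i j then w j else 0) ∧
      τ.arr (d + 6) j = nearWeight s X w (σ.reg 11) I j ∧
      ∀ z : ℤ, z ≠ j → τ.arr (d + 6) z = σ.arr (d + 6) z)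
    (Run.seq (clearArray_run h13) (T' := (2 * I + 1) ^ d * (1 + 3) + 3 +
      ((1 + ((I + 1) * (4 + 3) + 3) + 1) + 1 + 1) + 1) ?_) ?_ (fun _ _ => id)
  swap
  · generalize (2 * I + 1) ^ d = B
    omega
  intro τ hf hb
  have hτ := h.of_frame hf (by simp [clearArray, forUp, Cmd.regs])
    (by simp [clearArray, forUp, Cmd.arrs]; omega)
  have r1 := hf.reg 1 (by simp [clearArray, forUp, Cmd.regs])
  have r11 := hf.reg 11 (by simp [clearArray, forUp, Cmd.regs])
  have r12 := hf.reg 12 (by simp [clearArray, forUp, Cmd.regs])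
  have r13 := hf.reg 13 (by simp [clearArray, forUp, Cmd.regs])
  have r14 := hf.reg 14 (by simp [clearArray, forUp, Cmd.regs])
  have r15 := hf.reg 15 (by simp [clearArray, forUp, Cmd.regs])
  have r16 := hf.reg 16 (by simp [clearArray, forUp, Cmd.regs])
  have a3 := hf.arr (d + 3) (by simp [clearArray, forUp, Cmd.arrs])
  have a5 := hf.arr (d + 5) (by simp [clearArray, forUp, Cmd.arrs])
  have a6 := hf.arr (d + 6) (by simp [clearArray, forUp, Cmd.arrs])
  refine Run.seq (fillBuckets_run hτ (by rw [r12, h12]) (by rw [r14, h14]) (by rw [r15, h15])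
    (by rw [r16, h16]) hj (by rw [r11, a3]; exact htab) hb) ?_
  rw [r11]
  intro ρ hg hb'
  have hρ := hτ.of_frame hg (by simp [fillBuckets, forUp, Cmd.regs])
    (by simp [fillBuckets, forUp, Cmd.arrs]; omega)
  have q1 := hg.reg 1 (by simp [fillBuckets, forUp, Cmd.regs])
  have q13 := hg.reg 13 (by simp [fillBuckets, forUp, Cmd.regs])
  have q16 := hg.reg 16 (by simp [fillBuckets, forUp, Cmd.regs])
  have b5 := hg.arr (d + 5) (by simp [fillBuckets, forUp, Cmd.arrs])
  have b6 := hg.arr (d + 6) (by simp [fillBuckets, forUp, Cmd.arrs])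
  refine Run.seq (T' := 1) (sumBuckets_run (by rw [q1, r1, h1]) (by rw [q13, r13, h13])
    (by rw [q16, r16, h16]) (hρ.weight j hj) hb') ?_
  simp only [sum_buckets]
  rintro π hk ⟨hO, h19⟩
  have p16 := hk.reg 16 (by simp [sumBuckets, forUp, Cmd.regs])
  have c6 := hk.arr (d + 6) (by simp [sumBuckets, forUp, Cmd.arrs])
  refine .write ?_
  simp only [Term.eval, p16, q16, r16, h16, Int.floor_natCast, h19, Store.setCell_arr,
    Nat.add_left_cancel_iff, Nat.reduceEqDiff, false_and, if_false, true_and, if_true]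
  refine ⟨fun i hi => ?_, fun z hz => ?_⟩
  · rw [hO i hi, b5, a5]
  · rw [if_neg hz, c6, b6, a6]

/-- For the side `η` in register `11` and the bound `I` in register `12`, compute in cell `i ≤ I`
of array `d + 5` the total weight of the points with weight at least `m + 1` in the cells
at distance less than `i + 1`, and in array `d + 6` the weights near the points, for `i = I`. -/
def scan (d : ℕ) : Cmd :=
  .seq (.seq (.set 13 (.add (.var 12) (.const 1)))
    (.seq (.set 14 (.add (.mul (.const 2) (.var 12)) (.const 1)))
      (.set 15 (powTerm (.var 14) d))))
  (.seq (clearArray (d + 5)) (.seq (clearTable d) (.seq (fillTable d) (forUp 16 4 (scanPoint d)))))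

lemma scan_regs (d : ℕ) : (scan d).regs ⊆ [13, 14, 15, 16, 17, 18, 19] := by
  simp [scan, clearArray, clearTable, fillTable, scanPoint, fillBuckets, sumBuckets, forUp,
    Cmd.regs]

lemma scan_arrs (d : ℕ) : (scan d).arrs ⊆ [d + 3, d + 4, d + 5, d + 6] := by
  simp [scan, clearArray, clearTable, fillTable, scanPoint, fillBuckets, sumBuckets, forUp,
    Cmd.arrs]

/-- This approximate decision procedure is used at every scale. With bounded `I` it takes linear
time, as needed for the rounds; with `I` of order 1/ε it takes the n/ε^d steps of the final
selection. -/
theorem scan_run {s I : ℕ} {X : ℕ → EuclideanSpace ℝ (Fin d)} {w : ℕ → ℝ} {σ : Store} {m η : ℝ}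
    (h : Holds s X w σ) (h1 : σ.reg 1 = m) (h11 : σ.reg 11 = η) (h12 : σ.reg 12 = I) :
    Run (scan d) σ (60 * ((s + 1) * ((2 * I + 1) ^ d + I + 1))) fun τ =>
      (∀ i ≤ I, τ.arr (d + 5) i = deepWeight s (fun j i' => Near η i (X j) (X i')) w m) ∧
      ∀ j < s, τ.arr (d + 6) j = nearWeight s X w η I j := by
  subst h11
  refine Run.conseq (Q := fun τ =>
      (∀ i ≤ I, τ.arr (d + 5) i = deepWeight s (fun j i' => Near (σ.reg 11) i (X j) (X i')) w m) ∧
      ∀ j < s, τ.arr (d + 6) j = nearWeight s X w (σ.reg 11) I j)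
    (Run.seq (T' := ((I + 1) * (1 + 3) + 3) + ((s * (((2 * I + 1) ^ d * (1 + 3) + 3) + 3) + 3) +
      ((s * (1 + 3) + 3) + (s * (31 * ((2 * I + 1) ^ d + I + 1) + 3) + 3) + 1) + 1) + 1)
      (R := fun τ => τ.reg 13 = (I + 1 : ℕ) ∧ τ.reg 14 = (2 * I + 1 : ℕ) ∧
        τ.reg 15 = ((2 * I + 1) ^ d : ℕ))
      (Run.straight (by simp [Cmd.Straight]) ?_) ?_) ?_ (fun _ _ => id)
  · simp [Cmd.exec, Term.eval, h12]
  swap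
  · simp only [Cmd.size]
    generalize (2 * I + 1) ^ d = B
    nlinarith [Nat.zero_le (s * B), Nat.zero_le (s * I)]
  rintro τ hf ⟨h13, h14, h15⟩
  have hτ := h.of_frame hf (by simp [Cmd.regs]) (by simp [Cmd.arrs])
  have r1 := hf.reg 1 (by simp [Cmd.regs])
  have r11 := hf.reg 11 (by simp [Cmd.regs])
  have r12 := hf.reg 12 (by simp [Cmd.regs])
  rw [h1] at r1; rw [h12] at r12
  clear hf h1 h12 h
  generalize σ.reg 11 = η at r11 ⊢
  refine Run.seq (clearArray_run h13) ?_
  intro τ₁ hf hO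
  replace hτ := hτ.of_frame hf (by simp [clearArray, forUp, Cmd.regs])
    (by simp [clearArray, forUp, Cmd.arrs]; omega)
  rw [← hf.reg 1 (by simp [clearArray, forUp, Cmd.regs])] at r1
  rw [← hf.reg 11 (by simp [clearArray, forUp, Cmd.regs])] at r11
  rw [← hf.reg 12 (by simp [clearArray, forUp, Cmd.regs])] at r12
  rw [← hf.reg 13 (by simp [clearArray, forUp, Cmd.regs])] at h13
  rw [← hf.reg 14 (by simp [clearArray, forUp, Cmd.regs])] at h14
  rw [← hf.reg 15 (by simp [clearArray, forUp, Cmd.regs])] at h15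
  clear hf
  refine Run.seq (clearTable_run hτ r12 h14 h15) ?_
  intro τ₂ hf hT
  replace hτ := hτ.of_frame hf (by simp [clearTable, forUp, Cmd.regs])
    (by simp [clearTable, forUp, Cmd.arrs]; omega)
  rw [r11] at hT
  rw [← hf.reg 1 (by simp [clearTable, forUp, Cmd.regs])] at r1
  rw [← hf.reg 11 (by simp [clearTable, forUp, Cmd.regs])] at r11
  rw [← hf.reg 12 (by simp [clearTable, forUp, Cmd.regs])] at r12
  rw [← hf.reg 13 (by simp [clearTable, forUp, Cmd.regs])] at h13
  rw [← hf.reg 14 (by simp [clearTable, forUp, Cmd.regs])] at h14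
  rw [← hf.reg 15 (by simp [clearTable, forUp, Cmd.regs])] at h15
  rw [← hf.arr (d + 5) (by simp [clearTable, forUp, Cmd.arrs])] at hO
  clear hf
  refine Run.seq (fillTable_run hτ
    {v | ∃ j < s, ∃ t < (2 * I + 1) ^ d, v = cell η 0 (X j) + boxVec d I t} ?_) ?_
  · rintro _ ⟨j, hj, t, ht, rfl⟩
    exact hT j hj t ht
  intro τ₃ hf hT'
  replace hτ := hτ.of_frame hf (by simp [fillTable, forUp, Cmd.regs])
    (by simp [fillTable, forUp, Cmd.arrs]; omega)
  rw [r11] at hT'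
  rw [← hf.reg 1 (by simp [fillTable, forUp, Cmd.regs])] at r1
  rw [← hf.reg 11 (by simp [fillTable, forUp, Cmd.regs])] at r11
  rw [← hf.reg 12 (by simp [fillTable, forUp, Cmd.regs])] at r12
  rw [← hf.reg 13 (by simp [fillTable, forUp, Cmd.regs])] at h13
  rw [← hf.reg 14 (by simp [fillTable, forUp, Cmd.regs])] at h14
  rw [← hf.reg 15 (by simp [fillTable, forUp, Cmd.regs])] at h15
  rw [← hf.arr (d + 5) (by simp [fillTable, forUp, Cmd.arrs])] at hO
  clear hf hT
  refine Run.forUp s _ (fun j' ρ => (∀ i ≤ I, ρ.arr (d + 5) i =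
      ∑ j ∈ range j', if m + 1 ≤ nearWeight s X w η i j then w j else 0) ∧
      ∀ j < j', ρ.arr (d + 6) j = nearWeight s X w η I j) hτ.size
      (by simp [scanPoint, clearArray, fillBuckets, sumBuckets, forUp, Cmd.regs])
      (by simp [scanPoint, clearArray, fillBuckets, sumBuckets, forUp, Cmd.regs])
      (by simpa using hO) ?_ (fun ρ _ _ hI => hI)
  rintro j hj ρ hf hx ⟨hI1, hI2⟩
  have q (x : ℕ) (hx : x ∉ [16, 18, 17, 19]) := hf.reg x
    (by simp only [scanPoint, clearArray, fillBuckets, sumBuckets, forUp, Cmd.regs]; simp_all)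
  have hρ := hτ.of_frame hf
    (by simp [scanPoint, clearArray, fillBuckets, sumBuckets, forUp, Cmd.regs])
    (by simp [scanPoint, clearArray, fillBuckets, sumBuckets, forUp, Cmd.arrs]; omega)
  have a3 := hf.arr (d + 3)
    (by simp [scanPoint, clearArray, fillBuckets, sumBuckets, forUp, Cmd.arrs])
  have q11 := q 11 (by simp)
  rw [r11] at q11
  refine (scanPoint_run hρ (m := m) (I := I) (j := j) (by rw [q 1 (by simp), r1])
    (by rw [q 12 (by simp), r12])
    (by rw [q 13 (by simp), h13]) (by rw [q 14 (by simp), h14]) (by rw [q 15 (by simp), h15])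
    hx hj ?_).conseq le_rfl ?_
  · intro t ht
    rw [q11, a3]
    exact hT' _ ⟨j, hj, t, ht, rfl⟩
  · rintro π - ⟨hO1, hO2, hO3⟩
    rw [q11] at hO1 hO2
    refine ⟨fun i hi => ?_, fun j' hj' => ?_⟩
    · rw [Store.setReg_arr, hO1 i hi, hI1 i hi, sum_range_succ]
    · rw [Store.setReg_arr]
      rcases Nat.lt_succ_iff_lt_or_eq.1 hj' with hlt | rfl
      · rw [hO3 j' (by exact_mod_cast hlt.ne), hI2 j' hlt]
      · exact hO2

/-! ### The input -/

structure Input (n : ℕ) (X : ℕ → EuclideanSpace ℝ (Fin d)) (w : ℕ → ℝ) (m k ε : ℝ)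
    (σ : Store) : Prop where
  size : σ.reg 0 = n
  m : σ.reg 1 = m
  k : σ.reg 2 = k
  ε : σ.reg 3 = ε
  coord : ∀ j < n, ∀ c : Fin d, σ.arr c j = X j c
  weight : ∀ j < n, σ.arr d j = w j

lemma Input.of_frame {n : ℕ} {X : ℕ → EuclideanSpace ℝ (Fin d)} {w : ℕ → ℝ} {m k ε : ℝ}
    {σ τ : Store} {P : Cmd} (h : Input n X w m k ε σ) (hf : Frame P σ τ)
    (hr : ∀ x < 4, x ∉ P.regs) (ha : ∀ a < d + 1, a ∉ P.arrs) : Input n X w m k ε τ where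
  size := (hf.reg 0 (hr 0 (by omega))).trans h.size
  m := (hf.reg 1 (hr 1 (by omega))).trans h.m
  k := (hf.reg 2 (hr 2 (by omega))).trans h.k
  ε := (hf.reg 3 (hr 3 (by omega))).trans h.ε
  coord j hj c := by rw [hf.arr c (ha c (by omega)), h.coord j hj c]
  weight j hj := by rw [hf.arr d (ha d (by omega)), h.weight j hj]

/-- Make the input the working set, and compute in register `22` the total weight of the points
of weight at least `m + 1`. -/
def init (d : ℕ) : Cmd :=
  .seq (.seq (.set 4 (.var 0)) (.seq (.set 5 (.var 2)) (.set 22 (.const 0))))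
    (forUp 16 4 (.seq (.write (d + 1) (.var 16) (.var 16))
      (.seq (.write (d + 2) (.var 16) (.read d (.var 16)))
        (.ite (.lt (.read d (.var 16)) (.add (.var 1) (.const 1))) .skip
          (.set 22 (.add (.var 22) (.read d (.var 16))))))))

/-- For distinct points, register 22 decides whether f = 0; see `reach_zero_iff`. -/
theorem init_run {n : ℕ} {X : ℕ → EuclideanSpace ℝ (Fin d)} {w : ℕ → ℝ} {m k ε : ℝ} {σ : Store}
    (h : Input n X w m k ε σ) :
    Run (init d) σ (30 * (n + 1)) fun τ => Holds n X w τ ∧ τ.reg 5 = k ∧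
      τ.reg 22 = ∑ i ∈ range n, if m + 1 ≤ w i then w i else 0 := by
  refine Run.conseq (Q := fun τ => Holds n X w τ ∧ τ.reg 5 = k ∧
      τ.reg 22 = ∑ i ∈ range n, if m + 1 ≤ w i then w i else 0)
    (Run.seq (T' := n * (7 + 3) + 3)
      (R := fun τ => τ.reg 4 = n ∧ τ.reg 5 = k ∧ τ.reg 22 = 0)
      (Run.straight (by simp [Cmd.Straight]) ?_) ?_)
    (by simp only [Cmd.size]; omega) (fun _ _ => id)
  · simp [Cmd.exec, Term.eval, h.size, h.k]
  rintro τ hf ⟨h4, h5, h22⟩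
  have hτ := h.of_frame hf (by simp [Cmd.regs]; omega) (by simp [Cmd.arrs])
  refine Run.forUp n _ (fun j' ρ => (∀ j < j', ρ.arr (d + 1) j = j ∧ ρ.arr (d + 2) j = w j) ∧
      ρ.reg 22 = ∑ i ∈ range j', if m + 1 ≤ w i then w i else 0) h4
      (by simp [Cmd.regs]) (by simp [Cmd.regs]) (by simpa using h22) ?_ ?_
  · rintro j hj ρ hg hx ⟨hI, hI22⟩
    have hρ := hτ.of_frame hg (by simp [forUp, Cmd.regs]; omega)
      (by simp [forUp, Cmd.arrs]; omega)
    refine Run.conseq (Run.straight (P := _) (by simp [Cmd.Straight])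
      (Q := fun ρ => (∀ j' < j + 1, ρ.arr (d + 1) j' = j' ∧ ρ.arr (d + 2) j' = w j') ∧
      ρ.reg 22 = ∑ i ∈ range (j + 1), if m + 1 ≤ w i then w i else 0) ?_) (by simp [Cmd.size]) ?_
    · have hw := hρ.weight j hj
      have hA : ∀ j' < j + 1, j' ≠ j → ρ.arr (d + 1) j' = j' ∧ ρ.arr (d + 2) j' = w j' :=
        fun j' hj' hne => hI j' (by omega)
      rw [sum_range_succ, ← hI22]
      simp only [Cmd.exec, Term.eval, hx, Int.floor_natCast, Test.holds, Store.setCell_reg,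
        Store.setCell_arr, Int.cast_one, Nat.left_eq_add, hw, hρ.m,
        OfNat.ofNat_ne_zero, one_ne_zero, false_and, if_false]
      split_ifs with h1 h2 h2
      · linarith
      · refine ⟨fun j' hj' => ?_, by simp⟩
        rcases eq_or_ne j' j with rfl | hne
        · simp
        · simpa [hne] using hA j' hj' hne
      · refine ⟨fun j' hj' => ?_, by simp⟩
        rcases eq_or_ne j' j with rfl | hne
        · simp
        · simpa [hne] using hA j' hj' hne
      · linarith
    · rintro π - ⟨h1, h2⟩
      exact ⟨by simpa using h1, by simpa using h2⟩
  · rintro ρ hg hx ⟨hI, hI22⟩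
    have hρ := hτ.of_frame hg (by simp [forUp, Cmd.regs]; omega)
      (by simp [forUp, Cmd.arrs]; omega)
    have q4 := hg.reg 4 (by simp [forUp, Cmd.regs])
    have q5 := hg.reg 5 (by simp [forUp, Cmd.regs])
    refine ⟨⟨by rw [q4, h4], fun j hj c => ?_, fun j hj => (hI j hj).2⟩, by rw [q5, h5], hI22⟩
    rw [(hI j hj).1, Int.floor_natCast, hρ.coord j hj c]

/-! ### Nearest neighbors -/

/-- Compute in register `10` the distance from the point in the slot given by register `8`
to its nearest neighbor. -/
def nearest (d : ℕ) : Cmd :=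
  .seq (.seq (.ite (.lt (.var 8) (.const 1)) (.set 21 (.const 1)) (.set 21 (.const 0)))
      (.set 10 (distTerm d 8 21)))
    (forUp 16 4 (.ite (.and (.not (.and (.not (.lt (.var 16) (.var 8)))
        (.not (.lt (.var 8) (.var 16))))) (.lt (distTerm d 8 16) (.var 10)))
      (.set 10 (distTerm d 8 16)) .skip))

theorem nearest_run {s u : ℕ} {X : ℕ → EuclideanSpace ℝ (Fin d)} {w : ℕ → ℝ} {σ : Store}
    (h : Holds s X w σ) (h8 : σ.reg 8 = u) (hu : u < s) (hs : 2 ≤ s) :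
    Run (nearest d) σ (20 * (s + 1)) fun τ =>
      (∃ j < s, j ≠ u ∧ τ.reg 10 = dist (X u) (X j)) ∧
      ∀ j < s, j ≠ u → τ.reg 10 ≤ dist (X u) (X j) := by
  refine Run.conseq (Q := fun τ =>
      (∃ j < s, j ≠ u ∧ τ.reg 10 = dist (X u) (X j)) ∧
      ∀ j < s, j ≠ u → τ.reg 10 ≤ dist (X u) (X j))
    (Run.seq (T' := s * (3 + 3) + 3)
      (R := fun τ => (∃ j < s, j ≠ u ∧ τ.reg 10 = dist (X u) (X j)))
      (Run.straight (by simp [Cmd.Straight]) ?_) ?_)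
    (by simp only [Cmd.size]; omega) (fun _ _ => id)
  · simp only [Cmd.exec, Test.holds, Term.eval, h8, Int.cast_one, Int.cast_zero]
    -- The search starts from slot 1 if `u = 0` and from slot 0 otherwise; a slot other than `u`
    -- exists because 2 ≤ s.
    by_cases hu0 : u = 0
    · have hlt : ((u : ℕ) : ℝ) < 1 := by simp [hu0]
      rw [if_pos hlt]
      have h' : Holds s X w (σ.setReg 21 1) := h.of_eq (by simp) (fun _ _ => rfl)
      refine ⟨1, by omega, by omega, ?_⟩
      rw [h'.eval_distTerm (i := u) (j := 1) (by simp [h8]) hu (by simp) (by omega)]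
      simp
    · have hlt : ¬ ((u : ℕ) : ℝ) < 1 := by
        rw [not_lt]; exact_mod_cast Nat.one_le_iff_ne_zero.2 hu0
      rw [if_neg hlt]
      have h' : Holds s X w (σ.setReg 21 0) := h.of_eq (by simp) (fun _ _ => rfl)
      refine ⟨0, by omega, by omega, ?_⟩
      rw [h'.eval_distTerm (i := u) (j := 0) (by simp [h8]) hu (by simp) (by omega)]
      simp
  rintro τ hf hex
  have hτ := h.of_frame hf (by simp [Cmd.regs]) (by simp [Cmd.arrs])
  have r8 := hf.reg 8 (by simp [Cmd.regs])
  refine Run.forUp s _ (fun j' ρ => (∃ j < s, j ≠ u ∧ ρ.reg 10 = dist (X u) (X j)) ∧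
      ∀ j < j', j ≠ u → ρ.reg 10 ≤ dist (X u) (X j)) hτ.size
      (by simp [Cmd.regs]) (by simp [Cmd.regs]) (by simpa using hex) ?_ (fun _ _ _ hI => hI)
  rintro j hj ρ hg hx ⟨hI1, hI2⟩
  have hρ := hτ.of_frame hg (by simp [forUp, Cmd.regs]) (by simp [forUp, Cmd.arrs])
  have q8 := hg.reg 8 (by simp [forUp, Cmd.regs])
  rw [r8, h8] at q8
  have e := hρ.eval_distTerm q8 hu hx hj
  refine Run.conseq (T := 2) (Run.ite (T := 1)
    (Q := fun ρ => (∃ j < s, j ≠ u ∧ ρ.reg 10 = dist (X u) (X j)) ∧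
      ∀ j' < j + 1, j' ≠ u → ρ.reg 10 ≤ dist (X u) (X j')) (fun hb => .set ?_) (fun hb => .skip ?_))
      (by norm_num) ?_
  · simp only [Test.holds, Term.eval, e, hx, q8, Nat.cast_lt] at hb
    simp only [e, Store.setReg_reg, if_true]
    refine ⟨⟨j, hj, by omega, rfl⟩, fun j' hj' hne => ?_⟩
    rcases Nat.lt_succ_iff_lt_or_eq.1 hj' with hlt | rfl
    · exact hb.2.le.trans (hI2 j' hlt hne)
    · exact le_rfl
  · simp only [Test.holds, Term.eval, e, hx, q8, Nat.cast_lt] at hb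
    refine ⟨hI1, fun j' hj' hne => ?_⟩
    rcases Nat.lt_succ_iff_lt_or_eq.1 hj' with hlt | rfl
    · exact hI2 j' hlt hne
    · by_contra hlt
      exact hb ⟨by omega, not_le.1 hlt⟩
  · rintro π - hQ
    simpa using hQ

/-! ### Pruning -/

/-- Remove the points whose weight is not smaller than the weight near them according to
array `d + 6`. -/
def prune (d : ℕ) : Cmd :=
  .seq (.set 20 (.const 0)) (.seq (forUp 16 4
    (.ite (.lt (.read (d + 2) (.var 16)) (.read (d + 6) (.var 16)))
      (.seq (.write (d + 1) (.var 20) (.read (d + 1) (.var 16)))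
        (.seq (.write (d + 2) (.var 20) (.read (d + 2) (.var 16)))
          (.set 20 (.add (.var 20) (.const 1)))))
      (.ite (.lt (.read (d + 2) (.var 16)) (.add (.var 1) (.const 1))) .skip
        (.set 5 (.sub (.var 5) (.read (d + 2) (.var 16)))))))
    (.set 4 (.var 20)))

open Classical in
-- The map `e` lists the kept slots. The identity for all `F` expresses this in the form used both
-- for the weights in `deepWeight_prune` and, with `F = 1`, for the new size. Register 5 loses the
-- weight of those deleted points that reach m + 1 on their own.
theorem prune_run {s : ℕ} {X : ℕ → EuclideanSpace ℝ (Fin d)} {w : ℕ → ℝ} {σ : Store} {m : ℝ}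
    {N : ℕ → ℝ} (h : Holds s X w σ) (h1 : σ.reg 1 = m) (hN : ∀ j < s, σ.arr (d + 6) j = N j) :
    Run (prune d) σ (20 * (s + 1)) fun τ => ∃ (s' : ℕ) (e : ℕ → ℕ), Holds s' (fun a => X (e a)) (fun a => w (e a)) τ ∧
      (∀ F : ℕ → ℝ, ∑ a ∈ range s', F (e a) = ∑ j ∈ range s, if w j < N j then F j else 0) ∧
      (∀ a < s', e a < s ∧ w (e a) < N (e a)) ∧ (∀ a < s', ∀ b < s', e a = e b → a = b) ∧
      τ.reg 5 = σ.reg 5 - ∑ j ∈ range s, if ¬ w j < N j ∧ m + 1 ≤ w j then w j else 0 := by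
  refine Run.conseq (T := 1 + ((s * (9 + 3) + 3) + 1 + 1) + 1) (Run.seq (T' := (s * (9 + 3) + 3) + 1 + 1)
      (R := fun τ => τ = σ.setReg 20 0) (.set (by simp [Term.eval]))
      (Q := fun τ => ∃ (s' : ℕ) (e : ℕ → ℕ), Holds s' (fun a => X (e a)) (fun a => w (e a)) τ ∧
      (∀ F : ℕ → ℝ, ∑ a ∈ range s', F (e a) = ∑ j ∈ range s, if w j < N j then F j else 0) ∧
      (∀ a < s', e a < s ∧ w (e a) < N (e a)) ∧ (∀ a < s', ∀ b < s', e a = e b → a = b) ∧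
      τ.reg 5 = σ.reg 5 - ∑ j ∈ range s, if ¬ w j < N j ∧ m + 1 ≤ w j then w j else 0) ?_)
    (by omega) (fun _ _ => id)
  rintro _ - rfl
  have key : Run (forUp 16 4
    (.ite (.lt (.read (d + 2) (.var 16)) (.read (d + 6) (.var 16)))
      (.seq (.write (d + 1) (.var 20) (.read (d + 1) (.var 16)))
        (.seq (.write (d + 2) (.var 20) (.read (d + 2) (.var 16)))
          (.set 20 (.add (.var 20) (.const 1)))))
      (.ite (.lt (.read (d + 2) (.var 16)) (.add (.var 1) (.const 1))) .skip
        (.set 5 (.sub (.var 5) (.read (d + 2) (.var 16))))))) (σ.setReg 20 0) (s * (9 + 3) + 3)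
      fun τ => ∃ (s' : ℕ) (e : ℕ → ℕ), τ.reg 20 = s' ∧
        (∀ a < s', τ.arr (d + 1) a = σ.arr (d + 1) (e a) ∧ τ.arr (d + 2) a = w (e a)) ∧
        (∀ F : ℕ → ℝ, ∑ a ∈ range s', F (e a) = ∑ j ∈ range s, if w j < N j then F j else 0) ∧
        (∀ a < s', e a < s ∧ w (e a) < N (e a)) ∧ (∀ a < s', ∀ b < s', e a = e b → a = b) ∧
        τ.reg 5 = σ.reg 5 - ∑ j ∈ range s, if ¬ w j < N j ∧ m + 1 ≤ w j then w j else 0 := by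
    -- The compaction is done in place: by s' ≤ j', writing never overtakes reading, so slots from
    -- j' on are still intact.
    refine Run.forUp s _ (fun j' τ => ∃ (s' : ℕ) (e : ℕ → ℕ), s' ≤ j' ∧ τ.reg 20 = s' ∧
        (∀ j < s, j' ≤ j → τ.arr (d + 1) j = σ.arr (d + 1) j ∧ τ.arr (d + 2) j = w j) ∧
        (∀ a < s', τ.arr (d + 1) a = σ.arr (d + 1) (e a) ∧ τ.arr (d + 2) a = w (e a)) ∧
        (∀ F : ℕ → ℝ, ∑ a ∈ range s', F (e a) = ∑ j ∈ range j', if w j < N j then F j else 0) ∧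
        (∀ a < s', e a < j' ∧ w (e a) < N (e a)) ∧ (∀ a < s', ∀ b < s', e a = e b → a = b) ∧
        τ.reg 5 = σ.reg 5 - ∑ j ∈ range j', if ¬ w j < N j ∧ m + 1 ≤ w j then w j else 0)
        (by simpa using h.size) (by simp [Cmd.regs]) (by simp [Cmd.regs]) ?_ ?_ ?_
    · exact ⟨0, id, le_rfl, by simp, fun j hj _ => by simpa using h.weight j hj, by simp, by simp,
        by simp, by simp, by simp⟩
    · rintro j hj τ hf hx ⟨s', e, hs', h20, hT, hH, hF, he, hinj, h5⟩
      have r1 := hf.reg 1 (by simp [forUp, Cmd.regs])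
      rw [Store.setReg_reg, if_neg (by norm_num), h1] at r1
      have a6 := hf.arr (d + 6) (by simp [forUp, Cmd.arrs])
      obtain ⟨hT1, hT2⟩ := hT j hj le_rfl
      have ew : (Term.read (d + 2) (.var 16)).eval τ = w j := by
        simp only [Term.eval, hx, Int.floor_natCast, hT2]
      have eN : (Term.read (d + 6) (.var 16)).eval τ = N j := by
        simp only [Term.eval, hx, Int.floor_natCast, a6, Store.setReg_arr, hN j hj]
      refine Run.ite (T := 8) (fun hb => ?_) (fun hb => ?_)
      · simp only [Test.holds, ew, eN] at hb
        refine Run.conseq (Run.straight (P := _) (by simp [Cmd.Straight])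
          (Q := fun ρ => ρ = ((τ.setCell (d + 1) s' (σ.arr (d + 1) j)).setCell (d + 2) s'
            (w j)).setReg 20 (s' + 1)) ?_) (by simp [Cmd.size]) ?_
        · simp [Cmd.exec, Term.eval, h20, hx, hT1, hT2]
        · rintro _ - rfl
          refine ⟨s' + 1, fun a => if a = s' then j else e a, by omega, by simp, ?_, ?_, ?_, ?_, ?_, ?_⟩
          · intro j' hj' hle
            have hne : j' ≠ s' := by omega
            simpa [hne] using hT j' hj' (by omega)
          · intro a ha
            rcases eq_or_ne a s' with rfl | hne
            · simp
            · simpa [hne] using hH a (by omega)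
          · intro F
            rw [sum_range_succ, sum_range_succ, ← hF F, if_pos hb]
            simp only [if_true]
            congr 1
            refine sum_congr rfl fun a ha => ?_
            rw [if_neg (mem_range.1 ha).ne]
          · intro a ha
            rcases eq_or_ne a s' with rfl | hne
            · simpa using hb
            · have := he a (by omega)
              simp only [hne, if_false]
              exact ⟨by omega, this.2⟩
          · intro a ha b hb'
            have ga := he a
            have gb := he b
            dsimp only
            split_ifs with ea eb eb
            · omega
            · intro hE
              have := gb (by omega)
              omega
            · intro hE
              have := ga (by omega)
              omega
            · exact hinj a (by omega) b (by omega)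
          · rw [sum_range_succ, if_neg (by simp [hb]), add_zero, ← h5]
            simp
      · simp only [Test.holds, ew, eN] at hb
        refine Run.conseq (T := 2) (Run.ite (T := 1) (Q := fun ρ => ρ = τ.setReg 5 (σ.reg 5 -
          ∑ j ∈ range (j + 1), if ¬ w j < N j ∧ m + 1 ≤ w j then w j else 0))
            (fun hb' => .skip ?_) (fun hb' => .set ?_)) (by norm_num) ?_
        · simp only [Test.holds, Term.eval, hx, Int.floor_natCast, hT2, r1, Int.cast_one] at hb'
          rw [sum_range_succ, if_neg (by simp [hb']), add_zero, ← h5]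
          simp [Store.setReg]
        · simp only [Test.holds, Term.eval, hx, Int.floor_natCast, hT2, r1, Int.cast_one, not_lt] at hb'
          rw [sum_range_succ, if_pos ⟨hb, hb'⟩, ← sub_sub, ← h5]
          congr 1
          simp only [Term.eval] at ew ⊢
          rw [ew]
        · rintro _ - rfl
          refine ⟨s', e, by omega, by simpa using h20, fun j' hj' hle => ?_, by simpa using hH, ?_, ?_,
            hinj, by simp⟩
          · simpa using hT j' hj' (by omega)
          · intro F
            rw [sum_range_succ, ← hF F, if_neg hb, add_zero]
          · intro a ha
            have := he a ha
            exact ⟨by omega, this.2⟩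
    · rintro τ hf hx ⟨s', e, hs', h20, hT, hH, hF, he, hinj, h5⟩
      exact ⟨s', e, h20, hH, hF, he, hinj, h5⟩
  refine Run.seq (T' := 1) key ?_
  rintro τ hf ⟨s', e, h20, hH, hF, he, hinj, h5⟩
  refine .set ⟨s', e, ⟨by simpa [Term.eval] using h20, fun a ha c => ?_, fun a ha => (hH a ha).2⟩,
    hF, he, hinj, by simpa using h5⟩
  rw [Store.setReg_arr, (hH a ha).1, hf.arr c (by simp [forUp, Cmd.arrs]; omega)]
  exact h.coord _ (he a ha).1 c

/-! ### Netting -/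

/-- The code of the cell of the point in the slot given by register `16`, in the grid whose side
is in register `11`, shifted according to the binary digits of register `9`. -/
def netCellTerm (d : ℕ) : Term :=
  cellTerm d 16 fun c => .div (digitTerm (.var 9) (.const 2) c) (.const 2)

/-- The cell of `x` in the grid of side `η` shifted according to the binary digits of `b`. -/
def netCell (η : ℝ) (b : ℕ) (x : EuclideanSpace ℝ (Fin d)) : Fin d → ℤ :=
  cell η (fun c : Fin d => ((b / 2 ^ (c : ℕ) % 2 : ℕ) : ℝ) / 2) x

lemma eval_netCellTerm {σ : Store} {x : EuclideanSpace ℝ (Fin d)} {j b : ℕ} (h16 : σ.reg 16 = j)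
    (h9 : σ.reg 9 = b) (hx : ∀ c : Fin d, σ.arr c ⌊σ.arr (d + 1) j⌋ = x c) :
    (netCellTerm d).eval σ = vecCode d (netCell (σ.reg 11) b x) := by
  refine eval_codeTerm σ d fun c => ?_
  simp only [Term.eval, slotCoord, h16, Int.floor_natCast, hx c, netCell, cell,
    eval_digitTerm (t := .var 9) (b := .const 2) (b' := 2) h9 (by simp [Term.eval])]
  norm_num

/-- Merge the points in the same cells. -/
def net (d : ℕ) : Cmd :=
  .seq (forUp 16 4 (.write (d + 3) (netCellTerm d) (.const 0)))
  (.seq (.set 20 (.const 0)) (.seq (forUp 16 4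
    (.ite (.lt (.read (d + 3) (netCellTerm d)) (.const 1))
      (.seq (.write (d + 3) (netCellTerm d) (.add (.var 20) (.const 1)))
        (.seq (.write (d + 1) (.var 20) (.read (d + 1) (.var 16)))
          (.seq (.write (d + 2) (.var 20) (.read (d + 2) (.var 16)))
            (.set 20 (.add (.var 20) (.const 1))))))
      (.write (d + 2) (.sub (.read (d + 3) (netCellTerm d)) (.const 1))
        (.add (.read (d + 2) (.sub (.read (d + 3) (netCellTerm d)) (.const 1)))
          (.read (d + 2) (.var 16))))))
    (.set 4 (.var 20))))

lemma net_clear_run {s b : ℕ} {X : ℕ → EuclideanSpace ℝ (Fin d)} {w : ℕ → ℝ} {σ : Store}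
    (h : Holds s X w σ) (h9 : σ.reg 9 = b) :
    Run (forUp 16 4 (.write (d + 3) (netCellTerm d) (.const 0))) σ (s * (1 + 3) + 3) fun τ =>
      ∀ j < s, τ.arr (d + 3) (vecCode d (netCell (σ.reg 11) b (X j))) = 0 := by
  refine Run.forUp s _ (fun j' τ => ∀ j < j',
      τ.arr (d + 3) (vecCode d (netCell (σ.reg 11) b (X j))) = 0) h.size
      (by simp [Cmd.regs]) (by simp [Cmd.regs]) (by simp) ?_ (fun _ _ _ hI => hI)
  intro j hj τ hf hx hI
  have hτ := h.of_frame hf (by simp [forUp, Cmd.regs]) (by simp [forUp, Cmd.arrs]; omega)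
  have r9 := hf.reg 9 (by simp [forUp, Cmd.regs])
  have r11 := hf.reg 11 (by simp [forUp, Cmd.regs])
  refine .write ?_
  rw [eval_netCellTerm hx (r9.trans h9) (hτ.coord j hj), r11, Int.floor_intCast]
  intro j' hj'
  simp only [Store.setReg_arr, Store.setCell_arr, Term.eval, Int.cast_zero, true_and]
  split_ifs with hc
  · rfl
  · rcases Nat.lt_succ_iff_lt_or_eq.1 hj' with hlt | rfl
    · exact hI j' hlt
    · exact absurd rfl hc

/-- After `j'` points have been merged, `g` gives the new slots of these points, and `r` the old
slots of the representatives. -/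
structure Merged (s : ℕ) (w : ℕ → ℝ) (v : ℕ → Fin d → ℤ) (idx : ℤ → ℝ) (j' s' : ℕ)
    (g r : ℕ → ℕ) (τ : Store) : Prop where
  le : s' ≤ j'
  count : τ.reg 20 = s'
  lt : ∀ j < j', g j < s'
  repr : ∀ a < s', r a < j' ∧ g (r a) = a
  cell_eq : ∀ j < j', ∀ i < j', g j = g i → v j = v i
  table : ∀ j < j', τ.arr (d + 3) (vecCode d (v j)) = g j + 1
  table_zero : ∀ j < s, (∀ i < j', v i ≠ v j) → τ.arr (d + 3) (vecCode d (v j)) = 0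
  index : ∀ a < s', τ.arr (d + 1) a = idx (r a)
  weight : ∀ a < s', τ.arr (d + 2) a = ∑ j ∈ range j', if g j = a then w j else 0
  rest : ∀ j < s, j' ≤ j → τ.arr (d + 1) j = idx j ∧ τ.arr (d + 2) j = w j

/-- Point `j` is the first in its cell and becomes its representative in slot `s'`. The table stores
the slot plus 1, since 0 marks an empty cell; slot `s' ≤ j` has already been read. -/
lemma Merged.new {s : ℕ} {w : ℕ → ℝ} {v : ℕ → Fin d → ℤ} {idx : ℤ → ℝ} {j s' : ℕ}
    {g r : ℕ → ℕ} {τ : Store} (h : Merged s w v idx j s' g r τ) (hv : ∀ i < j, v i ≠ v j) :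
    Merged s w v idx (j + 1) (s' + 1) (fun x => if x = j then s' else g x)
      (fun x => if x = s' then j else r x)
      ((((τ.setCell (d + 3) (vecCode d (v j)) (s' + 1)).setCell (d + 1) s' (idx j)).setCell (d + 2)
        s' (w j)).setReg 20 (s' + 1)) := by
  have hle := h.le
  refine ⟨by omega, by simp, ?_, ?_, ?_, ?_, ?_, ?_, ?_, ?_⟩
  · intro i hi
    split_ifs with h1
    · omega
    · have := h.lt i (by omega); omega
  · intro a ha
    rcases eq_or_ne a s' with rfl | hne
    · simp
    · have := h.repr a (by omega)
      rw [if_neg hne, if_neg (by omega)]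
      exact ⟨by omega, this.2⟩
  · intro i hi i' hi'
    have h1 := h.lt i
    have h2 := h.lt i'
    split_ifs with e1 e2 e2
    · simp [e1, e2]
    · intro; have := h2 (by omega); omega
    · intro; have := h1 (by omega); omega
    · exact h.cell_eq i (by omega) i' (by omega)
  · intro i hi
    rcases eq_or_ne i j with rfl | hne
    · simp
    · have h1 := hv i (by omega)
      simpa [hne, (vecCode_injective d).eq_iff, h1] using h.table i (by omega)
  · intro i hi hne
    have h1 : v i ≠ v j := (hne j (by omega)).symm
    simpa [(vecCode_injective d).eq_iff, h1] using h.table_zero i hi fun i' hi' => hne i' (by omega)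
  · intro a ha
    rcases eq_or_ne a s' with rfl | hne
    · simp
    · simpa [hne] using h.index a (by omega)
  · intro a ha
    rw [sum_range_succ]
    have hs : ∑ x ∈ range j, (if (if x = j then s' else g x) = a then w x else 0) =
        ∑ x ∈ range j, if g x = a then w x else 0 := by
      refine sum_congr rfl fun x hx => ?_
      rw [if_neg (mem_range.1 hx).ne]
    rw [hs, if_pos rfl]
    rcases eq_or_ne a s' with rfl | hne
    · rw [sum_eq_zero]
      · simp
      · intro x hx
        rw [if_neg (h.lt x (mem_range.1 hx)).ne]
    · rw [← h.weight a (by omega), if_neg hne.symm]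
      simp [hne]
  · intro i hi hle'
    have hne : i ≠ s' := by omega
    simpa [hne] using h.rest i hi (by omega)

/-- The cell of `j` already has a representative, whose weight absorbs that of `j`. -/
lemma Merged.old {s : ℕ} {w : ℕ → ℝ} {v : ℕ → Fin d → ℤ} {idx : ℤ → ℝ} {j s' i : ℕ}
    {g r : ℕ → ℕ} {τ : Store} (h : Merged s w v idx j s' g r τ) (hi : i < j) (hv : v i = v j) :
    Merged s w v idx (j + 1) s' (fun x => if x = j then g i else g x) r
      (τ.setCell (d + 2) (g i) (τ.arr (d + 2) (g i) + w j)) := by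
  have hle := h.le
  have hgi := h.lt i hi
  refine ⟨by omega, by simpa using h.count, ?_, ?_, ?_, ?_, ?_, ?_, ?_, ?_⟩
  · intro i' hi'
    split_ifs with h1
    · omega
    · exact h.lt i' (by omega)
  · intro a ha
    have := h.repr a (by omega)
    rw [if_neg (by omega)]
    exact ⟨by omega, this.2⟩
  · intro x hx y hy
    split_ifs with e1 e2 e2
    · simp [e1, e2]
    · intro hg
      rw [e1, ← hv]
      exact h.cell_eq i hi y (by omega) hg
    · intro hg
      rw [e2, ← hv]
      exact h.cell_eq x (by omega) i hi hg
    · exact h.cell_eq x (by omega) y (by omega)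
  · intro x hx
    rcases eq_or_ne x j with rfl | hne
    · simpa [hv] using h.table i hi
    · simpa [hne] using h.table x (by omega)
  · intro x hx hne
    simpa using h.table_zero x hx fun i' hi' => hne i' (by omega)
  · intro a ha
    simpa using h.index a (by omega)
  · intro a ha
    rw [sum_range_succ]
    have hs : ∑ x ∈ range j, (if (if x = j then g i else g x) = a then w x else 0) =
        ∑ x ∈ range j, if g x = a then w x else 0 := by
      refine sum_congr rfl fun x hx => ?_
      rw [if_neg (mem_range.1 hx).ne]
    rw [hs, if_pos rfl, ← h.weight a ha]
    rcases eq_or_ne a (g i) with rfl | hne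
    · simp
    · simp [hne, hne.symm]
  · intro x hx hle'
    have hne : x ≠ g i := by omega
    simpa [hne] using h.rest x hx (by omega)

/-- Here `g` sends old slots to new ones and `r` picks a representative of each new slot, so the
fibres of `g` are exactly the occupied cells. Merged points sit at input points; no coordinates are
ever written. -/
theorem net_run {s b : ℕ} {X : ℕ → EuclideanSpace ℝ (Fin d)} {w : ℕ → ℝ} {σ : Store} {η : ℝ}
    (h : Holds s X w σ) (h9 : σ.reg 9 = b) (h11 : σ.reg 11 = η) :
    Run (net d) σ (30 * (s + 1)) fun τ => ∃ (s' : ℕ) (g r : ℕ → ℕ),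
      Holds s' (fun a => X (r a)) (fun a => ∑ j ∈ range s, if g j = a then w j else 0) τ ∧
      (∀ j < s, g j < s') ∧ (∀ a < s', r a < s ∧ g (r a) = a) ∧
      ∀ j < s, ∀ i < s, (g j = g i ↔ netCell η b (X j) = netCell η b (X i)) := by
  subst h11
  refine Run.conseq (T := (s * (1 + 3) + 3) + (1 + ((s * (9 + 3) + 3) + 1 + 1) + 1) + 1)
    (Q := fun τ => ∃ (s' : ℕ) (g r : ℕ → ℕ),
      Holds s' (fun a => X (r a)) (fun a => ∑ j ∈ range s, if g j = a then w j else 0) τ ∧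
      (∀ j < s, g j < s') ∧ (∀ a < s', r a < s ∧ g (r a) = a) ∧
      ∀ j < s, ∀ i < s, (g j = g i ↔ netCell (σ.reg 11) b (X j) = netCell (σ.reg 11) b (X i)))
    (Run.seq (T' := 1 + ((s * (9 + 3) + 3) + 1 + 1) + 1) (net_clear_run h h9) ?_)
    (by omega) (fun _ _ => id)
  rintro τ hf hZ
  have hτ := h.of_frame hf (by simp [forUp, Cmd.regs]) (by simp [forUp, Cmd.arrs]; omega)
  have r9 := (hf.reg 9 (by simp [forUp, Cmd.regs])).trans h9
  have r11 := hf.reg 11 (by simp [forUp, Cmd.regs])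
  generalize σ.reg 11 = η at hZ r11 ⊢
  clear hf h9 h σ
  refine Run.seq (T' := (s * (9 + 3) + 3) + 1 + 1)
      (R := fun ρ => ρ = τ.setReg 20 0) (.set (by simp [Term.eval])) ?_
  rintro _ - rfl
  refine Run.seq (T' := 1) (R := fun ρ => (∀ c : Fin d, ρ.arr c = τ.arr c) ∧ ∃ (s' : ℕ)
    (g r : ℕ → ℕ), Merged s w (fun j => netCell η b (X j)) (τ.arr (d + 1)) s s' g r ρ) ?_ ?_
  · refine Run.forUp s _ (fun j' ρ => ∃ (s' : ℕ)
      (g r : ℕ → ℕ), Merged s w (fun j => netCell η b (X j)) (τ.arr (d + 1)) j' s' g r ρ)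
        (by simpa using hτ.size) (by simp [Cmd.regs]) (by simp [Cmd.regs]) ?_ ?_ ?_
    · refine ⟨0, id, id, le_rfl, by simp, by simp, by simp, by simp, by simp,
        fun j hj _ => by simpa using hZ j hj, by simp, by simp,
        fun j hj _ => by simpa using hτ.weight j hj⟩
    · rintro j hj ρ hf hx ⟨s', g, r, hM⟩
      have q9 := hf.reg 9 (by simp [forUp, Cmd.regs])
      have q11 := hf.reg 11 (by simp [forUp, Cmd.regs])
      rw [Store.setReg_reg, if_neg (by norm_num), r9] at q9
      rw [Store.setReg_reg, if_neg (by norm_num), r11] at q11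
      obtain ⟨hT1, hT2⟩ := hM.rest j hj le_rfl
      have e : (netCellTerm d).eval ρ = vecCode d (netCell η b (X j)) := by
        rw [eval_netCellTerm hx q9 (x := X j), q11]
        intro c
        rw [hf.arr c (by simp [forUp, Cmd.arrs]; omega), hT1]
        exact hτ.coord j hj c
      refine Run.ite (T := 8) (fun hb => ?_) (fun hb => ?_)
      · have hv : ∀ i < j, netCell η b (X i) ≠ netCell η b (X j) := by
          intro i hi hv
          have := hM.table i hi
          simp only [Test.holds, Term.eval, e, Int.floor_intCast, ← hv, this, Int.cast_one] at hb
          have : (0 : ℝ) ≤ g i := by positivity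
          linarith
        refine Run.conseq (Run.straight (P := _) (by simp [Cmd.Straight])
          (Q := fun π => π = (((ρ.setCell (d + 3) (vecCode d (netCell η b (X j))) (s' + 1)).setCell
            (d + 1) s' (τ.arr (d + 1) j)).setCell (d + 2) s' (w j)).setReg 20 (s' + 1)) ?_)
            (by simp [Cmd.size]) ?_
        · simp [Cmd.exec, Term.eval, e, hM.count, hx, hT1, hT2]
        · rintro _ - rfl
          have := hM.new hv
          refine ⟨s' + 1, _, _, this.le, by simp, this.lt, this.repr, this.cell_eq, this.table,
            this.table_zero, this.index, this.weight, this.rest⟩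
      · have hv : ∃ i < j, netCell η b (X i) = netCell η b (X j) := by
          by_contra! hv
          simp only [Test.holds, Term.eval, e, Int.floor_intCast, hM.table_zero j hj hv,
            Int.cast_one] at hb
          norm_num at hb
        obtain ⟨i, hi, hv⟩ := hv
        have htab := hM.table i hi
        simp only [hv] at htab
        refine Run.conseq (Run.write (Q := fun π => π = ρ.setCell (d + 2) (g i)
          (ρ.arr (d + 2) (g i) + w j)) ?_) (by norm_num) ?_
        · simp [Term.eval, e, htab, hx, hT2]
        · rintro _ - rfl
          have := hM.old hi hv
          refine ⟨s', _, _, this.le, by simpa using this.count, this.lt, this.repr, this.cell_eq,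
            this.table, this.table_zero, this.index, this.weight, this.rest⟩
    · rintro ρ hf - hM
      exact ⟨fun c => hf.arr c (by simp [forUp, Cmd.arrs]; omega), hM⟩
  · rintro ρ hf ⟨hc, s', g, r, hM⟩
    refine .set ⟨s', g, r, ⟨by simpa [Term.eval] using hM.count, fun a ha c => ?_, hM.weight⟩, hM.lt,
      hM.repr, fun j hj i hi => ⟨hM.cell_eq j hj i hi, fun hv => ?_⟩⟩
    · rw [Store.setReg_arr, hM.index a ha, hc c]
      exact hτ.coord _ (hM.repr a ha).1 c
    · have h1 := hM.table j hj
      have h2 := hM.table i hi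
      simp only [hv, h2] at h1
      exact_mod_cast (add_right_cancel h1).symm

/-! ### The invariant of the rounds -/

/-- The working set approximates the predicate `G` of the input with additive error
`16 (d + 1) Λ`, while `G` fails at `32 (d + 1) Λ`. -/
structure WorkInv (G : ℝ → Prop) (s : ℕ) (X : ℕ → EuclideanSpace ℝ (Fin d)) (w : ℕ → ℝ)
    (m kk Λ : ℝ) : Prop where
  Λ_nonneg : 0 ≤ Λ
  weight_pos : ∀ j < s, 0 < w j
  inj : ∀ j < s, ∀ i < s, X j = X i → j = i
  fwd : ∀ r, 0 ≤ r → G r → Reach s X w m kk (r + 16 * (d + 1) * Λ)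
  bwd : ∀ r, 0 ≤ r → Reach s X w m kk r → G (r + 16 * (d + 1) * Λ)
  not : ¬ G (32 * (d + 1) * Λ)

variable {G : ℝ → Prop} {s : ℕ} {X : ℕ → EuclideanSpace ℝ (Fin d)} {w : ℕ → ℝ} {m kk Λ : ℝ}

lemma WorkInv.weight_nonneg (h : WorkInv G s X w m kk Λ) : ∀ j < s, 0 ≤ w j :=
  fun j hj => (h.weight_pos j hj).le

/-- With at most one point left, distances play no role, so `Reach` would already hold at 0 and `G`
at 16 (d + 1) Λ, contrary to the invariant. -/
lemma WorkInv.two_le (h : WorkInv G s X w m kk Λ) (hG : ∀ r r', r ≤ r' → G r → G r') {r : ℝ}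
    (hr : 0 ≤ r) (hGr : G r) : 2 ≤ s := by
  by_contra! hs
  have h1 := h.fwd r hr hGr
  have h2 : Reach s X w m kk 0 := by
    refine le_trans h1 (deepWeight_mono h.weight_nonneg fun j hj i hi _ => ?_)
    rw [show j = i by omega, dist_self]
  refine h.not (hG _ _ ?_ (h.bwd 0 le_rfl h2))
  have := mul_nonneg (by positivity : (0 : ℝ) ≤ d + 1) h.Λ_nonneg
  linarith

/-- Together with `near_of_reach`, this brackets the outcome of a scan between two radii that differ
by η times a constant. -/
lemma reach_of_near {η r : ℝ} {i : ℕ} (hw : ∀ j < s, 0 ≤ w j) (hη : 0 < η)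
    (h : kk ≤ deepWeight s (fun j i' => Near η i (X j) (X i')) w m)
    (hr : η * (i + 1 + (d + 1)) ≤ r) : Reach s X w m kk r :=
  h.trans (deepWeight_mono hw fun _ _ _ _ hn => (hn.dist_lt hη).le.trans hr)

lemma near_of_reach {η r : ℝ} {i : ℕ} (hw : ∀ j < s, 0 ≤ w j) (hη : 0 < η)
    (h : Reach s X w m kk r) (hr : r < η * (i + 1 - (d + 1))) :
    kk ≤ deepWeight s (fun j i' => Near η i (X j) (X i')) w m :=
  h.trans (deepWeight_mono hw fun _ _ _ _ hn => near_of_dist_le hη hn hr)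

/-- Since weights are positive, a near point other than `j` would make the near weight strictly
larger than `w j`; comparing two numbers thus detects isolation. -/
lemma eq_of_near {η : ℝ} {I j i : ℕ} (hw : ∀ j < s, 0 < w j) (hj : j < s) (hi : i < s)
    (h : ¬ w j < nearWeight s X w η I j) (hn : Near η I (X j) (X i)) : i = j := by
  classical
  by_contra hne
  apply h
  rw [nearWeight]
  have hsub : ({j, i} : Finset ℕ) ⊆ range s := by
    intro x hx
    simp only [mem_insert, mem_singleton] at hx
    rcases hx with rfl | rfl <;> simpa
  refine lt_of_lt_of_le ?_ (sum_le_sum_of_subset_of_nonneg hsub fun x hx _ => ?_)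
  · rw [sum_pair (Ne.symm hne), if_pos (near_self _ _ _), if_pos hn]
    linarith [hw i hi]
  · have := (hw x (mem_range.1 hx)).le
    split_ifs
    · exact this
    · exact le_rfl

lemma exists_near {η : ℝ} {I j : ℕ} (hj : j < s)
    (h : w j < nearWeight s X w η I j) : ∃ i < s, i ≠ j ∧ Near η I (X j) (X i) := by
  classical
  by_contra! hn
  refine absurd h (not_lt.2 (le_of_eq ?_))
  rw [nearWeight, sum_eq_single_of_mem j (mem_range.2 hj), if_pos (near_self _ _ _)]
  intro i hi hne
  rw [if_neg (hn i (mem_range.1 hi) hne)]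

/-! ### How pruning, netting and stopping act on the invariant, and how many points they remove. -/

open Classical in
-- The successful test gives `Reach` at η (2 (d + 1) + 1). Up to this radius the deleted points are
-- isolated, because they have no other point within a smaller distance than η (3 (d + 1) + 1), and
-- `deepWeight_prune` applies. Beyond it both predicates hold by monotonicity. So `Reach` does not
-- change at all and Λ stays the same.
lemma WorkInv.prune (h : WorkInv G s X w m kk Λ) {η : ℝ} (hη : 0 < η)
    (hnear : kk ≤ deepWeight s (fun j i' => Near η (d + 1) (X j) (X i')) w m) {s' : ℕ} {e : ℕ → ℕ}
    (hF : ∀ F : ℕ → ℝ, ∑ a ∈ range s', F (e a) =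
      ∑ j ∈ range s, if w j < nearWeight s X w η (4 * (d + 1)) j then F j else 0)
    (he : ∀ a < s', e a < s ∧ w (e a) < nearWeight s X w η (4 * (d + 1)) (e a))
    (hinj : ∀ a < s', ∀ b < s', e a = e b → a = b) :
    WorkInv G s' (fun a => X (e a)) (fun a => w (e a)) m
      (kk - ∑ j ∈ range s, if ¬ w j < nearWeight s X w η (4 * (d + 1)) j ∧ m + 1 ≤ w j
        then w j else 0) Λ := by
  have hw' : ∀ a < s', 0 ≤ w (e a) := fun a ha => h.weight_nonneg _ (he a ha).1
  have key : ∀ r, 0 ≤ r → (Reach s' (fun a => X (e a)) (fun a => w (e a)) m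
      (kk - ∑ j ∈ range s, if ¬ w j < nearWeight s X w η (4 * (d + 1)) j ∧ m + 1 ≤ w j
        then w j else 0) r ↔ Reach s X w m kk r) := by
    have small : ∀ r, 0 ≤ r → r ≤ η * (2 * (d + 1) + 1) →
      (Reach s' (fun a => X (e a)) (fun a => w (e a)) m
      (kk - ∑ j ∈ range s, if ¬ w j < nearWeight s X w η (4 * (d + 1)) j ∧ m + 1 ≤ w j
        then w j else 0) r ↔ Reach s X w m kk r) := by
      intro r hr hr'
      rw [Reach, Reach, deepWeight_prune (R := fun j i => dist (X j) (X i) ≤ r)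
        (K := fun j => w j < nearWeight s X w η (4 * (d + 1)) j) (e := e) ?_ ?_ ?_ hF he,
        sub_le_iff_le_add']
      · intro j _
        simpa using hr
      · intro j _ i _ hji
        rwa [dist_comm]
      · intro j hj hK i hi hji
        refine eq_of_near h.weight_pos hj hi hK (near_of_dist_le hη hji (hr'.trans_lt ?_))
        have : (0 : ℝ) ≤ d := by positivity
        push_cast
        nlinarith
    have hg : Reach s X w m kk (η * (2 * (d + 1) + 1)) :=
      reach_of_near h.weight_nonneg hη hnear (le_of_eq (by push_cast; ring))
    intro r hr
    rcases le_total r (η * (2 * (d + 1) + 1)) with hle | hle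
    · exact small r hr hle
    · exact iff_of_true (((small _ (by positivity) le_rfl).2 hg).mono hw' hle)
        (hg.mono h.weight_nonneg hle)
  have hΛ := mul_nonneg (by positivity : (0 : ℝ) ≤ 16 * (d + 1)) h.Λ_nonneg
  exact ⟨h.Λ_nonneg, fun a ha => h.weight_pos _ (he a ha).1,
    fun a ha b hb hX => hinj a ha b hb (h.inj _ (he a ha).1 _ (he b hb).1 hX),
    fun r hr hGr => (key _ (by linarith)).2 (h.fwd r hr hGr),
    fun r hr hR => h.bwd r hr ((key _ hr).1 hR), h.not⟩

open Classical in
-- A kept point has another one closer than η (5 (d + 1) + 1) ≤ η (6 (d + 1)) ≤ l, so points with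
-- nearest-neighbour distance at least l are gone.
lemma card_prune_le {η l : ℝ} {nn : ℕ → ℝ} (hη : 0 < η) (hl : η * (6 * (d + 1)) ≤ l)
    (hnn : ∀ j < s, ∀ i < s, i ≠ j → nn j ≤ dist (X j) (X i)) {s' : ℕ} {e : ℕ → ℕ}
    (hF : ∀ F : ℕ → ℝ, ∑ a ∈ range s', F (e a) =
      ∑ j ∈ range s, if w j < nearWeight s X w η (4 * (d + 1)) j then F j else 0) :
    s' + #{j ∈ range s | l ≤ nn j} ≤ s := by
  have h1 : s' = #{j ∈ range s | w j < nearWeight s X w η (4 * (d + 1)) j} := by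
    have := hF fun _ => 1
    rw [← sum_filter] at this
    simp only [sum_const, card_range, nsmul_eq_mul, mul_one] at this
    exact_mod_cast this
  have h2 := card_filter_add_card_filter_not (s := range s)
    (fun j => w j < nearWeight s X w η (4 * (d + 1)) j)
  rw [card_range] at h2
  have h3 : {j ∈ range s | l ≤ nn j} ⊆
      {j ∈ range s | ¬ w j < nearWeight s X w η (4 * (d + 1)) j} := by
    intro j hj
    obtain ⟨hj, hlj⟩ := mem_filter.1 hj
    refine mem_filter.2 ⟨hj, fun hK => ?_⟩
    obtain ⟨i, hi, hne, hn⟩ := exists_near (mem_range.1 hj) hK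
    have h4 := hn.dist_lt hη
    have h5 := hnn j (mem_range.1 hj) i hi hne
    have : (0 : ℝ) ≤ d := by positivity
    push_cast at h4
    nlinarith
  have := card_le_card h3
  omega

/-- If L ≤ 2 Λ, the successful test would give `Reach` at (2 d + 3) L / (6 (d + 1)) ≤ L/2 ≤ Λ, hence
`G` at a radius below 32 (d + 1) Λ. -/
lemma WorkInv.lt_of_prune (h : WorkInv G s X w m kk Λ) (hG : ∀ r r', r ≤ r' → G r → G r')
    {L : ℝ} (hL : 0 < L)
    (hnear : kk ≤ deepWeight s (fun j i' => Near (L / (6 * (d + 1))) (d + 1) (X j) (X i')) w m) :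
    2 * Λ < L := by
  by_contra! hle
  have hd : (0 : ℝ) ≤ d := by positivity
  have h1 : Reach s X w m kk Λ := by
    refine reach_of_near h.weight_nonneg (by positivity) hnear ?_
    rw [div_mul_eq_mul_div, div_le_iff₀ (by positivity)]
    push_cast
    nlinarith [h.Λ_nonneg, mul_nonneg hd h.Λ_nonneg]
  refine h.not (hG _ _ ?_ (h.bwd _ h.Λ_nonneg h1))
  nlinarith [h.Λ_nonneg, mul_nonneg hd h.Λ_nonneg]

/-- Merging moves points by at most 4 (d + 1) L and changes distances by at most 8 (d + 1) L. The
old error 16 (d + 1) Λ is at most 8 (d + 1) L as well, so the new total is 16 (d + 1) L: this is the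
geometric series. -/
lemma WorkInv.net (h : WorkInv G s X w m kk Λ) {L : ℝ} (hL : 0 < L) (hΛ : 2 * Λ ≤ L)
    (hnear : ¬ kk ≤ deepWeight s (fun j i' => Near (64 * (d + 1) * L) (d + 1) (X j) (X i')) w m)
    {b s' : ℕ} {g r : ℕ → ℕ} (hg : ∀ j < s, g j < s') (hr : ∀ a < s', r a < s ∧ g (r a) = a)
    (hcell : ∀ j < s, ∀ i < s,
      (g j = g i ↔ netCell (4 * L) b (X j) = netCell (4 * L) b (X i))) :
    WorkInv G s' (fun a => X (r a)) (fun a => ∑ j ∈ range s, if g j = a then w j else 0)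
      m kk L := by
  have hd : (0 : ℝ) ≤ d := by positivity
  have hdΛ := mul_nonneg hd h.Λ_nonneg
  have hdL := mul_nonneg hd (sub_nonneg.2 hΛ)
  have hpos : ∀ a < s', 0 < ∑ j ∈ range s, if g j = a then w j else 0 := by
    intro a ha
    obtain ⟨h1, h2⟩ := hr a ha
    refine sum_pos' (fun j hj => ?_) ⟨r a, mem_range.2 h1, ?_⟩
    · have := h.weight_nonneg j (mem_range.1 hj)
      split_ifs
      · exact this
      · exact le_rfl
    · rw [if_pos h2]
      exact h.weight_pos _ h1
  have hmove : ∀ j < s, dist (X j) (X (r (g j))) ≤ 4 * L * (d + 1) := by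
    intro j hj
    obtain ⟨h1, h2⟩ := hr _ (hg j hj)
    exact dist_le_of_cell_eq (by positivity) ((hcell j hj _ h1).1 h2.symm)
  have hiff : ∀ t, Reach s' (fun a => X (r a)) (fun a => ∑ j ∈ range s, if g j = a then w j else 0)
      m kk t ↔ Reach s (fun j => X (r (g j))) w m kk t := by
    intro t
    rw [Reach, deepWeight_merge hg (fun a _ => rfl), Reach]
  have hto : ∀ t, Reach s X w m kk t →
      Reach s (fun j => X (r (g j))) w m kk (t + 8 * (d + 1) * L) := by
    intro t ht
    refine le_trans ht (deepWeight_mono h.weight_nonneg fun j hj i hi hd => ?_)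
    have h1 := hmove j hj
    have h2 := hmove i hi
    have h3 := dist_triangle4 (X (r (g j))) (X j) (X i) (X (r (g i)))
    rw [dist_comm] at h1
    linarith
  have hfrom : ∀ t, Reach s (fun j => X (r (g j))) w m kk t →
      Reach s X w m kk (t + 8 * (d + 1) * L) := by
    intro t ht
    refine le_trans ht (deepWeight_mono h.weight_nonneg fun j hj i hi hd => ?_)
    have h1 := hmove j hj
    have h2 := hmove i hi
    have h3 := dist_triangle4 (X j) (X (r (g j))) (X (r (g i))) (X i)
    rw [dist_comm] at h2
    linarith
  -- Otherwise `Reach` would hold at 32 (d + 1) L + 16 (d + 1) Λ ≤ 40 (d + 1) L, less than one side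
  -- 64 (d + 1) L of the grid, and the test would have succeeded.
  have hnot : ¬ G (32 * (d + 1) * L) := by
    intro hGr
    apply hnear
    refine near_of_reach h.weight_nonneg (by positivity) (h.fwd _ (by positivity) hGr) ?_
    push_cast
    nlinarith [mul_nonneg hd hL.le]
  refine ⟨hL.le, hpos, fun a ha b hb hX => ?_, fun t ht hGt => ?_, fun t ht hR => ?_, hnot⟩
  · rw [← (hr a ha).2, ← (hr b hb).2, h.inj _ (hr a ha).1 _ (hr b hb).1 hX]
  · rw [hiff]
    exact (hto _ (h.fwd t ht hGt)).mono h.weight_nonneg (by nlinarith)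
  · rw [hiff] at hR
    -- The nonnegative slack in the radius is chosen so that adding the old error gives exactly t +
    -- 16 (d + 1) L.
    have h3 := h.bwd (t + 8 * (d + 1) * L + (16 * (d + 1) * L - 8 * (d + 1) * L - 16 * (d + 1) * Λ))
      (by nlinarith) ((hfrom t hR).mono h.weight_nonneg (by nlinarith))
    convert h3 using 1
    ring

lemma card_net_le {L : ℝ} {b s' : ℕ} {g r : ℕ → ℕ} (hr : ∀ a < s', r a < s ∧ g (r a) = a)
    (hcell : ∀ j < s, ∀ i < s,
      (g j = g i ↔ netCell (4 * L) b (X j) = netCell (4 * L) b (X i))) :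
    2 * s' + mergedCount s (fun j => netCell (4 * L) b (X j)) ≤ 2 * s := by
  have h1 := two_mul_card_image_add_mergedCount_le s (fun j => netCell (4 * L) b (X j))
  have h2 : s' ≤ #((range s).image fun j => netCell (4 * L) b (X j)) := by
    rw [← card_range s']
    refine card_le_card_of_injOn (fun a => netCell (4 * L) b (X (r a))) (fun a ha => ?_)
      (fun a ha a' ha' hE => ?_)
    · exact mem_coe.2 (mem_image_of_mem (fun j => netCell (4 * L) b (X j))
        (mem_range.2 (hr a (by simpa using ha)).1))
    · obtain ⟨x1, x2⟩ := hr a (by simpa using ha)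
      obtain ⟨y1, y2⟩ := hr a' (by simpa using ha')
      rw [← x2, ← y2]
      exact (hcell _ x1 _ y1).2 hE
  omega

/-- The test gives `Reach` at 64 (d + 1) L (2 (d + 1) + 1), and the error adds at most 8 (d + 1) L.
-/
lemma WorkInv.upper (h : WorkInv G s X w m kk Λ) (hG : ∀ r r', r ≤ r' → G r → G r')
    {L : ℝ} (hL : 0 < L) (hΛ : 2 * Λ ≤ L)
    (hnear : kk ≤ deepWeight s (fun j i' => Near (64 * (d + 1) * L) (d + 1) (X j) (X i')) w m) :
    G (256 * (d + 1) ^ 2 * L) := by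
  have hd : (0 : ℝ) ≤ d := by positivity
  have h1 := reach_of_near h.weight_nonneg (by positivity) hnear le_rfl
  refine hG _ _ ?_ (h.bwd _ (by positivity) h1)
  have hdL := mul_nonneg hd (sub_nonneg.2 hΛ)
  have hdL' := mul_nonneg hd hL.le
  have hddL := mul_nonneg hd hdL'
  push_cast
  nlinarith

/-- Since `G` fails at 32 (d + 1) Λ, the additive error is less than r/2. So r < L / (9 (d + 1))
would give `Reach` at 3r/2, below one side L / (6 (d + 1)) of the grid, and the test would have
succeeded. -/
lemma WorkInv.lower (h : WorkInv G s X w m kk Λ) (hG : ∀ r r', r ≤ r' → G r → G r')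
    {L : ℝ} (hL : 0 < L)
    (hnear : ¬ kk ≤ deepWeight s (fun j i' => Near (L / (6 * (d + 1))) (d + 1) (X j) (X i')) w m)
    {r : ℝ} (hr : 0 ≤ r) (hGr : G r) : L / (9 * (d + 1)) ≤ r := by
  by_contra! hlt
  apply hnear
  have h1 : 32 * (d + 1) * Λ < r := by
    by_contra! hle
    exact h.not (hG _ _ hle hGr)
  refine near_of_reach h.weight_nonneg (by positivity) (h.fwd r hr hGr) ?_
  have h2 : L / (6 * (d + 1)) = L / (9 * (d + 1)) * (3 / 2) := by field_simp; norm_num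
  push_cast
  rw [h2]
  ring_nf at h1 hlt ⊢
  linarith

/-- For at least one shift, such a point shares its cell with its nearest neighbour. -/
lemma card_le_sum_mergedCount {L : ℝ} (hL : 0 < L) {nn : ℕ → ℝ}
    (hnn : ∀ j < s, ∃ i < s, i ≠ j ∧ nn j = dist (X j) (X i)) {l : ℝ} (hl : l ≤ L) :
    #{j ∈ range s | nn j ≤ l} ≤
      ∑ b ∈ range (2 ^ d), mergedCount s (fun j => netCell (4 * L) b (X j)) := by
  have h1 : {j ∈ range s | nn j ≤ l} ⊆ (range (2 ^ d)).biUnion fun b =>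
      {j ∈ range s | ∃ i ∈ range s, i ≠ j ∧
        netCell (4 * L) b (X i) = netCell (4 * L) b (X j)} := by
    intro j hj
    obtain ⟨hj, hlj⟩ := mem_filter.1 hj
    obtain ⟨i, hi, hne, hd⟩ := hnn j (mem_range.1 hj)
    obtain ⟨b, hb, hc⟩ := exists_shift hL (x := X i) (y := X j) (by
      rw [dist_comm, ← hd]; exact hlj.trans hl)
    exact mem_biUnion.2 ⟨b, mem_range.2 hb, mem_filter.2 ⟨hj, i, mem_range.2 hi, hne, hc⟩⟩
  exact (card_le_card h1).trans card_biUnion_le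

/-! ### What the subprograms leave untouched. -/

lemma Input.of_subset {n : ℕ} {X : ℕ → EuclideanSpace ℝ (Fin d)} {w : ℕ → ℝ} {m k ε : ℝ}
    {σ τ : Store} {P : Cmd} (h : Input n X w m k ε σ) (hf : Frame P σ τ) {R A : List ℕ}
    (hR : P.regs ⊆ R) (hA : P.arrs ⊆ A) (hr : ∀ x ∈ R, 4 ≤ x) (ha : ∀ a ∈ A, d < a) :
    Input n X w m k ε τ :=
  h.of_frame hf (fun x hx h' => absurd (hr x (hR h')) (by omega))
    fun a h1 h2 => absurd (ha a (hA h2)) (by omega)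

lemma Holds.of_subset {s : ℕ} {X : ℕ → EuclideanSpace ℝ (Fin d)} {w : ℕ → ℝ} {σ τ : Store}
    {P : Cmd} (h : Holds s X w σ) (hf : Frame P σ τ) {R A : List ℕ}
    (hR : P.regs ⊆ R) (hA : P.arrs ⊆ A) (hr : 4 ∉ R) (ha : ∀ a ∈ A, d + 2 < a) :
    Holds s X w τ :=
  h.of_frame hf (fun h' => hr (hR h')) fun a h1 h2 => absurd (ha a (hA h2)) (by omega)

lemma nearest_regs (d : ℕ) : (nearest d).regs ⊆ [10, 16, 21] := by
  simp [nearest, forUp, Cmd.regs]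

lemma nearest_arrs (d : ℕ) : (nearest d).arrs ⊆ [] := by
  simp [nearest, forUp, Cmd.arrs]

lemma prune_regs (d : ℕ) : (prune d).regs ⊆ [4, 5, 16, 20] := by
  simp [prune, forUp, Cmd.regs]

lemma prune_arrs (d : ℕ) : (prune d).arrs ⊆ [d + 1, d + 2] := by
  simp [prune, forUp, Cmd.arrs]

lemma net_regs (d : ℕ) : (net d).regs ⊆ [4, 16, 20] := by
  simp [net, forUp, Cmd.regs]

lemma net_arrs (d : ℕ) : (net d).arrs ⊆ [d + 1, d + 2, d + 3] := by
  simp [net, forUp, Cmd.arrs]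

lemma init_regs (d : ℕ) : (init d).regs ⊆ [4, 5, 16, 22] := by
  simp [init, forUp, Cmd.regs]

lemma init_arrs (d : ℕ) : (init d).arrs ⊆ [d + 1, d + 2] := by
  simp [init, forUp, Cmd.arrs]

/-! ### One round -/

/-- The part of a round in which the working set is pruned, or netted with the radius in register
`10`, or found to have the right scale. -/
def shrink (d : ℕ) : Cmd :=
  .seq (.seq (.set 11 (.div (.var 10) (.const (6 * (d + 1))))) (.set 12 (.const (4 * (d + 1)))))
  (.seq (scan d)
  (.ite (.not (.lt (.read (d + 5) (.const (d + 1))) (.var 5))) (prune d)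
  (.seq (.set 11 (.mul (.const (64 * (d + 1))) (.var 10)))
  (.seq (scan d)
  (.ite (.not (.lt (.read (d + 5) (.const (d + 1))) (.var 5))) (.set 7 (.const 1))
  (.seq (.set 11 (.mul (.const 4) (.var 10))) (.seq (net d) (.set 6 (.var 10)))))))))

/-- A round after the choice of a slot (register `8`) and of a shift (register `9`). -/
def roundBody (d : ℕ) : Cmd :=
  .seq (nearest d) (.seq (.ite (.lt (.var 10) (.mul (.const 2) (.var 6)))
    (.set 10 (.mul (.const 2) (.var 6))) .skip) (shrink d))

structure AtRound (G : ℝ → Prop) (n : ℕ) (Y : ℕ → EuclideanSpace ℝ (Fin d)) (v : ℕ → ℝ)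
    (m k ε : ℝ) (s : ℕ) (X : ℕ → EuclideanSpace ℝ (Fin d)) (w : ℕ → ℝ) (kk Λ : ℝ)
    (σ : Store) : Prop where
  input : Input n Y v m k ε σ
  holds : Holds s X w σ
  kk_eq : σ.reg 5 = kk
  Λ_eq : σ.reg 6 = Λ
  done : σ.reg 7 = 0
  inv : WorkInv G s X w m kk Λ

structure AtEnd (G : ℝ → Prop) (n : ℕ) (Y : ℕ → EuclideanSpace ℝ (Fin d)) (v : ℕ → ℝ)
    (m k ε : ℝ) (L : ℝ) (σ : Store) : Prop where
  input : Input n Y v m k ε σ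
  done : σ.reg 7 = 1
  scale : σ.reg 10 = L
  pos : 0 < L
  upper : G (256 * (d + 1) ^ 2 * L)
  lower : ∀ r, 0 ≤ r → G r → L / (9 * (d + 1)) ≤ r

def boxSize (d : ℕ) : ℕ := (2 * (4 * (d + 1)) + 1) ^ d + 4 * (d + 1) + 1

variable {G : ℝ → Prop} {n : ℕ} {Y : ℕ → EuclideanSpace ℝ (Fin d)} {v : ℕ → ℝ} {m k ε : ℝ}
  {s : ℕ} {X : ℕ → EuclideanSpace ℝ (Fin d)} {w : ℕ → ℝ} {kk Λ : ℝ} {σ : Store}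

open Classical in
-- The two scans leave three cases: f small (prune), f comparable with L (stop), f large (net). The
-- two alternatives in the conclusion measure the progress made by pruning and by netting.
theorem shrink_run (h : AtRound G n Y v m k ε s X w kk Λ σ)
    (hG : ∀ r r', r ≤ r' → G r → G r') {b : ℕ} {l L : ℝ} {nn : ℕ → ℝ} (h9 : σ.reg 9 = b)
    (h10 : σ.reg 10 = L) (hl : 0 < l) (hL : L = max l (2 * Λ))
    (hnn : ∀ j < s, ∀ i < s, i ≠ j → nn j ≤ dist (X j) (X i)) :
    Run (shrink d) σ ((s + 1) * (50 + 120 * boxSize d)) fun τ =>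
      AtEnd G n Y v m k ε L τ ∨ ∃ s' X' w' kk' Λ',
        AtRound G n Y v m k ε s' X' w' kk' Λ' τ ∧
        (s' + #{j ∈ range s | l ≤ nn j} ≤ s ∨
          2 * s' + mergedCount s (fun j => netCell (4 * L) b (X j)) ≤ 2 * s) := by
  have hL0 : 0 < L := hL ▸ lt_max_of_lt_left hl
  have hLΛ : 2 * Λ ≤ L := hL ▸ le_max_right _ _
  set T2 : ℕ := 1 + ((30 * (s + 1)) + 1 + 1) + 1 with hT2
  set T1 : ℕ := 60 * ((s + 1) * boxSize d) with hT1
  refine Run.conseq (T := 3 + (T1 + ((1 + (T1 + (T2 + 1) + 1) + 1) + 1) + 1) + 1)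
    (Run.seq (T := 3) (T' := T1 + ((1 + (T1 + (T2 + 1) + 1) + 1) + 1) + 1)
      (R := fun τ => τ = (σ.setReg 11 (L / (6 * (d + 1)))).setReg 12 ((4 * (d + 1) : ℕ) : ℝ))
      (Run.straight (by simp [Cmd.Straight]) ?_) ?_) ?_ (fun _ _ => id)
  · simp [Cmd.exec, Term.eval, h10]
  swap
  · generalize boxSize d = B at *
    simp only [hT1, hT2]
    ring_nf
    omega
  rintro τ hf hτ
  have r11 : τ.reg 11 = L / (6 * (d + 1)) := by simp [hτ]
  have r12 : τ.reg 12 = ((4 * (d + 1) : ℕ) : ℝ) := by simp [hτ]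
  have r9 : τ.reg 9 = b := by simpa [hτ] using h9
  have r10 : τ.reg 10 = L := by simpa [hτ] using h10
  have r5 : τ.reg 5 = kk := by simpa [hτ] using h.kk_eq
  have r6 : τ.reg 6 = Λ := by simpa [hτ] using h.Λ_eq
  have r7 : τ.reg 7 = 0 := by simpa [hτ] using h.done
  have hin : Input n Y v m k ε τ := h.input.of_frame hf (by simp [Cmd.regs]; omega)
    (by simp [Cmd.arrs])
  have hho : Holds s X w τ := h.holds.of_frame hf (by simp [Cmd.regs]) (by simp [Cmd.arrs])
  clear hf hτ h9 h10
  have hinv := h.inv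
  clear h
  refine Run.seq (scan_run hho hin.m r11 r12) ?_
  rintro τ₁ hf ⟨hO, hN⟩
  have fr : ∀ x, x ∉ [13, 14, 15, 16, 17, 18, 19] → τ₁.reg x = τ.reg x :=
    fun x hx => hf.reg x fun h' => hx (scan_regs d h')
  rw [← fr 9 (by simp)] at r9
  rw [← fr 10 (by simp)] at r10
  rw [← fr 12 (by simp)] at r12
  rw [← fr 5 (by simp)] at r5
  rw [← fr 6 (by simp)] at r6
  rw [← fr 7 (by simp)] at r7
  replace hin := hin.of_subset hf (scan_regs d) (scan_arrs d) (by simp) (by simp)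
  replace hho := hho.of_subset hf (scan_regs d) (scan_arrs d) (by simp) (by simp)
  clear hf fr r11 τ
  have hO' := hO (d + 1) (by omega)
  have hη : 0 < L / (6 * (d + 1) : ℝ) := by positivity
  have eO : (Term.read (d + 5) (.const (d + 1))).eval τ₁ = τ₁.arr (d + 5) (d + 1 : ℕ) := by
    simp only [Term.eval, Int.floor_intCast]
    push_cast
    rfl
  refine Run.ite (fun hb => ?_) (fun hb => ?_)
  · simp only [Test.holds, eO, hO'] at hb
    simp only [Term.eval, r5, not_lt] at hb
    have hlt := hinv.lt_of_prune hG hL0 hb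
    -- Pruning thus happens only at the sampled distance itself, so it removes all points at least
    -- as isolated as the sampled one.
    have hLl : L = l := by
      rcases max_choice l (2 * Λ) with h' | h' <;> rw [h'] at hL <;> linarith
    refine (prune_run hho hin.m hN).conseq (by simp only [hT2]; nlinarith [Nat.zero_le T1]) ?_
    rintro ρ hf ⟨s', e, hho', hF, he, hinj, h5⟩
    have fr : ∀ x, x ∉ [4, 5, 16, 20] → ρ.reg x = τ₁.reg x :=
      fun x hx => hf.reg x fun h' => hx (prune_regs d h')
    rw [r5] at h5
    refine .inr ⟨s', _, _, _, Λ, ⟨hin.of_subset hf (prune_regs d) (prune_arrs d) (by simp)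
      (by simp), hho', h5, by rw [fr 6 (by simp), r6], by rw [fr 7 (by simp), r7],
      hinv.prune hη hb hF he hinj⟩, .inl (card_prune_le hη ?_ hnn hF)⟩
    rw [hLl]
    apply le_of_eq
    field_simp
  · simp only [Test.holds, eO, hO'] at hb
    simp only [Term.eval, r5, not_not] at hb
    have hb1 := not_le.2 hb
    clear hO hO' hN hb eO
    refine Run.seq (T := 1) (R := fun τ => τ = τ₁.setReg 11 (64 * (d + 1) * L)) (.set ?_) ?_
    · simp [Term.eval, r10]
    rintro τ hf hτ
    have r11 : τ.reg 11 = 64 * (d + 1) * L := by simp [hτ]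
    replace hin := hin.of_frame hf (by simp [Cmd.regs]; omega) (by simp [Cmd.arrs])
    replace hho := hho.of_frame hf (by simp [Cmd.regs]) (by simp [Cmd.arrs])
    rw [← hf.reg 9 (by simp [Cmd.regs])] at r9
    rw [← hf.reg 10 (by simp [Cmd.regs])] at r10
    rw [← hf.reg 12 (by simp [Cmd.regs])] at r12
    rw [← hf.reg 5 (by simp [Cmd.regs])] at r5
    rw [← hf.reg 6 (by simp [Cmd.regs])] at r6
    rw [← hf.reg 7 (by simp [Cmd.regs])] at r7
    clear hf hτ τ₁
    refine Run.seq (scan_run hho hin.m r11 r12) ?_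
    rintro τ₁ hf ⟨hO, -⟩
    have fr : ∀ x, x ∉ [13, 14, 15, 16, 17, 18, 19] → τ₁.reg x = τ.reg x :=
      fun x hx => hf.reg x fun h' => hx (scan_regs d h')
    rw [← fr 9 (by simp)] at r9
    rw [← fr 10 (by simp)] at r10
    rw [← fr 5 (by simp)] at r5
    rw [← fr 7 (by simp)] at r7
    replace hin := hin.of_subset hf (scan_regs d) (scan_arrs d) (by simp) (by simp)
    replace hho := hho.of_subset hf (scan_regs d) (scan_arrs d) (by simp) (by simp)
    clear hf fr r6 r11 r12 τ
    have hO' := hO (d + 1) (by omega)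
    have eO : (Term.read (d + 5) (.const (d + 1))).eval τ₁ = τ₁.arr (d + 5) (d + 1 : ℕ) := by
      simp only [Term.eval, Int.floor_intCast]
      push_cast
      rfl
    refine Run.ite (fun hb => ?_) (fun hb => ?_)
    · simp only [Test.holds, eO, hO'] at hb
      simp only [Term.eval, r5, not_lt] at hb
      refine (Run.set (Q := fun τ => τ = τ₁.setReg 7 1) (by simp [Term.eval])).conseq
        (by omega) ?_
      rintro ρ hf rfl
      exact .inl ⟨hin.of_frame hf (by simp [Cmd.regs]; omega) (by simp [Cmd.arrs]), by simp,
        by simpa using r10, hL0, hinv.upper hG hL0 hLΛ hb, fun r => hinv.lower hG hL0 hb1⟩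
    · simp only [Test.holds, eO, hO'] at hb
      simp only [Term.eval, r5, not_not] at hb
      have hb2 := not_le.2 hb
      clear hO hO' hb eO hb1
      refine Run.seq (T := 1) (T' := 30 * (s + 1) + 1 + 1) (R := fun τ => τ = τ₁.setReg 11 (4 * L))
        (.set ?_) ?_
      · simp [Term.eval, r10]
      rintro τ hf hτ
      have r11 : τ.reg 11 = 4 * L := by simp [hτ]
      replace hin := hin.of_frame hf (by simp [Cmd.regs]; omega) (by simp [Cmd.arrs])
      replace hho := hho.of_frame hf (by simp [Cmd.regs]) (by simp [Cmd.arrs])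
      rw [← hf.reg 9 (by simp [Cmd.regs])] at r9
      rw [← hf.reg 10 (by simp [Cmd.regs])] at r10
      rw [← hf.reg 5 (by simp [Cmd.regs])] at r5
      rw [← hf.reg 7 (by simp [Cmd.regs])] at r7
      clear hf hτ τ₁
      refine Run.seq (T' := 1) (net_run hho r9 r11) ?_
      rintro ρ hf ⟨s', g, r, hho', hg, hr, hcell⟩
      have fr : ∀ x, x ∉ [4, 16, 20] → ρ.reg x = τ.reg x :=
        fun x hx => hf.reg x fun h' => hx (net_regs d h')
      replace hin := hin.of_subset hf (net_regs d) (net_arrs d) (by simp) (by simp)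
      refine (Run.set (Q := fun τ => τ = ρ.setReg 6 L) (by simp [Term.eval, fr, r10])).conseq
        le_rfl ?_
      rintro π hf' rfl
      exact .inr ⟨s', _, _, kk, L, ⟨hin.of_frame hf' (by simp [Cmd.regs]; omega)
        (by simp [Cmd.arrs]), hho'.of_frame hf' (by simp [Cmd.regs]) (by simp [Cmd.arrs]),
        by simp [fr, r5], by simp, by simp [fr, r7], hinv.net hL0 hLΛ hb2 hg hr hcell⟩,
        .inr (card_net_le hr hcell)⟩

open Classical in
-- Taking the maximum with 2 Λ keeps the merging radii at least doubling. It does no harm to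
-- progress: netting at a larger radius still catches all points with nearest-neighbour distance at
-- most `nn u`.
theorem roundBody_run (h : AtRound G n Y v m k ε s X w kk Λ σ)
    (hG : ∀ r r', r ≤ r' → G r → G r') (hs : 2 ≤ s) {u b : ℕ} {nn : ℕ → ℝ} (h8 : σ.reg 8 = u)
    (hu : u < s) (h9 : σ.reg 9 = b)
    (hnn : ∀ j < s, ∃ i < s, i ≠ j ∧ nn j = dist (X j) (X i))
    (hnn' : ∀ j < s, ∀ i < s, i ≠ j → nn j ≤ dist (X j) (X i)) :
    Run (roundBody d) σ (2 * (80 + 120 * boxSize d) * s) fun τ =>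
      (∃ L, AtEnd G n Y v m k ε L τ) ∨ ∃ s' X' w' kk' Λ',
        AtRound G n Y v m k ε s' X' w' kk' Λ' τ ∧
        (s' + #{j ∈ range s | nn u ≤ nn j} ≤ s ∨ 2 * s' +
          mergedCount s (fun j => netCell (4 * max (nn u) (2 * Λ)) b (X j)) ≤ 2 * s) := by
  set T : ℕ := (s + 1) * (50 + 120 * boxSize d) with hT
  refine Run.conseq (T := 20 * (s + 1) + (3 + T + 1) + 1)
    (Run.seq (T' := 3 + T + 1) (nearest_run h.holds h8 hu hs) ?_) ?_ (fun _ _ => id)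
  swap
  · rw [hT]
    generalize boxSize d = B
    nlinarith [mul_le_mul_of_nonneg_right hs (Nat.zero_le B)]
  rintro τ hf ⟨⟨i, hi, hiu, hl⟩, hl'⟩
  have hnu : τ.reg 10 = nn u := by
    obtain ⟨j, hj, hju, hd⟩ := hnn u hu
    refine le_antisymm ?_ ?_
    · rw [hd]; exact hl' j hj hju
    · rw [hl]; exact hnn' u hu i hi hiu
  have hpos : 0 < nn u := by
    rw [← hnu, hl, dist_pos]
    exact fun hX => hiu (h.inv.inj u hu i hi hX).symm
  have fr : ∀ x, x ∉ [10, 16, 21] → τ.reg x = σ.reg x :=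
    fun x hx => hf.reg x fun h' => hx (nearest_regs d h')
  have r6 : τ.reg 6 = Λ := by rw [fr 6 (by simp), h.Λ_eq]
  refine Run.seq (T := 3) (R := fun ρ => ρ = τ.setReg 10 (max (nn u) (2 * Λ)))
    (Run.straight (by simp [Cmd.Straight]) ?_) ?_
  · simp only [Cmd.exec, Test.holds, Term.eval, hnu, r6]
    split_ifs with hlt
    · rw [max_eq_right (by exact_mod_cast hlt.le)]
      norm_num
    · rw [max_eq_left (by exact_mod_cast not_lt.1 hlt), ← hnu]
      simp [Store.setReg]
  rintro ρ hf' hρ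
  have hA : AtRound G n Y v m k ε s X w kk Λ ρ := by
    refine ⟨?_, ?_, ?_, ?_, ?_, h.inv⟩
    · exact (h.input.of_subset hf (nearest_regs d) (nearest_arrs d) (by simp) (by simp)).of_frame
        hf' (by simp [Cmd.regs]; omega) (by simp [Cmd.arrs])
    · exact (h.holds.of_subset hf (nearest_regs d) (nearest_arrs d) (by simp) (by simp)).of_frame
        hf' (by simp [Cmd.regs]) (by simp [Cmd.arrs])
    · simp [hρ, fr, h.kk_eq]
    · simp [hρ, r6]
    · simp [hρ, fr, h.done]
  refine (shrink_run hA hG (l := nn u) (b := b) (by simp [hρ, fr, h9]) (by simp [hρ]) hpos rfl hnn').conseq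
    le_rfl ?_
  rintro π - (hE | hR)
  · exact .inl ⟨_, hE⟩
  · exact .inr hR

/-! ### The loop -/

lemma average_add_ofReal {M : ℕ} (hM : 0 < M) (F : ENNReal) {x : ℕ → ℝ}
    (hx : ∀ u < M, 0 ≤ x u) :
    (∑ u ∈ range M, (F + ENNReal.ofReal (x u))) / (M : ENNReal) =
      F + ENNReal.ofReal ((∑ u ∈ range M, x u) / M) := by
  have hM0 : (M : ENNReal) ≠ 0 := by exact_mod_cast hM.ne'
  rw [sum_add_distrib, ENNReal.add_div, sum_const, card_range, nsmul_eq_mul,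
    ENNReal.ofReal_div_of_pos (by exact_mod_cast hM), ENNReal.ofReal_natCast,
    ENNReal.ofReal_sum_of_nonneg fun u hu => hx u (mem_range.1 hu), mul_comm,
    ENNReal.mul_div_cancel_right hM0 (ENNReal.natCast_ne_top M)]

/-- Each random choice costs 2, for the sequence and the draw. Only the fuel of one draw is kept as
spent; that of the other is given back by `cost_mono`. -/
lemma cost_two_rand_le (good : Store → Prop) (N : ℕ) {s S : ℕ} (hs : 0 < s) (hS : 0 < S)
    {x y : ℕ} {t t' : Term} {P : Cmd} {K : List Cmd} {σ : Store}
    (ht : t.eval σ = s) (ht' : ∀ u : ℕ, t'.eval (σ.setReg x u) = S) {F : ENNReal} {c : ℕ → ℕ → ℝ}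
    (hc : ∀ u < s, ∀ b < S, 0 ≤ c u b)
    (h : ∀ u : ℕ, u < s → ∀ b : ℕ, b < S → cost good N ⟨P :: K, (σ.setReg x u).setReg y b⟩ ≤
      F + ENNReal.ofReal (c u b)) :
    cost good (N + 1) ⟨.seq (.rand x t) (.seq (.rand y t') P) :: K, σ⟩ ≤
      F + ENNReal.ofReal ((∑ u ∈ range s, ((∑ b ∈ range S, c u b) / S + 2)) / s + 2) := by
  have h1 : ∀ u < s, cost good N ⟨.seq (.rand y t') P :: K, σ.setReg x u⟩ ≤
      F + ENNReal.ofReal ((∑ b ∈ range S, c u b) / S + 2) := by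
    intro u hu
    calc cost good N ⟨.seq (.rand y t') P :: K, σ.setReg x u⟩
        ≤ (1 : ℕ) + cost good N ⟨.rand y t' :: P :: K, σ.setReg x u⟩ :=
          (Steps.head rfl (.refl _)).cost_le good N
      _ ≤ (1 : ℕ) + cost good (N + 1) ⟨.rand y t' :: P :: K, σ.setReg x u⟩ := by
          gcongr
          exact cost_mono _ _ _
      _ ≤ (1 : ℕ) + (1 + (∑ b ∈ range S,
            cost good N ⟨P :: K, (σ.setReg x u).setReg y b⟩) / S) := by
          gcongr
          exact cost_rand_le good N y t' _ _ S hS (ht' u)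
      _ ≤ (1 : ℕ) + (1 + (∑ b ∈ range S, (F + ENNReal.ofReal (c u b))) / S) := by
          gcongr with b hb
          exact h u hu b (mem_range.1 hb)
      _ = F + (ENNReal.ofReal ((∑ b ∈ range S, c u b) / S) + ENNReal.ofReal 2) := by
          rw [average_add_ofReal hS F (hc u hu), show ENNReal.ofReal 2 = 2 by simp]
          push_cast
          ring
      _ = _ := by
          rw [← ENNReal.ofReal_add _ (by norm_num)]
          exact div_nonneg (sum_nonneg fun b hb => hc u hu b (mem_range.1 hb)) (by positivity)
  have h0 : ∀ u < s, 0 ≤ (∑ b ∈ range S, c u b) / S + 2 := fun u hu =>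
    add_nonneg (div_nonneg (sum_nonneg fun b hb => hc u hu b (mem_range.1 hb)) (by positivity))
      (by norm_num)
  calc cost good (N + 1) ⟨.seq (.rand x t) (.seq (.rand y t') P) :: K, σ⟩
      ≤ (1 : ℕ) + cost good (N + 1) ⟨.rand x t :: .seq (.rand y t') P :: K, σ⟩ :=
        (Steps.head rfl (.refl _)).cost_le good (N + 1)
    _ ≤ (1 : ℕ) + (1 + (∑ u ∈ range s,
          cost good N ⟨.seq (.rand y t') P :: K, σ.setReg x u⟩) / s) := by
        gcongr
        exact cost_rand_le good N x t _ _ s hs ht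
    _ ≤ (1 : ℕ) + (1 + (∑ u ∈ range s,
          (F + ENNReal.ofReal ((∑ b ∈ range S, c u b) / S + 2))) / s) := by
        gcongr with u hu
        exact h1 u (mem_range.1 hu)
    _ = F + (ENNReal.ofReal ((∑ u ∈ range s, ((∑ b ∈ range S, c u b) / S + 2)) / s) +
          ENNReal.ofReal 2) := by
        rw [average_add_ofReal hs F h0, show ENNReal.ofReal 2 = 2 by simp]
        push_cast
        ring
    _ = _ := by
        rw [← ENNReal.ofReal_add _ (by norm_num)]
        exact div_nonneg (sum_nonneg fun u hu => h0 u (mem_range.1 hu)) (by positivity)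

/-- Repeat random rounds until the scale is found. -/
def rounds (d : ℕ) : Cmd :=
  .loop (.lt (.var 7) (.const 1))
    (.seq (.rand 8 (.var 4)) (.seq (.rand 9 (.const (2 ^ d))) (roundBody d)))

def roundCost (d : ℕ) : ℕ := 2 * (80 + 120 * boxSize d)

def roundsCost (d : ℕ) : ℝ := 32 * 2 ^ d * (roundCost d + 10)

lemma AtRound.set_random {G : ℝ → Prop} {n : ℕ} {Y : ℕ → EuclideanSpace ℝ (Fin d)} {v : ℕ → ℝ}
    {m k ε : ℝ} {s : ℕ} {X : ℕ → EuclideanSpace ℝ (Fin d)} {w : ℕ → ℝ} {kk Λ : ℝ} {σ : Store}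
    (h : AtRound G n Y v m k ε s X w kk Λ σ) (a b : ℝ) :
    AtRound G n Y v m k ε s X w kk Λ ((σ.setReg 8 a).setReg 9 b) where
  input := ⟨by simpa using h.input.size, by simpa using h.input.m, by simpa using h.input.k,
    by simpa using h.input.ε, h.input.coord, h.input.weight⟩
  holds := h.holds.of_eq (by simp) fun _ _ => rfl
  kk_eq := by simpa using h.kk_eq
  Λ_eq := by simpa using h.Λ_eq
  done := by simpa using h.done
  inv := h.inv

lemma exists_nearest {s : ℕ} (hs : 2 ≤ s) (X : ℕ → EuclideanSpace ℝ (Fin d)) :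
    ∃ nn : ℕ → ℝ, (∀ j < s, ∃ i < s, i ≠ j ∧ nn j = dist (X j) (X i)) ∧
      ∀ j < s, ∀ i < s, i ≠ j → nn j ≤ dist (X j) (X i) := by
  have h : ∀ j, j < s → ∃ i < s, i ≠ j ∧ ∀ i' < s, i' ≠ j → dist (X j) (X i) ≤ dist (X j) (X i') := by
    intro j hj
    obtain ⟨i, hi, hmin⟩ := exists_min_image ((range s).erase j) (fun i => dist (X j) (X i))
      (card_pos.1 (by rw [card_erase_of_mem (mem_range.2 hj), card_range]; omega))
    rw [mem_erase, mem_range] at hi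
    exact ⟨i, hi.2, hi.1, fun i' hi' hne => hmin i' (mem_erase.2 ⟨hne, mem_range.2 hi'⟩)⟩
  choose! i h1 h2 h3 using h
  exact ⟨fun j => dist (X j) (X (i j)), fun j hj => ⟨i j, h1 j hj, h2 j hj, rfl⟩,
    fun j hj i' hi' hne => h3 j hj i' hi' hne⟩

open Classical in
-- The potential is `roundsCost d * s`: its expected drop in a round pays for the round. The
-- induction is on the fuel and not on `s`, because an unlucky round may remove nothing.
theorem rounds_cost_le {G : ℝ → Prop} (hG : ∀ r r', r ≤ r' → G r → G r') {r₀ : ℝ} (hr₀ : 0 ≤ r₀)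
    (hGr₀ : G r₀) {n : ℕ} {Y : ℕ → EuclideanSpace ℝ (Fin d)} {v : ℕ → ℝ} {m k ε : ℝ}
    {good : Store → Prop} {K : List Cmd} {F : ENNReal}
    (hK : ∀ L τ, AtEnd G n Y v m k ε L τ → ∀ N, cost good N ⟨K, τ⟩ ≤ F) (N : ℕ) :
    ∀ (s : ℕ) (X : ℕ → EuclideanSpace ℝ (Fin d)) (w : ℕ → ℝ) (kk Λ : ℝ) (σ : Store),
      AtRound G n Y v m k ε s X w kk Λ σ →
      cost good N ⟨rounds d :: K, σ⟩ ≤ F + ENNReal.ofReal (roundsCost d * s) := by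
  have hc2 : 0 ≤ roundsCost d := by unfold roundsCost; positivity
  induction N with
  | zero => intros; simp [cost]
  | succ N ih =>
    intro s X w kk Λ σ h
    have hs := h.inv.two_le hG hr₀ hGr₀
    obtain ⟨nn, hnn, hnn'⟩ := exists_nearest hs X
    have hnpos : ∀ u < s, 0 < nn u := by
      intro u hu
      obtain ⟨i, hi, hne, hd⟩ := hnn u hu
      rw [hd, dist_pos]
      exact fun hX => hne (h.inv.inj u hu i hi hX).symm
    set M : ℕ → ℕ → ℕ := fun u b =>
      mergedCount s fun j => netCell (4 * max (nn u) (2 * Λ)) b (X j) with hM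
    -- The cost of a round with choices `u`, `b`, plus the potential left afterwards; the minimum
    -- covers both pruning and netting, and the 1 pays for the last test if the scale is found.
    set c : ℕ → ℕ → ℝ := fun u b => roundCost d * s + 1 + roundsCost d * (s -
      min (#{j ∈ range s | nn u ≤ nn j} : ℝ) ((M u b : ℝ) / 2)) with hc
    have hMs : ∀ u b, M u b ≤ s := fun u b => mergedCount_le _ _
    have hmin : ∀ u b, min (#{j ∈ range s | nn u ≤ nn j} : ℝ) ((M u b : ℝ) / 2) ≤ s := by
      intro u b
      refine (min_le_right _ _).trans ?_
      have : (M u b : ℝ) ≤ s := by exact_mod_cast hMs u b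
      linarith
    have hc0 : ∀ u < s, ∀ b < 2 ^ d, 0 ≤ c u b := by
      intro u _ b _
      have := mul_nonneg hc2 (sub_nonneg.2 (hmin u b))
      positivity
    have hbody : ∀ u : ℕ, u < s → ∀ b : ℕ, b < 2 ^ d →
        cost good N ⟨roundBody d :: rounds d :: K, (σ.setReg 8 u).setReg 9 b⟩ ≤
          F + ENNReal.ofReal (c u b) := by
      intro u hu b hb
      obtain ⟨t, ht, τ, hτ, -, hsteps⟩ := roundBody_run (h.set_random u b) hG hs (u := u) (b := b)
        (by simp) hu (by simp) hnn hnn'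
      have ht' : (t : ℝ) ≤ roundCost d * s := by
        rw [roundCost]
        exact_mod_cast ht
      have hstart := (hsteps (rounds d :: K)).cost_le good N
      have hfin : cost good N ⟨rounds d :: K, τ⟩ ≤ F + ENNReal.ofReal
          (1 + roundsCost d * (s - min (#{j ∈ range s | nn u ≤ nn j} : ℝ) ((M u b : ℝ) / 2))) := by
        rcases hτ with ⟨L, hE⟩ | ⟨s', X', w', kk', Λ', hR, hdec⟩
        · have hstep : Steps 1 ⟨rounds d :: K, τ⟩ ⟨K, τ⟩ :=
            .head (c' := ⟨K, τ⟩) (by simp [rounds, step, Test.holds, Term.eval, hE.done]) (.refl _)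
          calc _ ≤ ((1 : ℕ) : ENNReal) + cost good N ⟨K, τ⟩ := hstep.cost_le good N
            _ ≤ ((1 : ℕ) : ENNReal) + F := by gcongr; exact hK L τ hE N
            _ = F + ENNReal.ofReal 1 := by simp [add_comm]
            _ ≤ _ := by
                gcongr
                have := mul_nonneg hc2 (sub_nonneg.2 (hmin u b))
                linarith
        · refine (ih s' X' w' kk' Λ' τ hR).trans ?_
          gcongr
          have : (s' : ℝ) ≤ s - min (#{j ∈ range s | nn u ≤ nn j} : ℝ) ((M u b : ℝ) / 2) := by
            rcases hdec with hdec | hdec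
            · have h1 : (s' : ℝ) + #{j ∈ range s | nn u ≤ nn j} ≤ s := by exact_mod_cast hdec
              have := min_le_left (#{j ∈ range s | nn u ≤ nn j} : ℝ) ((M u b : ℝ) / 2)
              linarith
            · have h1 : 2 * (s' : ℝ) + M u b ≤ 2 * s := by exact_mod_cast hdec
              have := min_le_right (#{j ∈ range s | nn u ≤ nn j} : ℝ) ((M u b : ℝ) / 2)
              linarith
          have := mul_le_mul_of_nonneg_left this hc2
          linarith
      have h1 := mul_nonneg hc2 (sub_nonneg.2 (hmin u b))
      calc _ ≤ (t : ENNReal) + cost good N ⟨rounds d :: K, τ⟩ := hstart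
        _ ≤ ENNReal.ofReal (roundCost d * s) + (F + ENNReal.ofReal (1 + roundsCost d * (s -
            min (#{j ∈ range s | nn u ≤ nn j} : ℝ) ((M u b : ℝ) / 2)))) := by
            gcongr
            rw [← ENNReal.ofReal_natCast]
            exact ENNReal.ofReal_le_ofReal ht'
        _ = F + ENNReal.ofReal (c u b) := by
            rw [add_left_comm, ← ENNReal.ofReal_add (by positivity) (by linarith), hc]
            simp only [add_assoc]
    have hloop : Steps 1 ⟨rounds d :: K, σ⟩ ⟨.seq (.rand 8 (.var 4)) (.seq (.rand 9
        (.const (2 ^ d))) (roundBody d)) :: rounds d :: K, σ⟩ :=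
      .head (c' := ⟨.seq (.rand 8 (.var 4)) (.seq (.rand 9
        (.const (2 ^ d))) (roundBody d)) :: rounds d :: K, σ⟩)
        (by simp [rounds, step, Test.holds, Term.eval, h.done]) (.refl _)
    refine (hloop.cost_le good (N + 1)).trans ?_
    refine (add_le_add_right (cost_two_rand_le good N (by omega : 0 < s) (by positivity : 0 < 2 ^ d)
      (t := .var 4) (t' := .const (2 ^ d)) h.holds.size (by simp [Term.eval]) hc0 hbody) _).trans ?_
    have hsum := sum_removed_ge (S := 2 ^ d) nn M hMs fun u hu =>
      card_le_sum_mergedCount (lt_max_of_lt_left (hnpos u hu)) hnn (le_max_left _ _)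
    have hs0 : (0 : ℝ) < s := by exact_mod_cast (by omega : 0 < s)
    have hs1 : (1 : ℝ) ≤ s := by exact_mod_cast (by omega : 1 ≤ s)
    have hS0 : (0 : ℝ) < 2 ^ d := by positivity
    have hcsum : (∑ u ∈ range s, ((∑ b ∈ range (2 ^ d), c u b) / (2 ^ d : ℕ) + 2)) / s =
        roundCost d * s + 3 + roundsCost d * s - roundsCost d / (2 ^ d * s) *
          ∑ u ∈ range s, ∑ b ∈ range (2 ^ d),
            min (#{j ∈ range s | nn u ≤ nn j} : ℝ) ((M u b : ℝ) / 2) := by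
      simp only [hc, mul_sub, sum_add_distrib, sum_sub_distrib, sum_const, card_range,
        nsmul_eq_mul, ← sum_div, ← mul_sum]
      push_cast
      field_simp
      ring
    rw [hcsum, add_left_comm]
    gcongr
    have hle : roundsCost d / (2 ^ d * s) * ((s : ℝ) ^ 2 / 32) ≤ roundsCost d / (2 ^ d * s) *
          ∑ u ∈ range s, ∑ b ∈ range (2 ^ d),
            min (#{j ∈ range s | nn u ≤ nn j} : ℝ) ((M u b : ℝ) / 2) :=
      mul_le_mul_of_nonneg_left hsum (by positivity)
    -- The factor 32 · 2^d in `roundsCost` is chosen for this identity; the surplus 10 s covers the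
    -- constant number of control steps.
    have he : roundsCost d / (2 ^ d * s) * ((s : ℝ) ^ 2 / 32) = (roundCost d + 10) * s := by
      rw [roundsCost]
      field_simp
    rw [he] at hle
    have h1 : ((1 : ℕ) : ENNReal) = ENNReal.ofReal 1 := by simp
    have h2 : roundCost d * s + 3 + roundsCost d * s - roundsCost d / (2 ^ d * s) *
          ∑ u ∈ range s, ∑ b ∈ range (2 ^ d),
            min (#{j ∈ range s | nn u ≤ nn j} : ℝ) ((M u b : ℝ) / 2) + 2 ≤
        roundsCost d * s - 1 := by nlinarith
    have h3 : (32 : ℝ) ≤ roundsCost d * s := by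
      have h4 : (1 : ℝ) ≤ 2 ^ d := one_le_pow₀ (by norm_num)
      have h5 : (32 : ℝ) ≤ roundsCost d := by
        rw [roundsCost]
        have : (0 : ℝ) ≤ roundCost d := by positivity
        nlinarith
      nlinarith
    rw [h1]
    calc _ ≤ ENNReal.ofReal 1 + ENNReal.ofReal (roundsCost d * s - 1) := by
          gcongr
      _ = _ := by
          rw [← ENNReal.ofReal_add (by norm_num) (by linarith)]
          ring_nf

/-! ### The final selection -/

/-- Find in register `23` the first `i < ⌊reg 13⌋` such that cell `i` of array `d + 5` is at
least `k`. -/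
def firstIndex (d : ℕ) : Cmd :=
  .seq (.set 23 (.const 0)) (forUp 18 13
    (.ite (.and (.lt (.read (d + 5) (.var 18)) (.var 2)) (.not (.lt (.var 23) (.var 18))))
      (.set 23 (.add (.var 18) (.const 1))) .skip))

/-- Register 23 advances only while it keeps up with the counter, so it stays at the first index
whose entry is at least k. -/
lemma firstIndex_run {σ : Store} {I : ℕ} {k : ℝ} (h2 : σ.reg 2 = k)
    (h13 : σ.reg 13 = (I + 1 : ℕ)) (hI : k ≤ σ.arr (d + 5) I) :
    Run (firstIndex d) σ (6 * (I + 1) + 10) fun τ => ∃ i ≤ I, τ.reg 23 = i ∧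
      k ≤ σ.arr (d + 5) i ∧ ∀ j < i, σ.arr (d + 5) j < k := by
  refine Run.conseq (T := 1 + ((I + 1) * (2 + 3) + 3) + 1) (Run.seq (T' := (I + 1) * (2 + 3) + 3)
    (R := fun τ => τ = σ.setReg 23 0)
    (Q := fun τ => ∃ i ≤ I, τ.reg 23 = i ∧
      k ≤ σ.arr (d + 5) i ∧ ∀ j < i, σ.arr (d + 5) j < k)
    (.set (by simp [Term.eval])) ?_) (by omega) (fun _ _ => id)
  rintro _ - rfl
  refine Run.forUp (I + 1) _ (fun i' τ => ∃ i ≤ i', τ.reg 23 = i ∧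
      (i < i' → k ≤ σ.arr (d + 5) i) ∧ ∀ j < i, σ.arr (d + 5) j < k) (by simpa using h13)
      (by simp [Cmd.regs]) (by simp [Cmd.regs]) ⟨0, le_rfl, by simp⟩ ?_ ?_
  · rintro j hj τ hf hx ⟨i, hi, h23, h1, h3⟩
    have r2 := hf.reg 2 (by simp [forUp, Cmd.regs])
    rw [Store.setReg_reg, if_neg (by norm_num), h2] at r2
    have a5 := hf.arr (d + 5) (by simp [forUp, Cmd.arrs])
    rw [Store.setReg_arr] at a5
    refine Run.ite (T := 1) (fun hb => .set ?_) (fun hb => .skip ?_)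
    · simp only [Test.holds, Term.eval, hx, Int.floor_natCast, a5, r2, h23, Nat.cast_lt] at hb
      have hij : i = j := by omega
      refine ⟨j + 1, le_rfl, by simp [Term.eval, hx], by simp, fun j' hj' => ?_⟩
      rcases Nat.lt_succ_iff_lt_or_eq.1 hj' with h4 | rfl
      · exact h3 j' (by omega)
      · exact hb.1
    · simp only [Test.holds, Term.eval, hx, Int.floor_natCast, a5, r2, h23, Nat.cast_lt] at hb
      refine ⟨i, by omega, by simpa using h23, fun _ => ?_, h3⟩
      by_cases hij : i < j
      · exact h1 hij
      · have : i = j := by omega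
        subst this
        by_contra hlt
        exact hb ⟨not_le.1 hlt, by simp⟩
  · rintro τ hf hx ⟨i, hi, h23, h1, h3⟩
    rcases Nat.lt_succ_iff_lt_or_eq.1 (Nat.lt_succ_of_le hi) with h4 | rfl
    · exact ⟨i, by omega, h23, h1 h4, h3⟩
    · exact absurd (h3 I (by omega)) (not_lt.2 hI)

/-- Compute the output from the scale in register `10`. -/
def select (d : ℕ) : Cmd :=
  .seq (init d)
  (.seq (.seq (.set 11 (.div (.mul (.var 3) (.var 10)) (.const (27 * (d + 1) ^ 2))))
    (.set 12 (.add (.floor (.div (.const (6912 * (d + 1) ^ 4)) (.var 3))) (.const (d + 2)))))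
  (.seq (scan d)
  (.seq (.set 13 (.add (.var 12) (.const 1)))
  (.seq (firstIndex d)
    (.set 0 (.mul (.var 11) (.add (.var 23) (.const (d + 2)))))))))

lemma firstIndex_regs (d : ℕ) : (firstIndex d).regs ⊆ [18, 23] := by
  simp [firstIndex, forUp, Cmd.regs]

/-- The bound for the distances of cells in `select`. -/
def selectBound (d : ℕ) (ε : ℝ) : ℕ := ⌊6912 * (d + 1) ^ 4 / ε⌋₊ + d + 2

/-- `init` restores the full input, so the scan is free of merging errors. The answer is the upper
end of the bracket for the first successful radius. -/
theorem select_run {n : ℕ} {Y : ℕ → EuclideanSpace ℝ (Fin d)} {v : ℕ → ℝ} {m k ε L f : ℝ}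
    {σ : Store} (hv : ∀ i < n, 0 ≤ v i) (hε : 0 < ε)
    (h : AtEnd (Reach n Y v m k) n Y v m k ε L σ)
    (hf0 : 0 ≤ f) (hf : ∀ r, 0 ≤ r → (f ≤ r ↔ Reach n Y v m k r)) :
    Run (select d) σ (200 * ((n + 1) * ((2 * selectBound d ε + 1) ^ d + selectBound d ε + 1)))
      fun τ => f ≤ τ.reg 0 ∧ τ.reg 0 ≤ (1 + ε) * f := by
  set I := selectBound d ε with hI
  have hL := h.pos
  set η : ℝ := ε * L / (27 * (d + 1) ^ 2) with hη
  have hη0 : 0 < η := by positivity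
  refine Run.conseq (T := 30 * (n + 1) + (3 + (60 * ((n + 1) * ((2 * I + 1) ^ d + I + 1)) +
      (1 + ((6 * (I + 1) + 10) + 1 + 1) + 1) + 1) + 1) + 1)
    (Run.seq (T' := 3 + (60 * ((n + 1) * ((2 * I + 1) ^ d + I + 1)) +
      (1 + ((6 * (I + 1) + 10) + 1 + 1) + 1) + 1) + 1) (init_run h.input) ?_) ?_ (fun _ _ => id)
  swap
  · clear_value I
    generalize (2 * I + 1) ^ d = B
    have hexp : (n + 1) * (B + I + 1) = n * B + n * I + n + B + I + 1 := by ring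
    rw [hexp]
    generalize n * B = x
    generalize n * I = y
    omega
  rintro τ hfr ⟨hho, -, -⟩
  have hin := h.input.of_subset hfr (init_regs d) (init_arrs d) (by simp) (by simp)
  have r10 := hfr.reg 10 (fun h' => by simpa using init_regs d h')
  rw [h.scale] at r10
  clear hfr
  refine Run.seq (T := 3) (T' := 60 * ((n + 1) * ((2 * I + 1) ^ d + I + 1)) +
      (1 + ((6 * (I + 1) + 10) + 1 + 1) + 1) + 1)
    (R := fun ρ => ρ = (τ.setReg 11 η).setReg 12 (I : ℝ))
    (Run.straight (by simp [Cmd.Straight]) ?_) ?_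
  · have hfl : ((⌊(6912 * ((d : ℝ) + 1) ^ 4) / ε⌋ : ℤ) : ℝ) + (d + 2) = (I : ℝ) := by
      rw [hI, selectBound, ← Int.natCast_floor_eq_floor (by positivity)]
      push_cast
      ring
    simp [Cmd.exec, Term.eval, hin.ε, r10, hη, ← hfl]
  rintro ρ hfr hρ
  have r11 : ρ.reg 11 = η := by simp [hρ]
  have r12 : ρ.reg 12 = I := by simp [hρ]
  replace hin := hin.of_frame hfr (by simp [Cmd.regs]; omega) (by simp [Cmd.arrs])
  replace hho := hho.of_frame hfr (by simp [Cmd.regs]) (by simp [Cmd.arrs])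
  clear hfr hρ r10 τ
  refine Run.seq (scan_run hho hin.m r11 r12) ?_
  rintro τ hfr ⟨hO, -⟩
  have fr : ∀ x, x ∉ [13, 14, 15, 16, 17, 18, 19] → τ.reg x = ρ.reg x :=
    fun x hx => hfr.reg x fun h' => hx (scan_regs d h')
  rw [← fr 11 (by simp)] at r11
  rw [← fr 12 (by simp)] at r12
  have r2 : τ.reg 2 = k := by rw [fr 2 (by simp), hin.k]
  clear hfr fr hin hho ρ
  refine Run.seq (T := 1) (T' := (6 * (I + 1) + 10) + 1 + 1)
    (R := fun ρ => ρ = τ.setReg 13 (I + 1 : ℕ)) (.set (by simp [Term.eval, r12])) ?_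
  rintro ρ - rfl
  have hd : (0 : ℝ) ≤ d := by positivity
  -- The largest radius suffices: 256 (d + 1)² L / η = 6912 (d + 1)⁴ / ε, as 6912 = 256 · 27.
  have hkI : k ≤ τ.arr (d + 5) I := by
    rw [hO I le_rfl]
    refine near_of_reach hv hη0 h.upper ?_
    have h1 : 6912 * (d + 1) ^ 4 / ε < (I : ℝ) + 1 - (d + 1) := by
      have := Nat.lt_floor_add_one (6912 * ((d : ℝ) + 1) ^ 4 / ε)
      rw [hI, selectBound]
      push_cast
      linarith
    calc 256 * ((d : ℝ) + 1) ^ 2 * L = η * (6912 * (d + 1) ^ 4 / ε) := by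
          rw [hη]; field_simp; norm_num
      _ < _ := by gcongr
  refine Run.seq (T' := 1) (firstIndex_run (k := k) (by simpa using r2) (by simp) hkI) ?_
  rintro ρ hfr ⟨i, hi, h23, hik, hlt⟩
  have q11 := hfr.reg 11 (fun h' => by simpa using firstIndex_regs d h')
  rw [Store.setReg_reg, if_neg (by norm_num), r11] at q11
  refine .set ?_
  have hval : (Term.mul (.var 11) (.add (.var 23) (.const (d + 2)))).eval ρ =
      η * (i + 1 + (d + 1)) := by
    simp only [Term.eval, q11, h23]
    push_cast
    ring
  simp only [hval, Store.setReg_reg, if_true]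
  simp only [Store.setReg_arr] at hik hlt
  rw [hO i hi] at hik
  have hup : f ≤ η * (i + 1 + (d + 1)) :=
    (hf _ (by positivity)).2 (reach_of_near hv hη0 hik le_rfl)
  refine ⟨hup, ?_⟩
  have hGf : Reach n Y v m k f := (hf f hf0).1 le_rfl
  have hlow := h.lower f hf0 hGf
  -- Failure at i - 1 bounds f from below; for i = 0 there is no such failure, but the bound is not
  -- positive.
  have hlow2 : η * (i - (d + 1)) ≤ f := by
    by_contra! hlt'
    rcases Nat.eq_zero_or_pos i with rfl | hpos
    · have : η * (((0 : ℕ) : ℝ) - (d + 1)) ≤ 0 :=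
        mul_nonpos_of_nonneg_of_nonpos hη0.le (by push_cast; linarith)
      linarith
    · have h4 := hlt (i - 1) (by omega)
      rw [hO (i - 1) (by omega)] at h4
      refine absurd (near_of_reach hv hη0 hGf (hlt'.trans_le (le_of_eq ?_))) (not_le.2 h4)
      rw [Nat.cast_sub hpos]
      push_cast
      ring
  -- The bracket has width η (2 (d + 1) + 1) ≤ 3 (d + 1) η, and the 27 in η turns this into ε times
  -- the lower bound for f.
  have h5 : η * (3 * (d + 1)) = ε * (L / (9 * (d + 1))) := by
    rw [hη]; field_simp; norm_num
  have h6 : ε * (L / (9 * (d + 1))) ≤ ε * f := by gcongr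
  nlinarith [mul_nonneg hη0.le hd]

/-! ### The algorithm -/

/-- The whole algorithm. -/
def algorithm (d : ℕ) : Cmd :=
  .seq (init d) (.ite (.lt (.var 22) (.var 2))
    (.seq (.seq (.set 6 (.const 0)) (.set 7 (.const 0))) (.seq (rounds d) (select d)))
    (.set 0 (.const 0)))

lemma input_inputStore {n : ℕ} (p : Fin n → EuclideanSpace ℝ (Fin d)) (w : Fin n → ℕ)
    (m k : ℕ) (ε : ℝ) :
    Input n (pointAt p) (weightAt w) m k ε (inputStore p w m k ε) where
  size := by simp [inputStore]
  m := by simp [inputStore]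
  k := by simp [inputStore]
  ε := by simp [inputStore]
  coord j hj c := by simp [inputStore, pointAt, hj]
  weight j hj := by simp [inputStore, weightAt, hj]

/-- Distinct points see only their own copies at distance 0. -/
lemma reach_zero_iff {n : ℕ} {Y : ℕ → EuclideanSpace ℝ (Fin d)} {v : ℕ → ℝ} {m k : ℝ}
    (hinj : ∀ j < n, ∀ i < n, Y j = Y i → j = i) :
    Reach n Y v m k 0 ↔ k ≤ ∑ i ∈ range n, if m + 1 ≤ v i then v i else 0 := by
  classical
  rw [Reach, deepWeight]
  refine iff_of_eq (congrArg _ (sum_congr rfl fun j hj => ?_))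
  rw [sum_eq_single_of_mem j hj fun i hi hne => ?_]
  · simp
  · rw [if_neg]
    intro h
    exact hne (hinj j (mem_range.1 hj) i (mem_range.1 hi) (dist_le_zero.1 h)).symm

/-- The constant of the time bound of `select`. -/
def selectCost (d : ℕ) : ℝ := 400 * (13824 * (d + 1) ^ 4 + 2 * d + 6) ^ (d + 1) * 2

/-- Dimension 0 must be excluded: the term `selectBound`, of order 1/ε, is dominated by 1/ε^d only
for d ≥ 1. -/
lemma selectTime_le (hd : 0 < d) {n : ℕ} (hn : 0 < n) {ε : ℝ} (hε : 0 < ε) (hε1 : ε ≤ 1) :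
    ((200 * ((n + 1) * ((2 * selectBound d ε + 1) ^ d + selectBound d ε + 1)) : ℕ) : ℝ) ≤
      selectCost d * (n / ε ^ d) := by
  set A : ℝ := 13824 * (d + 1) ^ 4 + 2 * d + 6 with hA
  have hA1 : 1 ≤ A := by
    have : (0 : ℝ) ≤ 13824 * (d + 1) ^ 4 + 2 * d := by positivity
    linarith
  have h1ε : 1 ≤ 1 / ε := by rw [le_div_iff₀ hε]; linarith
  have hI : 2 * (selectBound d ε : ℝ) + 1 ≤ A / ε := by
    have h1 : (⌊6912 * ((d : ℝ) + 1) ^ 4 / ε⌋₊ : ℝ) ≤ 6912 * (d + 1) ^ 4 / ε :=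
      Nat.floor_le (by positivity)
    have h2 : A / ε = 2 * (6912 * (d + 1) ^ 4 / ε) + (2 * d + 6) * (1 / ε) := by
      rw [hA]; field_simp; ring
    have h3 : (2 * (d : ℝ) + 6) * 1 ≤ (2 * d + 6) * (1 / ε) := by gcongr
    rw [h2, selectBound]
    push_cast
    linarith
  have hAd : (A / ε) ^ d ≤ A ^ (d + 1) / ε ^ d := by
    rw [div_pow]
    have := pow_le_pow_right₀ hA1 (Nat.le_succ d)
    gcongr
  have hA1d : A / ε ≤ A ^ (d + 1) / ε ^ d := by
    have : A / ε ≤ (A / ε) ^ d := le_self_pow₀ (by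
      rw [le_div_iff₀ hε]; linarith) hd.ne'
    exact this.trans hAd
  have h1 : (2 * (selectBound d ε : ℝ) + 1) ^ d ≤ A ^ (d + 1) / ε ^ d :=
    (pow_le_pow_left₀ (by positivity) hI d).trans hAd
  have h2 : (selectBound d ε : ℝ) + 1 ≤ A ^ (d + 1) / ε ^ d := by
    have : (1 : ℝ) ≤ selectBound d ε := by
      rw [selectBound]
      push_cast
      have : (0 : ℝ) ≤ (⌊6912 * ((d : ℝ) + 1) ^ 4 / ε⌋₊ : ℝ) := by positivity
      linarith
    linarith
  have hn1 : ((n : ℝ) + 1) ≤ 2 * n := by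
    have : (1 : ℝ) ≤ n := by exact_mod_cast hn
    linarith
  have h3 : (2 * (selectBound d ε : ℝ) + 1) ^ d + selectBound d ε + 1 ≤
      A ^ (d + 1) / ε ^ d + A ^ (d + 1) / ε ^ d := by linarith
  push_cast
  calc 200 * (((n : ℝ) + 1) * ((2 * (selectBound d ε : ℝ) + 1) ^ d + selectBound d ε + 1))
      ≤ 200 * ((2 * n) * (A ^ (d + 1) / ε ^ d + A ^ (d + 1) / ε ^ d)) := by
        gcongr
    _ = selectCost d * (n / ε ^ d) := by
        rw [selectCost, ← hA]
        ring

end NeighborDistance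

end

/-! ### Correctness and expected time of the whole algorithm. -/

open NeighborDistance RealRAM in
-- The invariant holds at the start with the input as working set and Λ = 0: there is no error, and
-- `G` fails at 0 because the branch for f = 0 was not taken.
theorem algorithm_spec {d n : ℕ} (p : Fin n → EuclideanSpace ℝ (Fin d)) (w : Fin n → ℕ)
    (m k : ℕ) (ε : ℝ) (hp : Function.Injective p) (hw : ∀ i, 0 < w i) (hm : 1 ≤ m)
    (hmc : m + 1 ≤ ∑ i, w i) (hk : 1 ≤ k) (hkc : k ≤ ∑ i, w i) (hε : 0 < ε) (hε1 : ε ≤ 1) (N : ℕ) :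
    cost (fun τ => kthMthNeighborDist (copies p w) m k ≤ τ.reg 0 ∧
        τ.reg 0 ≤ (1 + ε) * kthMthNeighborDist (copies p w) m k) N
      (start (algorithm d) (inputStore p w m k ε)) ≤
      ENNReal.ofReal ((80 + roundsCost d + selectCost d) * n / ε ^ d) := by
  classical
  set f := kthMthNeighborDist (copies p w) m k with hfdef
  set good : Store → Prop := fun τ => f ≤ τ.reg 0 ∧ τ.reg 0 ≤ (1 + ε) * f with hgood
  set Y := pointAt p with hY
  set v := weightAt w with hv
  have hf0 : 0 ≤ f := kthMthNeighborDist_nonneg _ _ _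
  have hf : ∀ r, 0 ≤ r → (f ≤ r ↔ Reach n Y v m k r) := fun r hr =>
    kthMthNeighborDist_copies_le_iff p w hm hmc hk hkc hr
  have hvpos : ∀ i < n, 0 < v i := fun i hi => by
    rw [hv, weightAt, dif_pos hi]
    exact_mod_cast hw _
  have hG : ∀ r r', r ≤ r' → Reach n Y v m k r → Reach n Y v m k r' := fun r r' hr =>
    Reach.mono (fun i hi => (hvpos i hi).le) hr
  have hinj : ∀ j < n, ∀ i < n, Y j = Y i → j = i := fun j hj i hi h => by
    rw [hY, pointAt, pointAt, dif_pos hj, dif_pos hi] at h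
    simpa using hp h
  have hn : 0 < n := by
    rcases Nat.eq_zero_or_pos n with rfl | h
    · simp at hmc
    · exact h
  have hn1 : (1 : ℝ) ≤ n := by exact_mod_cast hn
  have hεd : (1 : ℝ) ≤ 1 / ε ^ d := by
    rw [le_div_iff₀ (by positivity), one_mul]
    exact pow_le_one₀ hε.le hε1
  have hr0 : 0 ≤ roundsCost d := by unfold roundsCost; positivity
  have hs0 : 0 ≤ selectCost d := by unfold selectCost; positivity
  have hsplit : (80 + roundsCost d + selectCost d) * n / ε ^ d =
      (80 * n + roundsCost d * n) * (1 / ε ^ d) + selectCost d * (n / ε ^ d) := by ring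
  have hbase : 80 * n + roundsCost d * n ≤ (80 * n + roundsCost d * n) * (1 / ε ^ d) :=
    le_mul_of_one_le_right (by positivity) hεd
  have hsel : 0 ≤ selectCost d * (n / ε ^ d) := by positivity
  have hrn : 0 ≤ roundsCost d * n := by positivity
  rw [hsplit]
  have hdone : ∀ τ, good τ → ∀ N, cost good N ⟨[], τ⟩ = 0 := by
    intro τ hτ N
    cases N with
    | zero => rfl
    | succ N => simp [cost, Config.Halted, hτ]
  have hin := input_inputStore p w m k ε
  obtain ⟨t, ht, τ, ⟨hho, h5, h22⟩, hfr, hsteps⟩ := init_run hin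
  have hinτ := hin.of_subset hfr (init_regs d) (init_arrs d) (by simp) (by simp)
  have h2 := hinτ.k
  set R : Cmd := .ite (.lt (.var 22) (.var 2))
    (.seq (.seq (.set 6 (.const 0)) (.set 7 (.const 0))) (.seq (rounds d) (select d)))
    (.set 0 (.const 0)) with hR
  have hstart : Steps (t + 1) (start (algorithm d) (inputStore p w m k ε)) ⟨[R], τ⟩ :=
    .head rfl (hsteps _)
  have ht' : ((t + 1 : ℕ) : ENNReal) ≤ ENNReal.ofReal (61 * n) := by
    rw [← ENNReal.ofReal_natCast]
    refine ENNReal.ofReal_le_ofReal ?_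
    have : (t : ℝ) ≤ 30 * (n + 1) := by exact_mod_cast ht
    push_cast
    linarith
  refine (hstart.cost_le good N).trans ((add_le_add_left ht' _).trans ?_)
  by_cases hlt : τ.reg 22 < τ.reg 2
  · have hnot : ¬ Reach n Y v m k 0 := by
      rw [reach_zero_iff hinj, not_le]
      rwa [h22, h2] at hlt
    have hsteps' : Steps 6 ⟨[R], τ⟩ ⟨[rounds d, select d], (τ.setReg 6 0).setReg 7 0⟩ := by
      refine .head (c' := ⟨[.seq (.seq (.set 6 (.const 0)) (.set 7 (.const 0)))
        (.seq (rounds d) (select d))], τ⟩) ?_ (.head rfl (.head rfl (.head (c' := ⟨[.set 7 (.const 0),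
          .seq (rounds d) (select d)], τ.setReg 6 0⟩) ?_ (.head (c' := ⟨[.seq (rounds d) (select d)],
            (τ.setReg 6 0).setReg 7 0⟩) ?_ (.head rfl (.refl _))))))
      · simp [hR, step, Test.holds, Term.eval, hlt]
      · simp [step, Term.eval]
      · simp [step, Term.eval]
    have hround : AtRound (Reach n Y v m k) n Y v m k ε n Y v k 0
        ((τ.setReg 6 0).setReg 7 0) := by
      refine ⟨⟨by simpa using hinτ.size, by simpa using hinτ.m, by simpa using hinτ.k,
        by simpa using hinτ.ε, hinτ.coord, hinτ.weight⟩, hho.of_eq (by simp) fun _ _ => rfl,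
        by simpa using h5, by simp, by simp, le_rfl, hvpos, hinj, ?_, ?_, by simpa using hnot⟩
      · intro r _ h; simpa using h
      · intro r _ h; simpa using h
    -- In dimension 0 there is only one point, but this branch has at least two.
    have hd : 0 < d := by
      rcases Nat.eq_zero_or_pos d with rfl | h
      · have h2n := hround.inv.two_le hG hf0 ((hf f hf0).1 le_rfl)
        exact absurd (hinj 0 (by omega) 1 (by omega) (Subsingleton.elim _ _)) (by norm_num)
      · exact h
    have hK : ∀ L ρ, AtEnd (Reach n Y v m k) n Y v m k ε L ρ → ∀ N,
        cost good N ⟨[select d], ρ⟩ ≤ ENNReal.ofReal (selectCost d * (n / ε ^ d)) := by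
      intro L ρ hE N
      obtain ⟨t, ht, π, hπ, -, hst⟩ := select_run (fun i hi => (hvpos i hi).le) hε hE hf0 hf
      have h6 := (hst []).cost_le good N
      rw [hdone π hπ, add_zero] at h6
      refine h6.trans ?_
      rw [← ENNReal.ofReal_natCast]
      exact ENNReal.ofReal_le_ofReal
        (le_trans (by exact_mod_cast ht) (selectTime_le hd hn hε hε1))
    have h7 := rounds_cost_le hG hf0 ((hf f hf0).1 le_rfl) hK N n Y v k 0 _ hround
    calc ENNReal.ofReal (61 * n) + cost good N ⟨[R], τ⟩
        ≤ ENNReal.ofReal (61 * n) + (ENNReal.ofReal 6 + (ENNReal.ofReal (selectCost d * (n / ε ^ d)) +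
          ENNReal.ofReal (roundsCost d * n))) := by
          gcongr
          refine (hsteps'.cost_le good N).trans ?_
          gcongr
          simp
      _ = ENNReal.ofReal (61 * n + (6 + (selectCost d * (n / ε ^ d) + roundsCost d * n))) := by
          rw [← ENNReal.ofReal_add (by positivity) (by positivity),
            ← ENNReal.ofReal_add (by norm_num) (by positivity),
            ← ENNReal.ofReal_add (by positivity) (by positivity)]
      _ ≤ _ := by
          refine ENNReal.ofReal_le_ofReal ?_
          linarith
  · have hreach : Reach n Y v m k 0 := by
      rw [reach_zero_iff hinj, ← not_lt]
      rwa [h22, h2] at hlt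
    have hfz : f = 0 := le_antisymm ((hf 0 le_rfl).2 hreach) hf0
    have hsteps' : Steps 2 ⟨[R], τ⟩ ⟨[], τ.setReg 0 0⟩ := by
      refine .head (c' := ⟨[.set 0 (.const 0)], τ⟩) ?_ (.head (c' := ⟨[], τ.setReg 0 0⟩) ?_ (.refl _))
      · simp [hR, step, Test.holds, Term.eval, hlt]
      · simp [step, Term.eval]
    have h3 := hsteps'.cost_le good N
    rw [hdone _ (by simp [hgood, hfz])] at h3
    calc ENNReal.ofReal (61 * n) + cost good N ⟨[R], τ⟩
        ≤ ENNReal.ofReal (61 * n) + ENNReal.ofReal 2 := by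
          gcongr
          simpa using h3
      _ = ENNReal.ofReal (61 * n + 2) := by
          rw [← ENNReal.ofReal_add (by positivity) (by norm_num)]
      _ ≤ _ := by
          refine ENNReal.ofReal_le_ofReal ?_
          linarith

theorem theoremk (d : ℕ) :
    ∃ (P : RealRAM.Cmd) (C : ℝ),
      ∀ (n : ℕ) (p : Fin n → EuclideanSpace ℝ (Fin d)) (w : Fin n → ℕ) (m k : ℕ) (ε : ℝ),
        Function.Injective p → (∀ i, 0 < w i) →
        1 ≤ m → m + 1 ≤ ∑ i, w i → 1 ≤ k → k ≤ ∑ i, w i →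
        0 < ε → ε ≤ 1 →
        RealRAM.OutputsOnly P (NeighborDistance.inputStore p w m k ε)
          (fun out =>
            NeighborDistance.kthMthNeighborDist (NeighborDistance.copies p w) m k ≤ out ∧
            out ≤ (1 + ε) *
              NeighborDistance.kthMthNeighborDist (NeighborDistance.copies p w) m k) ∧
        RealRAM.expectedTime P (NeighborDistance.inputStore p w m k ε) ≤
          ENNReal.ofReal (C * n / ε ^ d) :=
  ⟨NeighborDistance.algorithm d,
    80 + NeighborDistance.roundsCost d + NeighborDistance.selectCost d,
    fun _ p w m k ε hp hw hm hmc hk hkc hε hε1 =>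
      RealRAM.spec_of_cost_le ENNReal.ofReal_ne_top
        (algorithm_spec p w m k ε hp hw hm hmc hk hkc hε hε1)⟩
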